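/- Let $G$ be a real Lie group with Lie algebra $\mathfrak g$, let $H$ be a connected Abelian Lie subgroup of $G$ with Lie algebra $\mathfrak h$, fix a basis $h_1,\dots,h_l$ of $\mathfrak h$, and let $\lambda^1,\dots,\lambda^l$ be the induced linear coordinates on $\mathfrak h^*$. Regard $\wedge^2\mathfrak g$ as the space of skew tensors in $\mathfrak g\otimes\mathfrak g$ ($X\wedge Y=X\otimes Y-Y\otimes X$). Let $r:\mathfrak h^*\to\wedge^2\mathfrak g$ be a triangular dynamical $r$-matrix, i.e. a smooth map with $[h,r(\lambda)]=0$ for all $h\in\mathfrak h$, $\lambda\in\mathfrak h^*$, and $\sum_i h_i\wedge\frac{\partial r}{\partial\lambda^i}+\frac12[r,r]=0$. For $u$ in $U\mathfrak g$ or $U\mathfrak g\otimes U\mathfrak g$ let $\vec u$ denote the corresponding left-invariant (bi)differential operator on $M=\mathfrak h^*\times G$, and equip $M$ with the Poisson bivector $\pi=\sum_i\vec h_i\wedge\frac{\partial}{\partial\lambda^i}+\overrightarrow{r(\lambda)}$. Put $$\theta=\tfrac12\sum_{i=1}^l\Big(h_i\otimes\tfrac{\partial}{\partial\lambda^i}-\tfrac{\partial}{\partial\lambda^i}\otimes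 h_i\Big),\qquad \Theta=\exp(\hbar\theta).$$ A *quantization* of $r$ is a smooth map $F:\mathfrak h^*\to(U\mathfrak g\otimes U\mathfrak g)[[\hbar]]$, $F=1+\hbar F_1+O(\hbar^2)$, such that, for all $\lambda$, 1. $[1\otimes h+h\otimes1,F(\lambda)]=0$ for all $h\in\mathfrak h$; 2. $(\Delta\otimes\mathrm{id})F(\lambda)\;F^{12}(\lambda-\tfrac12\hbar h^{(3)})=(\mathrm{id}\otimes\Delta)F(\lambda)\;F^{23}(\lambda+\tfrac12\hbar h^{(1)})$, where $F^{12}(\lambda-\tfrac12\hbar h^{(3)})=\sum_k\frac1{k!}(-\frac\hbar2)^k\sum_{i_1,\dots,i_k}\frac{\partial^kF}{\partial\lambda^{i_1}\cdots\partial\lambda^{i_k}}\otimes h_{i_1}\cdots h_{i_k}$ and $F^{23}(\lambda+\tfrac12\hbar h^{(1)})=\sum_k\frac1{k!}(\frac\hbar2)^k\sum_{i_1,\dots,i_k}h_{i_1}\cdots h_{i_k}\otimes\frac{\partial^kF}{\partial\lambda^{i_1}\cdots\partial\lambda^{i_k}}$; 3. $(\epsilon\otimes\mathrm{id})F(\lambda)=1=(\mathrm{id}\otimes\epsilon)F(\lambda)$;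 4. $F_1(\lambda)-F_1^{21}(\lambda)=r(\lambda)$. Here $\Delta$ and $\epsilon$ are the standard comultiplication and counit of $U\mathfrak g$. A *star product* on $(M,\pi)$ is an associative $\mathbb R[[\hbar]]$-bilinear product $f*_\hbar g=fg+\sum_{n\ge1}\hbar^nB_n(f,g)$ on $C^\infty(M)[[\hbar]]$ with unit $1$, with bidifferential operators $B_n$ and $B_1(f,g)-B_1(g,f)=\{f,g\}_\pi$. It is *compatible, with coefficient $F$*, where $F:\mathfrak h^*\to(U\mathfrak g\otimes U\mathfrak g)[[\hbar]]$ is a smooth map, if it is invariant under left translations by $G$ and right translations by $H$ on the factor $G$ of $M$, and * (i) $f*_\hbar g=fg$ for $f,g\in C^\infty(\mathfrak h^*)$; * (ii) $f*_\hbar g=\vec\Theta(f,g)$ and $g*_\hbar f=\vec\Theta(g,f)$ for $f\in C^\infty(\mathfrak h^*)$, $g\in C^\infty(G)$; * (iii) $f*_\hbar g=\overrightarrow{F(\lambda)}(f,g)$ for $f,g\in C^\infty(G)$. Then: (a) If $*_\hbar$ is a compatible star product on $(M,\pi)$ with coefficient $F$, then $F$ is a quantization of $r$, and $f*_\hbar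 g=\overrightarrow{F(\lambda)\Theta}(f,g)$ for all $f,g\in C^\infty(M)$. (b) Every quantization $F$ of $r$ is the coefficient of exactly one compatible star product on $(M,\pi)$. (c) The coefficient $F$ of a compatible star product is unique. Thus quantizations of $r$ correspond bijectively to compatible star products on $(M,\pi)$. -/

import Mathlib

open scoped Manifold ContDiff TensorProduct Topology

noncomputable section

namespace DynQuant

/-! ### Universal enveloping algebras -/

section Algebraic

variable {𝔤 : Type*} [LieRing 𝔤] [LieAlgebra ℝ 𝔤]

/-- The universal enveloping algebra `U𝔤` of a real Lie algebra. -/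
abbrev UEA (𝔤 : Type*) [LieRing 𝔤] [LieAlgebra ℝ 𝔤] : Type _ := UniversalEnvelopingAlgebra ℝ 𝔤

/-- The canonical map `𝔤 → U𝔤`. -/
def incl : 𝔤 →ₗ[ℝ] UEA 𝔤 where
  toFun X := UniversalEnvelopingAlgebra.ι ℝ X
  map_add' X Y := map_add _ X Y
  map_smul' c X := map_smul _ c X

section Hopf

attribute [local instance] LieRing.ofAssociativeRing

/-- The standard comultiplication of `U𝔤`, with `Δ X = X ⊗ 1 + 1 ⊗ X` for `X ∈ 𝔤`. -/
def comul : UEA 𝔤 →ₐ[ℝ] UEA 𝔤 ⊗[ℝ] UEA 𝔤 :=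
  UniversalEnvelopingAlgebra.lift ℝ
    { toFun := fun X => incl X ⊗ₜ[ℝ] (1 : UEA 𝔤) + (1 : UEA 𝔤) ⊗ₜ[ℝ] incl X
      map_add' := fun X Y => by
        rw [map_add, TensorProduct.add_tmul, TensorProduct.tmul_add]; abel
      map_smul' := fun c X => by
        simp only [map_smul, TensorProduct.smul_tmul', TensorProduct.tmul_smul, smul_add,
          RingHom.id_apply]
      map_lie' := fun {X Y} => by
        have h : incl ⁅X, Y⁆ = incl X * incl Y - incl Y * incl X :=
          LieHom.map_lie (UniversalEnvelopingAlgebra.ι ℝ) X Y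
        rw [h, LieRing.of_associative_ring_bracket]
        simp only [mul_add, add_mul, Algebra.TensorProduct.tmul_mul_tmul, one_mul, mul_one,
          TensorProduct.sub_tmul, TensorProduct.tmul_sub]
        abel }

/-- The counit of `U𝔤`, vanishing on `𝔤`. -/
def counit : UEA 𝔤 →ₐ[ℝ] ℝ :=
  UniversalEnvelopingAlgebra.lift ℝ (0 : 𝔤 →ₗ⁅ℝ⁆ ℝ)

end Hopf

/-- `U𝔤 ⊗ U𝔤`. -/
abbrev UEA₂ (𝔤 : Type*) [LieRing 𝔤] [LieAlgebra ℝ 𝔤] : Type _ := UEA 𝔤 ⊗[ℝ] UEA 𝔤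

/-- `U𝔤 ⊗ U𝔤 ⊗ U𝔤`. -/
abbrev UEA₃ (𝔤 : Type*) [LieRing 𝔤] [LieAlgebra ℝ 𝔤] : Type _ := UEA 𝔤 ⊗[ℝ] UEA₂ 𝔤

/-- `Δ ⊗ id`. -/
def comulLeft : UEA₂ 𝔤 →ₐ[ℝ] UEA₃ 𝔤 :=
  (Algebra.TensorProduct.assoc ℝ ℝ ℝ (UEA 𝔤) (UEA 𝔤) (UEA 𝔤)).toAlgHom.comp
    (Algebra.TensorProduct.map comul (AlgHom.id ℝ (UEA 𝔤)))

/-- `id ⊗ Δ`. -/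
def comulRight : UEA₂ 𝔤 →ₐ[ℝ] UEA₃ 𝔤 :=
  Algebra.TensorProduct.map (AlgHom.id ℝ (UEA 𝔤)) comul

/-- `ε ⊗ id`. -/
def counitLeft : UEA₂ 𝔤 →ₐ[ℝ] UEA 𝔤 :=
  (Algebra.TensorProduct.lid ℝ (UEA 𝔤)).toAlgHom.comp
    (Algebra.TensorProduct.map counit (AlgHom.id ℝ (UEA 𝔤)))

/-- `id ⊗ ε`. -/
def counitRight : UEA₂ 𝔤 →ₐ[ℝ] UEA 𝔤 :=
  (Algebra.TensorProduct.rid ℝ ℝ (UEA 𝔤)).toAlgHom.comp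
    (Algebra.TensorProduct.map (AlgHom.id ℝ (UEA 𝔤)) counit)

/-- The flip `a ↦ a²¹`. -/
def flip : UEA₂ 𝔤 →ₐ[ℝ] UEA₂ 𝔤 :=
  (Algebra.TensorProduct.comm ℝ (UEA 𝔤) (UEA 𝔤)).toAlgHom

/-- `a ↦ a¹² = a ⊗ 1`. -/
def leg12 : UEA₂ 𝔤 →ₐ[ℝ] UEA₃ 𝔤 :=
  (Algebra.TensorProduct.assoc ℝ ℝ ℝ (UEA 𝔤) (UEA 𝔤) (UEA 𝔤)).toAlgHom.comp
    Algebra.TensorProduct.includeLeft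

/-- `u ⊗ v ↦ u ⊗ 1 ⊗ v`. -/
def leg13 : UEA₂ 𝔤 →ₐ[ℝ] UEA₃ 𝔤 :=
  Algebra.TensorProduct.map (AlgHom.id ℝ (UEA 𝔤)) Algebra.TensorProduct.includeRight

/-- `a ↦ a²³ = 1 ⊗ a`. -/
def leg23 : UEA₂ 𝔤 →ₐ[ℝ] UEA₃ 𝔤 := Algebra.TensorProduct.includeRight

/-- `u ↦ u ⊗ 1 ⊗ 1`. -/
def leg1 (u : UEA 𝔤) : UEA₃ 𝔤 := u ⊗ₜ[ℝ] (1 : UEA₂ 𝔤)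

/-- `u ↦ 1 ⊗ u ⊗ 1`. -/
def leg2 (u : UEA 𝔤) : UEA₃ 𝔤 := (1 : UEA 𝔤) ⊗ₜ[ℝ] (u ⊗ₜ[ℝ] (1 : UEA 𝔤))

/-- `u ↦ 1 ⊗ 1 ⊗ u`. -/
def leg3 (u : UEA 𝔤) : UEA₃ 𝔤 := (1 : UEA 𝔤) ⊗ₜ[ℝ] ((1 : UEA 𝔤) ⊗ₜ[ℝ] u)

/-- The canonical map `𝔤 ⊗ 𝔤 → U𝔤 ⊗ U𝔤`. -/
def incl₂ : 𝔤 ⊗[ℝ] 𝔤 →ₗ[ℝ] UEA₂ 𝔤 := TensorProduct.map incl incl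

/-! ### Smooth functions on `𝔥*` with values in a vector space -/

/-- The dual `V*` of a finite-dimensional real vector space, as a normed space. -/
def DualSpace (V : Type*) [AddCommGroup V] [Module ℝ V] : Type _ := Module.Dual ℝ V

section DualSpace

variable (V : Type*) [AddCommGroup V] [Module ℝ V]

instance : AddCommGroup (DualSpace V) := inferInstanceAs (AddCommGroup (Module.Dual ℝ V))

instance : Module ℝ (DualSpace V) := inferInstanceAs (Module ℝ (Module.Dual ℝ V))

/-- Coordinates on `V*` with respect to some basis of `V`. -/
def DualSpace.coords [Module.Finite ℝ V] :
    DualSpace V →ₗ[ℝ] (Fin (Module.finrank ℝ V) → ℝ) where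
  toFun := fun (φ : Module.Dual ℝ V) i => φ (Module.finBasis ℝ V i)
  map_add' _ _ := rfl
  map_smul' _ _ := rfl

lemma DualSpace.coords_injective [Module.Finite ℝ V] :
    Function.Injective (DualSpace.coords V) := fun φ ψ h =>
  (Module.finBasis ℝ V).ext (f₁ := (show Module.Dual ℝ V from φ))
    (f₂ := (show Module.Dual ℝ V from ψ)) fun i => congrFun h i

/-- A norm on the finite-dimensional space `V*` (all norms on it are equivalent, so that the
topology and the smooth structure do not depend on the choice). -/
instance [Module.Finite ℝ V] : NormedAddCommGroup (DualSpace V) :=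
  NormedAddCommGroup.induced (DualSpace V) (Fin (Module.finrank ℝ V) → ℝ)
    (DualSpace.coords V) (DualSpace.coords_injective V)

instance [Module.Finite ℝ V] : NormedSpace ℝ (DualSpace V) :=
  NormedSpace.induced ℝ (DualSpace V) (Fin (Module.finrank ℝ V) → ℝ) (DualSpace.coords V)

end DualSpace

section VectorValued

variable {P V : Type*} [NormedAddCommGroup P] [NormedSpace ℝ P] [AddCommGroup V] [Module ℝ V]

/-- A map from `P` to a real vector space `V` (possibly infinite-dimensional, without topology) is
smooth if locally it is a finite sum `∑ⱼ aⱼ vⱼ` with smooth real functions `aⱼ` and `vⱼ ∈ V`. -/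
def IsSmooth (F : P → V) : Prop :=
  ∀ p₀ : P, ∃ (m : ℕ) (v : Fin m → V) (a : Fin m → P → ℝ),
    (∀ j, ContDiff ℝ ∞ (a j)) ∧ ∀ᶠ p in 𝓝 p₀, F p = ∑ j, a j p • v j

/-- The derivative of `F : P → V` at `p` in the direction `ξ`: the vector `w` such that
`φ w = ∂_ξ (φ ∘ F) (p)` for all linear forms `φ` on `V`. (There is at most one such vector, and
there is one if `F` is smooth.) -/
def partialDeriv (ξ : P) (F : P → V) (p : P) : V :=
  Classical.epsilon fun w : V =>
    ∀ φ : Module.Dual ℝ V, HasLineDerivAt ℝ (fun q => φ (F q)) (φ w) p ξ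

end VectorValued

/-! ### Triangular dynamical r-matrices and their quantizations -/

variable {𝔥 : LieSubalgebra ℝ 𝔤} {l : ℕ}

/-- The `i`-th vector `ξᵢ` of the dual basis, i.e. the direction of `∂/∂λⁱ`. -/
def dualVec (b : Module.Basis (Fin l) ℝ 𝔥) (i : Fin l) : DualSpace 𝔥 := b.coord i

/-- `∂ᵏF / ∂λ^{i₁} ⋯ ∂λ^{iₖ}`. -/
def iterPartial [Module.Finite ℝ 𝔥] {V : Type*} [AddCommGroup V] [Module ℝ V]
    (b : Module.Basis (Fin l) ℝ 𝔥) {k : ℕ} (i : Fin k → Fin l) (F : DualSpace 𝔥 → V) :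
    DualSpace 𝔥 → V :=
  (List.ofFn i).foldr (fun j F' => partialDeriv (dualVec b j) F') F

/-- `h_{i₁} ⋯ h_{iₖ} ∈ U𝔤`. -/
def hMonomial (b : Module.Basis (Fin l) ℝ 𝔥) {k : ℕ} (i : Fin k → Fin l) : UEA 𝔤 :=
  (List.ofFn fun j => incl (b (i j) : 𝔤)).prod

/-- The left-hand side of the classical dynamical Yang-Baxter equation
`∑ᵢ hᵢ ∧ ∂r/∂λⁱ + ½ [r, r] = 0`, for skew-symmetric `r`. Here `∧³ 𝔤 ⊆ 𝔤 ⊗ 𝔤 ⊗ 𝔤` consists of the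
skew-symmetric tensors, `h ∧ s = h¹ s²³ - h² s¹³ + h³ s¹²` and
`½ [r, r] = [r¹², r¹³] + [r¹², r²³] + [r¹³, r²³]`. -/
def cdybe [Module.Finite ℝ 𝔥] (b : Module.Basis (Fin l) ℝ 𝔥) (r : DualSpace 𝔥 → 𝔤 ⊗[ℝ] 𝔤)
    (p : DualSpace 𝔥) : UEA₃ 𝔤 :=
  let r12 : UEA₃ 𝔤 := leg12 (incl₂ (r p))
  let r13 : UEA₃ 𝔤 := leg13 (incl₂ (r p))
  let r23 : UEA₃ 𝔤 := leg23 (incl₂ (r p))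
  (∑ i : Fin l,
      (leg1 (incl (b i : 𝔤)) * leg23 (incl₂ (partialDeriv (dualVec b i) r p))
        - leg2 (incl (b i : 𝔤)) * leg13 (incl₂ (partialDeriv (dualVec b i) r p))
        + leg3 (incl (b i : 𝔤)) * leg12 (incl₂ (partialDeriv (dualVec b i) r p))))
    + ((r12 * r13 - r13 * r12) + (r12 * r23 - r23 * r12) + (r13 * r23 - r23 * r13))

/-- Triangular dynamical r-matrices `r : 𝔥* → ∧² 𝔤`, where `∧² 𝔤` is the space of skew-symmetric
tensors in `𝔤 ⊗ 𝔤`, with `X ∧ Y = X ⊗ Y - Y ⊗ X`. -/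
structure IsTriangularRMatrix [Module.Finite ℝ 𝔥] (b : Module.Basis (Fin l) ℝ 𝔥)
    (r : DualSpace 𝔥 → 𝔤 ⊗[ℝ] 𝔤) : Prop where
  smooth : IsSmooth r
  skew : ∀ p, TensorProduct.comm ℝ 𝔤 𝔤 (r p) = - r p
  zero_weight : ∀ (h : 𝔥) (p), ⁅(h : 𝔤), r p⁆ = 0
  cdybe_eq_zero : ∀ p, cdybe b r p = 0

/-- `F¹²(λ - ½ ħ h⁽³⁾) = ∑ₖ (1/k!) (-ħ/2)ᵏ ∑_{i₁,…,iₖ} ∂ᵏF/∂λ^{i₁}⋯∂λ^{iₖ} ⊗ h_{i₁}⋯h_{iₖ}`. -/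
def shift12 [Module.Finite ℝ 𝔥] (b : Module.Basis (Fin l) ℝ 𝔥)
    (F : DualSpace 𝔥 → PowerSeries (UEA₂ 𝔤)) (p : DualSpace 𝔥) : PowerSeries (UEA₃ 𝔤) :=
  PowerSeries.mk fun n => ∑ km ∈ Finset.HasAntidiagonal.antidiagonal n,
    (((km.1.factorial : ℝ))⁻¹ * (-(1 / 2 : ℝ)) ^ km.1) •
      ∑ i : Fin km.1 → Fin l,
        leg12 (iterPartial b i (fun q => PowerSeries.coeff km.2 (F q)) p) * leg3 (hMonomial b i)

/-- `F²³(λ + ½ ħ h⁽¹⁾) = ∑ₖ (1/k!) (ħ/2)ᵏ ∑_{i₁,…,iₖ} h_{i₁}⋯h_{iₖ} ⊗ ∂ᵏF/∂λ^{i₁}⋯∂λ^{iₖ}`. -/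
def shift23 [Module.Finite ℝ 𝔥] (b : Module.Basis (Fin l) ℝ 𝔥)
    (F : DualSpace 𝔥 → PowerSeries (UEA₂ 𝔤)) (p : DualSpace 𝔥) : PowerSeries (UEA₃ 𝔤) :=
  PowerSeries.mk fun n => ∑ km ∈ Finset.HasAntidiagonal.antidiagonal n,
    (((km.1.factorial : ℝ))⁻¹ * (1 / 2 : ℝ) ^ km.1) •
      ∑ i : Fin km.1 → Fin l,
        leg1 (hMonomial b i) * leg23 (iterPartial b i (fun q => PowerSeries.coeff km.2 (F q)) p)

/-- `F` is a smooth function on `𝔥*` with values in `(U𝔤 ⊗ U𝔤)[[ħ]]`. -/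
def IsSmoothSeries [Module.Finite ℝ 𝔥] (F : DualSpace 𝔥 → PowerSeries (UEA₂ 𝔤)) : Prop :=
  ∀ n, IsSmooth fun p => PowerSeries.coeff n (F p)

/-- Quantizations of a triangular dynamical r-matrix. -/
structure IsQuantization [Module.Finite ℝ 𝔥] (b : Module.Basis (Fin l) ℝ 𝔥)
    (r : DualSpace 𝔥 → 𝔤 ⊗[ℝ] 𝔤) (F : DualSpace 𝔥 → PowerSeries (UEA₂ 𝔤)) : Prop where
  smooth : IsSmoothSeries F
  coeff_zero : ∀ p, PowerSeries.coeff 0 (F p) = 1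
  zero_weight : ∀ (h : 𝔥) (p),
    Commute (PowerSeries.C ((1 : UEA 𝔤) ⊗ₜ[ℝ] incl (h : 𝔤) + incl (h : 𝔤) ⊗ₜ[ℝ] (1 : UEA 𝔤))) (F p)
  shifted_cocycle : ∀ p,
    PowerSeries.map (comulLeft (𝔤 := 𝔤)).toRingHom (F p) * shift12 b F p
      = PowerSeries.map (comulRight (𝔤 := 𝔤)).toRingHom (F p) * shift23 b F p
  normal_left : ∀ p, PowerSeries.map (counitLeft (𝔤 := 𝔤)).toRingHom (F p) = 1
  normal_right : ∀ p, PowerSeries.map (counitRight (𝔤 := 𝔤)).toRingHom (F p) = 1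
  quantization : ∀ p,
    PowerSeries.coeff 1 (F p) - flip (PowerSeries.coeff 1 (F p)) = incl₂ (r p)

end Algebraic

/-! ### Vector fields acting on functions -/

section VectorFields

variable {E : Type*} [NormedAddCommGroup E] [NormedSpace ℝ E]

/-- The derivative `df_x(v)` of a real function along a tangent vector. -/
def tderiv {N : Type*} [TopologicalSpace N] [ChartedSpace E N] (f : N → ℝ) (x : N)
    (v : TangentSpace 𝓘(ℝ, E) x) : ℝ :=
  mfderiv 𝓘(ℝ, E) 𝓘(ℝ, ℝ) f x v

open VectorField in
lemma fderiv_mpullback_apply {N : Type*} [TopologicalSpace N] [ChartedSpace E N]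
    [IsManifold 𝓘(ℝ, E) 2 N] [CompleteSpace E] (V : Π x : N, TangentSpace 𝓘(ℝ, E) x) (x : N)
    (g : N → ℝ) (y : E) (hy : y ∈ (extChartAt 𝓘(ℝ, E) x).target)
    (hg : MDifferentiableAt 𝓘(ℝ, E) 𝓘(ℝ, ℝ) g ((extChartAt 𝓘(ℝ, E) x).symm y)) :
    (fderiv ℝ (g ∘ (extChartAt 𝓘(ℝ, E) x).symm) y
      (mpullbackWithin 𝓘(ℝ, E) 𝓘(ℝ, E) (extChartAt 𝓘(ℝ, E) x).symm V
        (Set.range 𝓘(ℝ, E)) y) : ℝ)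
    = tderiv g ((extChartAt 𝓘(ℝ, E) x).symm y) (V ((extChartAt 𝓘(ℝ, E) x).symm y)) := by
  have hI := isInvertible_mfderivWithin_extChartAt_symm (I := 𝓘(ℝ, E)) hy
  have hd := mdifferentiableWithinAt_extChartAt_symm (I := 𝓘(ℝ, E)) hy
  rw [mpullbackWithin_apply]
  have hr : Set.range 𝓘(ℝ, E) = Set.univ := by simp
  rw [hr, mfderivWithin_univ] at hI ⊢
  rw [hr, mdifferentiableWithinAt_univ] at hd
  obtain ⟨e, he⟩ := hI
  rw [← mfderiv_eq_fderiv]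
  have := mfderiv_comp_apply y hg hd
    ((mfderiv 𝓘(ℝ, E) 𝓘(ℝ, E) (extChartAt 𝓘(ℝ, E) x).symm y).inverse
      (V ((extChartAt 𝓘(ℝ, E) x).symm y)))
  refine this.trans ?_
  rw [← he, ContinuousLinearMap.inverse_equiv]
  exact congrArg _ (e.apply_symm_apply _)

open VectorField in
/-- The Lie bracket of vector fields acts on functions as the commutator. -/
lemma tderiv_mlieBracket {N : Type*} [TopologicalSpace N] [ChartedSpace E N]
    [IsManifold 𝓘(ℝ, E) 2 N] [CompleteSpace E]
    {V W : Π x : N, TangentSpace 𝓘(ℝ, E) x} {x : N} {f : N → ℝ}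
    (hf : ContMDiff 𝓘(ℝ, E) 𝓘(ℝ, ℝ) 2 f)
    (hV : MDifferentiableAt 𝓘(ℝ, E) (𝓘(ℝ, E)).tangent
      (fun x => (⟨x, V x⟩ : TangentBundle 𝓘(ℝ, E) N)) x)
    (hW : MDifferentiableAt 𝓘(ℝ, E) (𝓘(ℝ, E)).tangent
      (fun x => (⟨x, W x⟩ : TangentBundle 𝓘(ℝ, E) N)) x)
    (hVf : MDifferentiableAt 𝓘(ℝ, E) 𝓘(ℝ, ℝ) (fun y => tderiv f y (V y)) x)
    (hWf : MDifferentiableAt 𝓘(ℝ, E) 𝓘(ℝ, ℝ) (fun y => tderiv f y (W y)) x) :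
    tderiv f x (mlieBracket 𝓘(ℝ, E) V W x)
      = tderiv (fun y => tderiv f y (W y)) x (V x)
        - tderiv (fun y => tderiv f y (V y)) x (W x) := by
  have hr : Set.range 𝓘(ℝ, E) = Set.univ := by simp
  set φ := extChartAt 𝓘(ℝ, E) x with hφ
  have hx : φ.symm (φ x) = x := extChartAt_to_inv x
  have ht : φ x ∈ φ.target := mem_extChartAt_target x
  have htn : φ.target ∈ 𝓝 (φ x) := extChartAt_target_mem_nhds x
  set V' := mpullbackWithin 𝓘(ℝ, E) 𝓘(ℝ, E) φ.symm V (Set.range 𝓘(ℝ, E)) with hV'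
  set W' := mpullbackWithin 𝓘(ℝ, E) 𝓘(ℝ, E) φ.symm W (Set.range 𝓘(ℝ, E)) with hW'
  have hfd : MDifferentiable 𝓘(ℝ, E) 𝓘(ℝ, ℝ) f := hf.mdifferentiable (by norm_num)
  have kV := fun y hy => fderiv_mpullback_apply V x f y hy (hfd _)
  have kW := fun y hy => fderiv_mpullback_apply W x f y hy (hfd _)
  have kVW := fderiv_mpullback_apply V x _ (φ x) ht (hx.symm ▸ hWf)
  have kWV := fderiv_mpullback_apply W x _ (φ x) ht (hx.symm ▸ hVf)
  rw [← hφ] at kVW kWV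
  simp only [← hφ, ← hV', ← hW'] at kV kW kVW kWV
  have eV : ((fun y => tderiv f y (V y)) ∘ φ.symm) =ᶠ[𝓝 (φ x)]
      fun y => fderiv ℝ (f ∘ φ.symm) y (V' y) := by
    filter_upwards [htn] with y hy
    exact (kV y hy).symm
  have eW : ((fun y => tderiv f y (W y)) ∘ φ.symm) =ᶠ[𝓝 (φ x)]
      fun y => fderiv ℝ (f ∘ φ.symm) y (W' y) := by
    filter_upwards [htn] with y hy
    exact (kW y hy).symm
  rw [eW.fderiv_eq, hx] at kVW
  rw [eV.fderiv_eq, hx] at kWV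
  rw [← kVW, ← kWV]
  have dV : DifferentiableAt ℝ V' (φ x) := by
    have := hV.mdifferentiableWithinAt
      (s := Set.univ) |>.differentiableWithinAt_mpullbackWithin_vectorField
    rw [Set.preimage_univ, Set.univ_inter, ← hφ, ← hV', hr] at this
    exact differentiableWithinAt_univ.mp this
  have dW : DifferentiableAt ℝ W' (φ x) := by
    have := hW.mdifferentiableWithinAt
      (s := Set.univ) |>.differentiableWithinAt_mpullbackWithin_vectorField
    rw [Set.preimage_univ, Set.univ_inter, ← hφ, ← hW', hr] at this
    exact differentiableWithinAt_univ.mp this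
  have hF : ContDiffAt ℝ 2 (f ∘ φ.symm) (φ x) := by
    rw [← contMDiffAt_iff_contDiffAt]
    exact hf.contMDiffAt.comp _ ((contMDiffOn_extChartAt_symm x).contMDiffAt htn)
  rw [← fderiv_apply_lieBracket hF (by simp) dW dV]
  rw [← mlieBracketWithin_univ, mlieBracketWithin_apply, ← hφ, ← hV', ← hW']
  have hd : MDifferentiableAt 𝓘(ℝ, E) 𝓘(ℝ, E) φ x :=
    mdifferentiableAt_extChartAt (mem_chart_source E x)
  have hI := isInvertible_mfderiv_extChartAt (I := 𝓘(ℝ, E))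
    (mem_extChartAt_source (I := 𝓘(ℝ, E)) x)
  rw [← hφ] at hI
  obtain ⟨e, he⟩ := hI
  have hfe : f =ᶠ[𝓝 x] (f ∘ φ.symm) ∘ φ := by
    filter_upwards [extChartAt_source_mem_nhds (I := 𝓘(ℝ, E)) x] with y hy
    exact congrArg f ((extChartAt 𝓘(ℝ, E) x).left_inv hy).symm
  unfold tderiv
  rw [hfe.mfderiv_eq]
  have hgd : MDifferentiableAt 𝓘(ℝ, E) 𝓘(ℝ, ℝ) (f ∘ φ.symm) (φ x) :=
    (hF.differentiableAt (by norm_num)).mdifferentiableAt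
  refine (mfderiv_comp_apply x hgd hd _).trans ?_
  rw [mfderiv_eq_fderiv, ← he, ContinuousLinearMap.inverse_equiv]
  refine (congrArg _ (e.apply_symm_apply _)).trans ?_
  rw [Set.preimage_univ, Set.univ_inter, hr]
  exact congrArg (fun z => fderiv ℝ (f ∘ φ.symm) (φ x) z)
    (congrFun (lieBracketWithin_univ (V := V') (W := W')) (φ x))

end VectorFields

/-! ### Differential operators on `M = P × G` -/

section Manifold

variable {E P G : Type*} [NormedAddCommGroup E] [NormedSpace ℝ E]
  [NormedAddCommGroup P] [NormedSpace ℝ P]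
  [TopologicalSpace G] [ChartedSpace E G] [Group G] [LieGroup 𝓘(ℝ, E) ∞ G]

instance : LieGroup 𝓘(ℝ, E) (minSmoothness ℝ 3) G := by
  rw [minSmoothness_of_isRCLikeNormedField]; infer_instance

instance [FiniteDimensional ℝ E] : Module.Finite ℝ (GroupLieAlgebra 𝓘(ℝ, E) G) :=
  inferInstanceAs (Module.Finite ℝ E)

/-- The algebra `C^∞(P × G)` of smooth real functions. -/
abbrev Fn (E P G : Type*) [NormedAddCommGroup E] [NormedSpace ℝ E]
    [NormedAddCommGroup P] [NormedSpace ℝ P] [TopologicalSpace G] [ChartedSpace E G] : Type _ :=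
  C^∞⟮(𝓘(ℝ, P)).prod 𝓘(ℝ, E), P × G; 𝓘(ℝ, ℝ), ℝ⟯

lemma contMDiff_dP (f : Fn E P G) (v : P) :
    ContMDiff ((𝓘(ℝ, P)).prod 𝓘(ℝ, E)) 𝓘(ℝ, ℝ) ∞
      (fun p : P × G => fderiv ℝ (fun q => f (q, p.2)) p.1 v) := by
  intro p₀
  have h := ContMDiffAt.mfderiv (n := ∞) (m := ∞) (I := 𝓘(ℝ, P)) (I' := 𝓘(ℝ, ℝ))
    (J := (𝓘(ℝ, P)).prod 𝓘(ℝ, E)) (x₀ := p₀)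
    (fun (p : P × G) (q : P) => f (q, p.2)) (fun p => p.1) ?_ contMDiffAt_fst (by simp)
  · have e := inTangentCoordinates_model_space (I := 𝓘(ℝ, P)) (I' := 𝓘(ℝ, ℝ))
      (fun p : P × G => p.1) (fun p => f (p.1, p.2))
      (fun p => fderiv ℝ (fun q => f (q, p.2)) p.1) p₀
    have h' : ContMDiffAt ((𝓘(ℝ, P)).prod 𝓘(ℝ, E)) 𝓘(ℝ, P →L[ℝ] ℝ) ∞
        (fun p : P × G => fderiv ℝ (fun q => f (q, p.2)) p.1) p₀ := by
      rw [← e]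
      simp only [mfderiv_eq_fderiv] at h
      exact h
    exact h'.clm_apply contMDiffAt_const
  · exact (f.contMDiff.comp
      (contMDiff_snd.prodMk (contMDiff_snd.comp contMDiff_fst))).contMDiffAt

lemma contMDiff_slice (f : Fn E P G) (p : P) :
    ContMDiff 𝓘(ℝ, E) 𝓘(ℝ, ℝ) ∞ (fun y : G => f (p, y)) :=
  f.contMDiff.comp (ContMDiff.prodMk contMDiff_const contMDiff_id)

lemma contMDiff_slice' (f : Fn E P G) (x : G) :
    ContMDiff 𝓘(ℝ, P) 𝓘(ℝ, ℝ) ∞ (fun q : P => f (q, x)) :=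
  f.contMDiff.comp (ContMDiff.prodMk contMDiff_id contMDiff_const)

lemma tderiv_left_translate (f : Fn E P G) (X : GroupLieAlgebra 𝓘(ℝ, E) G) (p : P × G) :
    tderiv (fun y : G => f (p.1, y)) p.2 (mulInvariantVectorField X p.2)
      = tderiv (fun y : G => f (p.1, p.2 * y)) 1 X := by
  have h2 : MDifferentiableAt 𝓘(ℝ, E) 𝓘(ℝ, ℝ) (fun y : G => f (p.1, y)) p.2 :=
    ((contMDiff_slice f p.1).mdifferentiable (by simp)).mdifferentiableAt
  have h3 : MDifferentiableAt 𝓘(ℝ, E) 𝓘(ℝ, E) (fun y : G => p.2 * y) 1 :=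
    ((contMDiff_mul_left (n := ∞)).mdifferentiable (by simp)).mdifferentiableAt
  exact (mfderiv_comp_apply_of_eq _ h2 h3 (mul_one _) X).symm

lemma contMDiff_dG (f : Fn E P G) (X : GroupLieAlgebra 𝓘(ℝ, E) G) :
    ContMDiff ((𝓘(ℝ, P)).prod 𝓘(ℝ, E)) 𝓘(ℝ, ℝ) ∞
      (fun p : P × G => tderiv (fun y : G => f (p.1, y)) p.2 (mulInvariantVectorField X p.2)) := by
  simp only [tderiv_left_translate]
  intro p₀
  have h := ContMDiffAt.mfderiv (n := ∞) (m := ∞) (I := 𝓘(ℝ, E)) (I' := 𝓘(ℝ, ℝ))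
    (J := (𝓘(ℝ, P)).prod 𝓘(ℝ, E)) (x₀ := p₀)
    (fun (p : P × G) (y : G) => f (p.1, p.2 * y)) (fun p => 1) ?_ contMDiffAt_const (by simp)
  · let D : P × G → E →L[ℝ] ℝ :=
      fun p => mfderiv 𝓘(ℝ, E) 𝓘(ℝ, ℝ) (fun y : G => f (p.1, p.2 * y)) 1
    have e : ∀ p, inTangentCoordinates 𝓘(ℝ, E) 𝓘(ℝ, ℝ) (fun p : P × G => (1 : G))
        (fun p => f (p.1, p.2 * 1)) D p₀ p = D p := by
      intro p
      rw [inTangentCoordinates_eq]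
      · ext v
        have h1 := (tangentBundleCore 𝓘(ℝ, E) G).coordChange_self
          (achart E 1) 1 (mem_chart_source E 1) v
        simp only [ContinuousLinearMap.comp_apply]
        rw [h1]
        simp
      · simp
      · exact Set.mem_univ _
    have h' : ContMDiffAt ((𝓘(ℝ, P)).prod 𝓘(ℝ, E)) 𝓘(ℝ, E →L[ℝ] ℝ) ∞ D p₀ := by
      have e' : D = inTangentCoordinates 𝓘(ℝ, E) 𝓘(ℝ, ℝ) (fun p : P × G => (1 : G))
        (fun p => f (p.1, p.2 * 1)) D p₀ := funext fun p => (e p).symm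
      rw [e']
      exact h
    have hX : ContMDiffAt ((𝓘(ℝ, P)).prod 𝓘(ℝ, E)) 𝓘(ℝ, E) ∞
      (fun _ : P × G => (show E from X)) p₀ := contMDiffAt_const
    have h'' : ContMDiffAt ((𝓘(ℝ, P)).prod 𝓘(ℝ, E)) 𝓘(ℝ, ℝ) ∞
      (fun p => D p (show E from X)) p₀ := h'.clm_apply hX
    exact h''
  · refine (f.contMDiff.comp (ContMDiff.prodMk (contMDiff_fst.comp contMDiff_fst) ?_)).contMDiffAt
    exact (contMDiff_snd.comp contMDiff_fst).mul contMDiff_snd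

/-- The vector field on `P × G` given by a constant vector `v` of `P`. -/
def partialP (v : P) : Module.End ℝ (Fn E P G) where
  toFun f := ⟨fun p => fderiv ℝ (fun q => f (q, p.2)) p.1 v, contMDiff_dP f v⟩
  map_add' f g := by
    ext p
    have hf : DifferentiableAt ℝ (fun q => f (q, p.2)) p.1 :=
      ((contMDiff_slice' f p.2).contDiff.differentiable (by simp)).differentiableAt
    have hg : DifferentiableAt ℝ (fun q => g (q, p.2)) p.1 :=
      ((contMDiff_slice' g p.2).contDiff.differentiable (by simp)).differentiableAt
    exact congrArg (fun L => L v) (fderiv_add hf hg)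
  map_smul' c f := by
    ext p
    have hf : DifferentiableAt ℝ (fun q => f (q, p.2)) p.1 :=
      ((contMDiff_slice' f p.2).contDiff.differentiable (by simp)).differentiableAt
    exact congrArg (fun L => L v) (fderiv_const_smul hf c)

/-- The left-invariant vector field `X⃗` on `P × G` generated by `X` in the Lie algebra of `G`. -/
def leftInvField (X : GroupLieAlgebra 𝓘(ℝ, E) G) : Module.End ℝ (Fn E P G) where
  toFun f := ⟨fun p => tderiv (fun y => f (p.1, y)) p.2 (mulInvariantVectorField X p.2),
    contMDiff_dG f X⟩
  map_add' f g := by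
    ext p
    have hf := ((contMDiff_slice f p.1).mdifferentiable (by simp)) p.2
    have hg := ((contMDiff_slice g p.1).mdifferentiable (by simp)) p.2
    exact congrArg (fun L => L (mulInvariantVectorField X p.2)) (mfderiv_add hf hg)
  map_smul' c f := by
    ext p
    have hf := ((contMDiff_slice f p.1).mdifferentiable (by simp)) p.2
    exact congrArg (fun L => L (mulInvariantVectorField X p.2)) (const_smul_mfderiv hf c)

lemma leftInvField_add (X Y : GroupLieAlgebra 𝓘(ℝ, E) G) :
    (leftInvField (X + Y) : Module.End ℝ (Fn E P G)) = leftInvField X + leftInvField Y := by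
  ext f p
  refine (tderiv_left_translate f (X + Y) p).trans ?_
  refine Eq.trans ?_ (congrArg₂ (· + ·) (tderiv_left_translate f X p).symm
    (tderiv_left_translate f Y p).symm)
  exact map_add (mfderiv 𝓘(ℝ, E) 𝓘(ℝ, ℝ) (fun y : G => f (p.1, p.2 * y)) 1) X Y

lemma leftInvField_smul (c : ℝ) (X : GroupLieAlgebra 𝓘(ℝ, E) G) :
    (leftInvField (c • X) : Module.End ℝ (Fn E P G)) = c • leftInvField X := by
  ext f p
  refine (tderiv_left_translate f (c • X) p).trans ?_
  refine Eq.trans ?_ (congrArg (c • ·) (tderiv_left_translate f X p).symm)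
  exact map_smul (mfderiv 𝓘(ℝ, E) 𝓘(ℝ, ℝ) (fun y : G => f (p.1, p.2 * y)) 1) c X

lemma leftInvField_lie [FiniteDimensional ℝ E] (X Y : GroupLieAlgebra 𝓘(ℝ, E) G) :
    (leftInvField ⁅X, Y⁆ : Module.End ℝ (Fn E P G))
      = leftInvField X * leftInvField Y - leftInvField Y * leftInvField X := by
  have : CompleteSpace E := FiniteDimensional.complete ℝ E
  ext f p
  have key := tderiv_mlieBracket (V := mulInvariantVectorField X)
    (W := mulInvariantVectorField Y) (x := p.2)
    ((contMDiff_slice f p.1).of_le (ENat.LEInfty.out))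
    (mdifferentiableAt_mulInvariantVectorField X) (mdifferentiableAt_mulInvariantVectorField Y)
    (((contMDiff_slice (leftInvField X f) p.1).mdifferentiable (by simp)) p.2)
    (((contMDiff_slice (leftInvField Y f) p.1).mdifferentiable (by simp)) p.2)
  rw [← mulInvariantVector_mlieBracket] at key
  exact key

section Enveloping

attribute [local instance] LieRing.ofAssociativeRing

variable (E P G) in
/-- The action `u ↦ u⃗` of `U𝔤` on `C^∞(P × G)` by left-invariant differential operators. -/
def leftInvOp [FiniteDimensional ℝ E] :
    UEA (GroupLieAlgebra 𝓘(ℝ, E) G) →ₐ[ℝ] Module.End ℝ (Fn E P G) :=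
  UniversalEnvelopingAlgebra.lift ℝ
    { toFun := leftInvField
      map_add' := leftInvField_add
      map_smul' := leftInvField_smul
      map_lie' := fun {X Y} => leftInvField_lie X Y }

end Enveloping

variable (E P G) in
/-- The action of `U𝔤 ⊗ U𝔤` on `C^∞(M) ⊗ C^∞(M)`, for `M = P × G`. -/
def leftInvOp₂ [FiniteDimensional ℝ E] :
    UEA₂ (GroupLieAlgebra 𝓘(ℝ, E) G) →ₐ[ℝ] Module.End ℝ (Fn E P G ⊗[ℝ] Fn E P G) :=
  (Module.endTensorEndAlgHom (R := ℝ) (S := ℝ) (A := ℝ) (M := Fn E P G) (N := Fn E P G)).comp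
    (Algebra.TensorProduct.map (leftInvOp E P G) (leftInvOp E P G))

/-- The value at `p` of the bidifferential operator `(f, g) ↦ μ (D (f ⊗ g))`, where `μ` is the
multiplication of functions. -/
def biop (D : Module.End ℝ (Fn E P G ⊗[ℝ] Fn E P G)) (f g : Fn E P G) (p : P × G) : ℝ :=
  LinearMap.mul' ℝ (Fn E P G) (D (f ⊗ₜ[ℝ] g)) p

/-- `f(λ)`, as a function on `P × G`. -/
def ofP (f : C^∞⟮𝓘(ℝ, P), P; 𝓘(ℝ, ℝ), ℝ⟯) : Fn E P G :=
  ⟨fun p => f p.1, f.contMDiff.comp contMDiff_fst⟩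

/-- `f(x)`, as a function on `P × G`. -/
def ofG (f : C^∞⟮𝓘(ℝ, E), G; 𝓘(ℝ, ℝ), ℝ⟯) : Fn E P G :=
  ⟨fun p => f p.2, f.contMDiff.comp contMDiff_snd⟩

/-- `(λ, x) ↦ f (λ, a x c)`. -/
def translate (a c : G) (f : Fn E P G) : Fn E P G :=
  ⟨fun p => f (p.1, a * p.2 * c),
    f.contMDiff.comp (contMDiff_fst.prodMk ((contMDiff_const.mul contMDiff_snd).mul
      contMDiff_const))⟩

/-- The ideal of smooth functions on `P × G` that vanish at `q`. -/
def vanishingIdeal (q : P × G) : Ideal (Fn E P G) where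
  carrier := {f | f q = 0}
  add_mem' {f g} hf hg := by
    have hf' : f q = 0 := hf
    have hg' : g q = 0 := hg
    simp [hf', hg']
  zero_mem' := rfl
  smul_mem' c f hf := by
    have hf' : f q = 0 := hf
    simp [hf']

/-- Bidifferential operators on `P × G`. Locally, the value of `B f g` at a point `q` depends only
on the Taylor polynomials of some fixed order `n` of `f` and `g` at `q`; the functions whose
Taylor polynomial of order `n` at `q` vanishes are those in the `n+1`-st power of the ideal of
`q`. -/
def IsBidifferential (B : Fn E P G →ₗ[ℝ] Fn E P G →ₗ[ℝ] Fn E P G) : Prop :=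
  ∀ q₀ : P × G, ∃ n : ℕ, ∀ᶠ q in 𝓝 q₀, ∀ f g : Fn E P G,
    (f ∈ vanishingIdeal q ^ (n + 1) ∨ g ∈ vanishingIdeal q ^ (n + 1)) → B f g q = 0

end Manifold

/-! ### Compatible star products on `M = 𝔥* × G` -/

section Star

variable {E G : Type*} [NormedAddCommGroup E] [NormedSpace ℝ E] [FiniteDimensional ℝ E]
  [TopologicalSpace G] [ChartedSpace E G] [Group G] [LieGroup 𝓘(ℝ, E) ∞ G]
  {𝔥 : LieSubalgebra ℝ (GroupLieAlgebra 𝓘(ℝ, E) G)} {l : ℕ}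

/-- The value at `p` of the Poisson bracket of `f` and `g` for the bivector field
`π = ∑ᵢ h⃗ᵢ ∧ ∂/∂λⁱ + r⃗(λ)` on `M = 𝔥* × G`. -/
def poissonBracket (b : Module.Basis (Fin l) ℝ 𝔥)
    (r : DualSpace 𝔥 → GroupLieAlgebra 𝓘(ℝ, E) G ⊗[ℝ] GroupLieAlgebra 𝓘(ℝ, E) G)
    (f g : Fn E (DualSpace 𝔥) G) (p : DualSpace 𝔥 × G) : ℝ :=
  ∑ i : Fin l,
      (leftInvField (b i : GroupLieAlgebra 𝓘(ℝ, E) G) f p * partialP (dualVec b i) g p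
        - partialP (dualVec b i) f p * leftInvField (b i : GroupLieAlgebra 𝓘(ℝ, E) G) g p)
    + biop (leftInvOp₂ E (DualSpace 𝔥) G (incl₂ (r p.1))) f g p

/-- Star products `f * g = ∑ₙ ħⁿ B n f g` on `(M, π)` (extended `ħ`-linearly to `C^∞(M)[[ħ]]`): the
`B n` are bidifferential operators, `*` is associative with unit `1`, and
`f * g = f g + O(ħ)`, `f * g - g * f = ħ {f, g} + O(ħ²)`. -/
structure IsStarProduct (b : Module.Basis (Fin l) ℝ 𝔥)
    (r : DualSpace 𝔥 → GroupLieAlgebra 𝓘(ℝ, E) G ⊗[ℝ] GroupLieAlgebra 𝓘(ℝ, E) G)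
    (B : ℕ → Fn E (DualSpace 𝔥) G →ₗ[ℝ] Fn E (DualSpace 𝔥) G →ₗ[ℝ] Fn E (DualSpace 𝔥) G) :
    Prop where
  bidifferential : ∀ n, IsBidifferential (B n)
  coeff_zero : ∀ f g, B 0 f g = f * g
  assoc : ∀ n f g h,
    ∑ ij ∈ Finset.HasAntidiagonal.antidiagonal n, B ij.1 (B ij.2 f g) h
      = ∑ ij ∈ Finset.HasAntidiagonal.antidiagonal n, B ij.1 f (B ij.2 g h)
  one_left : ∀ n f, B n 1 f = if n = 0 then f else 0
  one_right : ∀ n f, B n f 1 = if n = 0 then f else 0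
  poisson : ∀ f g p, B 1 f g p - B 1 g f p = poissonBracket b r f g p

/-- `θ = ½ ∑ᵢ (hᵢ ⊗ ∂/∂λⁱ - ∂/∂λⁱ ⊗ hᵢ)`, acting on `C^∞(M) ⊗ C^∞(M)`. -/
def theta (b : Module.Basis (Fin l) ℝ 𝔥) :
    Module.End ℝ (Fn E (DualSpace 𝔥) G ⊗[ℝ] Fn E (DualSpace 𝔥) G) :=
  (1 / 2 : ℝ) • ∑ i : Fin l,
    (TensorProduct.map (leftInvField (b i : GroupLieAlgebra 𝓘(ℝ, E) G)) (partialP (dualVec b i))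
      - TensorProduct.map (partialP (dualVec b i))
          (leftInvField (b i : GroupLieAlgebra 𝓘(ℝ, E) G)))

/-- `Θ = exp (ħ θ)`. -/
def Theta (b : Module.Basis (Fin l) ℝ 𝔥) :
    PowerSeries (Module.End ℝ (Fn E (DualSpace 𝔥) G ⊗[ℝ] Fn E (DualSpace 𝔥) G)) :=
  PowerSeries.mk fun k => ((k.factorial : ℝ))⁻¹ • theta b ^ k

/-- The formal operator on `C^∞(M) ⊗ C^∞(M)` defined by an element of `(U𝔤 ⊗ U𝔤)[[ħ]]`. -/
def arrow (F : PowerSeries (UEA₂ (GroupLieAlgebra 𝓘(ℝ, E) G))) :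
    PowerSeries (Module.End ℝ (Fn E (DualSpace 𝔥) G ⊗[ℝ] Fn E (DualSpace 𝔥) G)) :=
  PowerSeries.map (leftInvOp₂ E (DualSpace 𝔥) G).toRingHom F

/-- `F` is the coefficient function of the compatible star product `∑ₙ ħⁿ B n` on `(M, π)`:
the star product is invariant under left translations by `G` and right translations by the
subgroup `ι(H)`, it is given by pointwise multiplication on `C^∞(𝔥*)` and by `Θ` on functions of
`λ` and functions of `x`, and `F` is a smooth map such that `f * g = F⃗(λ)(f, g)` for functions
`f`, `g` of `x`. -/
structure IsCompatible {H : Type*} [Group H] (ι : H →* G) (b : Module.Basis (Fin l) ℝ 𝔥)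
    (r : DualSpace 𝔥 → GroupLieAlgebra 𝓘(ℝ, E) G ⊗[ℝ] GroupLieAlgebra 𝓘(ℝ, E) G)
    (B : ℕ → Fn E (DualSpace 𝔥) G →ₗ[ℝ] Fn E (DualSpace 𝔥) G →ₗ[ℝ] Fn E (DualSpace 𝔥) G)
    (F : DualSpace 𝔥 → PowerSeries (UEA₂ (GroupLieAlgebra 𝓘(ℝ, E) G))) : Prop where
  isStarProduct : IsStarProduct b r B
  invariant : ∀ n (a : G) (c : H) f g,
    B n (translate a (ι c) f) (translate a (ι c) g) = translate a (ι c) (B n f g)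
  pointwise : ∀ n f g, B n (ofP f) (ofP g) = if n = 0 then ofP f * ofP g else 0
  theta_left : ∀ n f g p,
    B n (ofP f) (ofG g) p = biop (PowerSeries.coeff n (Theta b)) (ofP f) (ofG g) p
  theta_right : ∀ n f g p,
    B n (ofG g) (ofP f) p = biop (PowerSeries.coeff n (Theta b)) (ofG g) (ofP f) p
  smooth : IsSmoothSeries F
  coefficient : ∀ n f g p,
    B n (ofG f) (ofG g) p = biop (PowerSeries.coeff n (arrow (F p.1))) (ofG f) (ofG g) p

/-- `ι : H → G` is a connected Lie subgroup (an injective immersion of a connected Lie group) with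
Lie algebra `𝔥`. -/
structure IsConnectedLieSubgroup {E' H : Type*} [NormedAddCommGroup E'] [NormedSpace ℝ E']
    [TopologicalSpace H] [ChartedSpace E' H] [Group H] (ι : H →* G)
    (𝔥 : LieSubalgebra ℝ (GroupLieAlgebra 𝓘(ℝ, E) G)) : Prop where
  connected : ConnectedSpace H
  smooth : ContMDiff 𝓘(ℝ, E') 𝓘(ℝ, E) ∞ ι
  injective : Function.Injective ι
  immersion : ∀ c : H, Function.Injective (mfderiv 𝓘(ℝ, E') 𝓘(ℝ, E) ι c)
  lieAlgebra : ∀ X : GroupLieAlgebra 𝓘(ℝ, E) G,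
    X ∈ 𝔥 ↔ ∃ Y : GroupLieAlgebra 𝓘(ℝ, E') H, (mfderiv 𝓘(ℝ, E') 𝓘(ℝ, E) ι 1 Y : E) = X

end Star

end DynQuant

end

noncomputable section

namespace DynQuant

/-! ### Hadamard's lemma -/

section Hadamard

variable {V : Type*} [NormedAddCommGroup V] [NormedSpace ℝ V] [FiniteDimensional ℝ V]

/-! Everything rests on a formula for triple products. Write `f * g` for the product with symbol
`F⃗(λ) Θ`. The vector fields `h⃗ᵢ` and `∂/∂λⁱ` are derivations, and `h⃗ᵢ` passes through `F⃗(λ)`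
because `F` has zero weight. Hence `θ` applied to `F⃗(λ)(f, g) ⊗ k` is `θ₁₃ + θ₂₃` acting inside,
plus the term `-½ ∑ᵢ (∂ᵢF)⃗(f, g) ⊗ h⃗ᵢ k`. All operators involved commute, since `𝔥` is abelian,
and exponentiating the extra term gives a formal Taylor shift of `F`. So `(f * g) * k` has the
symbol `(Δ ⊗ id)F · F¹²(λ - ½ħh⁽³⁾) · exp(ħ(θ₁₂ + θ₁₃ + θ₂₃))`, and `f * (g * k)` has the symbol
`(id ⊗ Δ)F · F²³(λ + ½ħh⁽¹⁾)` times the same exponential (`starOp_rTensor`, `starOp_lTensor`).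

The shifted cocycle equation therefore implies associativity (`starOp_assoc`). Conversely, on
functions of `x` alone the exponential acts trivially, and associativity gives the equation, because
elements of `U𝔤`, `U𝔤 ⊗ U𝔤` and `U𝔤 ⊗ U𝔤 ⊗ U𝔤` are determined by their action on functions on `G`.
This separation property is proved by reading off the principal symbol of `u ∈ U𝔤` from its values
on powers of functions vanishing at the unit (`UEA.eq_zero_of_forall_apply_pow`). It also gives the
uniqueness of the coefficient and the remaining conditions on `F`.

It remains to see that a compatible star product with coefficient `F` must be `F⃗(λ) Θ`
(`IsParamStar.eq_starBilin`). By definition the two agree when each argument is a function of `λ`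
alone or of `x` alone. At a given order, if they agree at all lower orders, their difference
satisfies the Hochschild cocycle identity on the triples on which both are associative
(`eq_of_eq_on_generators`). The product `F⃗(λ) Θ` is not yet known to be associative, but it is so
if one of three functions depends only on `λ`: then the symbol matters only after the counit is
applied to that leg, and both sides of the cocycle equation become `F` by normalization alone
(`starOp_assoc_of_mem_legSub`). These triples suffice to make the difference vanish on products
`a(λ) u(x)`. A bidifferential operator is determined by its values on such products, since their
sums realize all Taylor polynomials (Hadamard's lemma, `exists_prodSpan_sub_mem_pow`).

Finally, zero weight of `F` is invariance under right translations by `H`: differentiation along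
curves through the unit gives one direction, and integration along curves together with
connectedness of `H` gives the other (`mem_zeroWeight`, `translateHom_invariant`). -/

theorem hasFDerivAt_parametric_integral {F : V → ℝ → ℝ}
    (hF : ContDiff ℝ ∞ (Function.uncurry F)) (z : V) :
    HasFDerivAt (fun z => ∫ t in (0 : ℝ)..1, F z t)
      (∫ t in (0 : ℝ)..1, fderiv ℝ (fun z => F z t) z) z := by
  have hd : Continuous fun p : V × ℝ => fderiv ℝ (fun z => F z p.2) p.1 := by
    have : ContDiff ℝ ∞ fun p : V × ℝ => fderiv ℝ (fun z => F z p.2) p.1 :=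
      ContDiff.fderiv (m := ∞) (n := ∞) (f := fun (p : V × ℝ) z => F z p.2)
        (hF.comp (contDiff_snd.prodMk (contDiff_snd.comp contDiff_fst))) contDiff_fst (by simp)
    exact this.continuous
  have hc : ∀ z, Continuous (F z) := fun z =>
    hF.continuous.comp (Continuous.prodMk continuous_const continuous_id)
  -- Balls are compact in finite dimension, so the derivative of the integrand is bounded by a
  -- constant, which serves as the dominating function.
  obtain ⟨C, hC⟩ := ((isCompact_closedBall z 1).prod
    (isCompact_Icc (a := (0 : ℝ)) (b := 1))).exists_bound_of_continuousOn hd.continuousOn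
  refine intervalIntegral.hasFDerivAt_integral_of_dominated_of_fderiv_le
    (F := F) (F' := fun z t => fderiv ℝ (fun z => F z t) z) (bound := fun _ => C)
    (Metric.closedBall_mem_nhds z one_pos) ?_ ?_ ?_ ?_ ?_ ?_
  · exact Filter.Eventually.of_forall fun z => (hc z).aestronglyMeasurable
  · exact (hc z).intervalIntegrable _ _
  · exact (hd.comp (Continuous.prodMk continuous_const continuous_id)).aestronglyMeasurable
  · refine Filter.Eventually.of_forall fun t ht x hx => hC (x, t) ⟨hx, ?_⟩
    rw [Set.uIoc_of_le zero_le_one] at ht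
    exact ⟨ht.1.le, ht.2⟩
  · exact intervalIntegrable_const
  · refine Filter.Eventually.of_forall fun t _ x _ => ?_
    have : ContDiff ℝ ∞ fun z => F z t := hF.comp (contDiff_id.prodMk contDiff_const)
    exact (this.differentiable (by simp) x).hasFDerivAt

/-- Induction on the order of differentiability, for all integrands at once: differentiation under
the integral sign shows that the derivative in a direction `v` is again an integral of the same
kind. -/
theorem contDiff_parametric_integral {F : V → ℝ → ℝ}
    (hF : ContDiff ℝ ∞ (Function.uncurry F)) :
    ContDiff ℝ ∞ fun z => ∫ t in (0 : ℝ)..1, F z t := by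
  rw [contDiff_infty]
  intro n
  induction n generalizing F with
  | zero =>
    refine contDiff_zero.2 ?_
    exact intervalIntegral.continuous_parametric_intervalIntegral_of_continuous'
      (f := F) hF.continuous 0 1
  | succ n ih =>
    rw [Nat.cast_succ]
    refine contDiff_succ_iff_fderiv_apply.2 ⟨fun z =>
      (hasFDerivAt_parametric_integral hF z).differentiableAt,
      fun h => absurd h (by simp), fun v => ?_⟩
    have hd : ContDiff ℝ ∞ fun p : V × ℝ => fderiv ℝ (fun z => F z p.2) p.1 :=
      ContDiff.fderiv (m := ∞) (n := ∞) (f := fun (p : V × ℝ) z => F z p.2)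
        (hF.comp (contDiff_snd.prodMk (contDiff_snd.comp contDiff_fst))) contDiff_fst (by simp)
    have := ih (F := fun z t => fderiv ℝ (fun z => F z t) z v) (hd.clm_apply contDiff_const)
    convert this using 2 with z
    rw [(hasFDerivAt_parametric_integral hF z).fderiv, ContinuousLinearMap.intervalIntegral_apply]
    exact (hd.continuous.comp
      (Continuous.prodMk continuous_const continuous_id)).intervalIntegrable _ _

/-- Hadamard's lemma. -/
theorem exists_hadamard {ι : Type*} [Fintype ι] (b : Module.Basis ι ℝ V) {F : V → ℝ}
    (hF : ContDiff ℝ ∞ F) (z₀ : V) :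
    ∃ K : ι → V → ℝ, (∀ i, ContDiff ℝ ∞ (K i)) ∧
      ∀ z, F z = F z₀ + ∑ i, b.repr (z - z₀) i * K i z := by
  have hdF : ContDiff ℝ ∞ (fderiv ℝ F) := hF.fderiv_right (by simp)
  -- The coefficients are the averages of the partial derivatives along the segment from `z₀` to
  -- `z`; the formula is the fundamental theorem of calculus on this segment.
  refine ⟨fun i z => ∫ t in (0 : ℝ)..1, fderiv ℝ F (z₀ + t • (z - z₀)) (b i), fun i => ?_,
    fun z => ?_⟩
  · refine contDiff_parametric_integral (F := fun z t => fderiv ℝ F (z₀ + t • (z - z₀)) (b i)) ?_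
    refine (hdF.comp ?_).clm_apply contDiff_const
    exact contDiff_const.add (contDiff_snd.smul (contDiff_fst.sub contDiff_const))
  · have hc : ∀ v, Continuous fun t : ℝ => fderiv ℝ F (z₀ + t • (z - z₀)) v := fun v =>
      (hdF.continuous.comp (by fun_prop)).clm_apply continuous_const
    have h := intervalIntegral.integral_eq_sub_of_hasDerivAt (a := 0) (b := 1)
      (f := fun t : ℝ => F (z₀ + t • (z - z₀)))
      (f' := fun t => fderiv ℝ F (z₀ + t • (z - z₀)) (z - z₀)) (fun t _ => ?_)
      ((hc _).intervalIntegrable _ _)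
    · simp only [one_smul, zero_smul, add_zero, add_sub_cancel] at h
      rw [← sub_eq_iff_eq_add', ← h]
      calc _ = ∫ t in (0 : ℝ)..1, ∑ i, b.repr (z - z₀) i *
              fderiv ℝ F (z₀ + t • (z - z₀)) (b i) := by
            congr 1
            ext t
            conv_lhs => rw [← b.sum_repr (z - z₀)]
            rw [map_sum]
            refine Finset.sum_congr rfl fun i _ => ?_
            rw [map_smul, smul_eq_mul, b.sum_repr]
        _ = _ := by
            rw [intervalIntegral.integral_finsetSum fun i _ =>
              ((hc _).const_mul _).intervalIntegrable _ _]
            simp only [intervalIntegral.integral_const_mul]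
    · have h1 : HasDerivAt (fun t : ℝ => z₀ + t • (z - z₀)) (z - z₀) t := by
        simpa using ((hasDerivAt_id t).smul_const (z - z₀)).const_add z₀
      exact ((hF.differentiable (by simp) _).hasFDerivAt).comp_hasDerivAt t h1

end Hadamard

end DynQuant
end

noncomputable section

namespace DynQuant

/-! ### Charts and inverse charts made global by cut-off functions -/

section Charts

variable {E N : Type*} [NormedAddCommGroup E] [NormedSpace ℝ E] [TopologicalSpace N]
  [ChartedSpace E N] [IsManifold 𝓘(ℝ, E) ∞ N]

/-- The tangent space at `x` is by construction the model space, seen through the preferred chart at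
`x`. -/
theorem mfderiv_extChartAt_self (x : N) :
    mfderiv 𝓘(ℝ, E) 𝓘(ℝ, E) (extChartAt 𝓘(ℝ, E) x) x = ContinuousLinearMap.id ℝ E := by
  have : IsManifold 𝓘(ℝ, E) 1 N := IsManifold.of_le (n := ∞) (by simp)
  refine (mfderiv_chartAt_eq_tangentCoordChange (I := 𝓘(ℝ, E)) (mem_chart_source E x)).trans ?_
  ext v
  exact tangentCoordChange_self (mem_extChartAt_source x)

variable [FiniteDimensional ℝ E]

/-- An inverse chart extends from a neighbourhood of a point to a smooth map on the model space. -/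
theorem exists_contMDiff_eq_extChartAt_symm (x₀ : N) :
    ∃ κ : E → N, ContMDiff 𝓘(ℝ, E) 𝓘(ℝ, E) ∞ κ ∧
      κ =ᶠ[𝓝 (extChartAt 𝓘(ℝ, E) x₀ x₀)] (extChartAt 𝓘(ℝ, E) x₀).symm := by
  set y₀ := extChartAt 𝓘(ℝ, E) x₀ x₀ with hy₀
  obtain ⟨ε, hε, hball⟩ := Metric.mem_nhds_iff.1 (extChartAt_target_mem_nhds (I := 𝓘(ℝ, E)) x₀)
  let β : ContDiffBump (0 : E) := ⟨ε / 2, ε, by positivity, by linarith⟩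
  -- `η` is the identity near `y₀` and maps all of `E` into a ball on which the inverse chart is
  -- defined, so composing with it extends the inverse chart to `E`.
  let η : E → E := fun y => y₀ + β (y - y₀) • (y - y₀)
  have hη : ContDiff ℝ ∞ η := by
    have h := (contDiff_id (𝕜 := ℝ) (E := E) (n := ∞)).sub (contDiff_const (c := y₀))
    exact contDiff_const.add ((β.contDiff.comp h).smul h)
  have hmem : ∀ y, η y ∈ (extChartAt 𝓘(ℝ, E) x₀).target := by
    intro y
    refine hball ?_
    rw [Metric.mem_ball, dist_eq_norm, ← hy₀]
    simp only [η, add_sub_cancel_left]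
    by_cases h : ‖y - y₀‖ < ε
    · rw [norm_smul, Real.norm_of_nonneg β.nonneg]
      exact (mul_le_of_le_one_left (norm_nonneg _) β.le_one).trans_lt h
    · rw [β.zero_of_le_dist (by simpa using h)]
      simpa using hε
  refine ⟨fun y => (extChartAt 𝓘(ℝ, E) x₀).symm (η y), ?_, ?_⟩
  · exact (contMDiffOn_extChartAt_symm x₀).comp_contMDiff hη.contMDiff hmem
  · have : ∀ᶠ y in 𝓝 y₀, y - y₀ ∈ Metric.ball (0 : E) (ε / 2) := by
      filter_upwards [Metric.ball_mem_nhds y₀ (half_pos hε)] with y hy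
      simpa [dist_eq_norm] using hy
    filter_upwards [this] with y hy
    simp only [η]
    rw [β.one_of_mem_closedBall (Metric.ball_subset_closedBall hy), one_smul, add_sub_cancel]

/-- A chart extends from a neighbourhood of a point to a smooth map on the manifold. -/
theorem exists_contMDiff_eq_extChartAt [T2Space N] (x₀ : N) :
    ∃ φ : N → E, ContMDiff 𝓘(ℝ, E) 𝓘(ℝ, E) ∞ φ ∧
      φ =ᶠ[𝓝 x₀] extChartAt 𝓘(ℝ, E) x₀ := by
  let β : SmoothBumpFunction 𝓘(ℝ, E) x₀ := Classical.arbitrary _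
  refine ⟨fun x => β x • extChartAt 𝓘(ℝ, E) x₀ x, ?_, ?_⟩
  · exact β.contMDiff_smul contMDiffOn_extChartAt
  · filter_upwards [β.eventuallyEq_one] with x hx
    rw [hx]
    simp

/-- Smooth functions with prescribed differential at a point. -/
theorem exists_contMDiff_tderiv_eq [T2Space N] (x₀ : N) (ℓ : E →L[ℝ] ℝ) :
    ∃ f : C^∞⟮𝓘(ℝ, E), N; 𝓘(ℝ, ℝ), ℝ⟯, f x₀ = 0 ∧
      ∀ v : TangentSpace 𝓘(ℝ, E) x₀, tderiv f x₀ v = ℓ v := by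
  obtain ⟨φ, hφ, hφ₀⟩ := exists_contMDiff_eq_extChartAt (E := E) x₀
  have hg : ContDiff ℝ ∞ fun y => ℓ (y - φ x₀) := ℓ.contDiff.comp (contDiff_id.sub contDiff_const)
  refine ⟨⟨fun x => ℓ (φ x - φ x₀), hg.contMDiff.comp hφ⟩, by simp, fun v => ?_⟩
  have h1 : HasMFDerivAt 𝓘(ℝ, E) 𝓘(ℝ, E) φ x₀ (ContinuousLinearMap.id ℝ E) := by
    rw [← mfderiv_extChartAt_self x₀, ← hφ₀.mfderiv_eq]
    exact (hφ.mdifferentiable (by simp) x₀).hasMFDerivAt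
  have h2 : HasFDerivAt (fun y => ℓ (y - φ x₀)) ℓ (φ x₀) :=
    ℓ.hasFDerivAt.comp (φ x₀) ((hasFDerivAt_id _).sub_const _)
  have h3 := (h2.hasMFDerivAt.comp x₀ h1).mfderiv
  exact congrArg (fun L => L v) h3

end Charts

/-! ### Taylor polynomials of sums of products `a(λ) u(x)` -/

section Density

variable {E P G : Type*} [NormedAddCommGroup E] [NormedSpace ℝ E]
  [NormedAddCommGroup P] [NormedSpace ℝ P] [TopologicalSpace G] [ChartedSpace E G]

@[simp]
theorem ofP_apply (a : C^∞⟮𝓘(ℝ, P), P; 𝓘(ℝ, ℝ), ℝ⟯) (p : P × G) :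
    (ofP a : Fn E P G) p = a p.1 := rfl

@[simp]
theorem ofG_apply (u : C^∞⟮𝓘(ℝ, E), G; 𝓘(ℝ, ℝ), ℝ⟯) (p : P × G) :
    (ofG u : Fn E P G) p = u p.2 := rfl

theorem mem_vanishingIdeal {q : P × G} {f : Fn E P G} : f ∈ vanishingIdeal q ↔ f q = 0 := Iff.rfl

variable (E P G) in
/-- The span of the products `a(λ) u(x)`. -/
def prodSpan : Submodule ℝ (Fn E P G) :=
  Submodule.span ℝ {f | ∃ a u, f = ofP a * ofG u}

theorem ofP_mul_ofG_mem_prodSpan (a : C^∞⟮𝓘(ℝ, P), P; 𝓘(ℝ, ℝ), ℝ⟯)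
    (u : C^∞⟮𝓘(ℝ, E), G; 𝓘(ℝ, ℝ), ℝ⟯) : (ofP a * ofG u : Fn E P G) ∈ prodSpan E P G :=
  Submodule.subset_span ⟨a, u, rfl⟩

theorem ofP_mem_prodSpan (a : C^∞⟮𝓘(ℝ, P), P; 𝓘(ℝ, ℝ), ℝ⟯) :
    (ofP a : Fn E P G) ∈ prodSpan E P G := by
  have : (ofP a : Fn E P G) = ofP a * ofG 1 := by
    ext p; simp
  rw [this]
  exact ofP_mul_ofG_mem_prodSpan a 1

theorem ofG_mem_prodSpan (u : C^∞⟮𝓘(ℝ, E), G; 𝓘(ℝ, ℝ), ℝ⟯) :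
    (ofG u : Fn E P G) ∈ prodSpan E P G := by
  have : (ofG u : Fn E P G) = ofP 1 * ofG u := by
    ext p; simp
  rw [this]
  exact ofP_mul_ofG_mem_prodSpan 1 u

theorem mul_mem_prodSpan {f g : Fn E P G} (hf : f ∈ prodSpan E P G) (hg : g ∈ prodSpan E P G) :
    f * g ∈ prodSpan E P G := by
  induction hf, hg using Submodule.span_induction₂ with
  | mem_mem x y hx hy =>
    obtain ⟨a, u, rfl⟩ := hx
    obtain ⟨b, v, rfl⟩ := hy
    have : (ofP a * ofG u * (ofP b * ofG v) : Fn E P G) = ofP (a * b) * ofG (u * v) := by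
      ext p; simp; ring
    rw [this]
    exact ofP_mul_ofG_mem_prodSpan _ _
  | zero_left y hy => simp
  | zero_right x hx => simp
  | add_left x y z _ _ _ h1 h2 => rw [add_mul]; exact add_mem h1 h2
  | add_right x y z _ _ _ h1 h2 => rw [mul_add]; exact add_mem h1 h2
  | smul_left r x y _ _ h => rw [smul_mul_assoc]; exact Submodule.smul_mem _ _ h
  | smul_right r x y _ _ h => rw [mul_smul_comm]; exact Submodule.smul_mem _ _ h

variable [FiniteDimensional ℝ E] [FiniteDimensional ℝ P] [T2Space G] [IsManifold 𝓘(ℝ, E) ∞ G]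

/-- For a bump function `ψ` on `G` at `q.2` supported in `S`, one has `k = k (1 - ψ)`, and both
factors vanish at `q`. -/
theorem mem_vanishingIdeal_sq_of_eventuallyEq_zero {q : P × G} {k : Fn E P G} {S : Set G}
    (hS : S ∈ 𝓝 q.2) (hk : ∀ p : P × G, p.2 ∈ S → k p = 0) : k ∈ vanishingIdeal q ^ 2 := by
  obtain ⟨β, -, hβ⟩ := (SmoothBumpFunction.nhds_basis_support (I := 𝓘(ℝ, E)) hS).mem_iff.1 hS
  let ψ : C^∞⟮𝓘(ℝ, E), G; 𝓘(ℝ, ℝ), ℝ⟯ := ⟨β, β.contMDiff⟩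
  have hψ : ∀ x, ψ x = β x := fun _ => rfl
  have h : k = k * (1 - ofG ψ) := by
    ext p
    by_cases hp : p.2 ∈ Function.support β
    · simp [hk p (hβ hp)]
    · have : β p.2 = 0 := by simpa using hp
      simp [hψ, this]
  rw [h, pow_two]
  refine Ideal.mul_mem_mul (hk q (mem_of_mem_nhds hS)) ?_
  rw [mem_vanishingIdeal]
  simp [hψ]

/-- Hadamard's lemma in a chart writes `f` as `∑ ξᵢ Kᵢ` for `x` near `q.2`, with coordinates `ξᵢ`
vanishing at `q`. Freezing the `Kᵢ` at `q` gives the linear part `w` of `f`. -/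
theorem exists_prodSpan_sub_mem_sq {q : P × G} {f : Fn E P G} (hf : f ∈ vanishingIdeal q) :
    ∃ w ∈ prodSpan E P G, w ∈ vanishingIdeal q ∧ f - w ∈ vanishingIdeal q ^ 2 := by
  obtain ⟨φ, hφ, hφ₀⟩ := exists_contMDiff_eq_extChartAt (E := E) q.2
  obtain ⟨κ, hκ, hκ₀⟩ := exists_contMDiff_eq_extChartAt_symm (E := E) q.2
  have hφq : φ q.2 = extChartAt 𝓘(ℝ, E) q.2 q.2 := hφ₀.eq_of_nhds
  have hinv : ∀ᶠ x in 𝓝 q.2, κ (φ x) = x := by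
    have h1 : ∀ᶠ x in 𝓝 q.2, κ (φ x) = (extChartAt 𝓘(ℝ, E) q.2).symm (φ x) :=
      (hφ.continuous.tendsto' q.2 _ hφq).eventually hκ₀
    filter_upwards [h1, hφ₀, extChartAt_source_mem_nhds (I := 𝓘(ℝ, E)) q.2] with x e1 e2 e3
    rw [e1, e2, PartialEquiv.left_inv _ e3]
  have hF : ContDiff ℝ ∞ fun z : P × E => f (z.1, κ z.2) := by
    rw [← contMDiff_iff_contDiff]
    exact f.contMDiff.comp (contDiff_fst.contMDiff.prodMk (hκ.comp contDiff_snd.contMDiff))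
  let b := Module.finBasis ℝ (P × E)
  obtain ⟨K, hK, hFK⟩ := exists_hadamard b hF (q.1, φ q.2)
  let K' : Fin (Module.finrank ℝ (P × E)) → Fn E P G := fun i =>
    ⟨fun p => K i (p.1, φ p.2),
      (hK i).contMDiff.comp (contMDiff_fst.prodMk_space (hφ.comp contMDiff_snd))⟩
  have hc : ∀ i, ContDiff ℝ ∞ fun z => b.coord i z := fun i =>
    (LinearMap.toContinuousLinearMap (b.coord i)).contDiff
  let ξP : Fin (Module.finrank ℝ (P × E)) → C^∞⟮𝓘(ℝ, P), P; 𝓘(ℝ, ℝ), ℝ⟯ := fun i =>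
    ⟨fun a => b.coord i (a - q.1, 0), ((hc i).comp
      ((contDiff_id.sub contDiff_const).prodMk contDiff_const)).contMDiff⟩
  let ξG : Fin (Module.finrank ℝ (P × E)) → C^∞⟮𝓘(ℝ, E), G; 𝓘(ℝ, ℝ), ℝ⟯ := fun i =>
    ⟨fun x => b.coord i (0, φ x - φ q.2), ((hc i).comp
      (contDiff_const.prodMk (contDiff_id.sub contDiff_const))).contMDiff.comp hφ⟩
  -- A linear coordinate on `P × E` is the sum of its restrictions to the two factors, so each `ξ i`
  -- is a function of `λ` plus a function of `x`.
  let ξ : Fin (Module.finrank ℝ (P × E)) → Fn E P G := fun i => ofP (ξP i) + ofG (ξG i)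
  have hξ : ∀ i p, ξ i p = b.repr ((p.1, φ p.2) - (q.1, φ q.2)) i := by
    intro i p
    change b.coord i (p.1 - q.1, 0) + b.coord i (0, φ p.2 - φ q.2) = b.coord i _
    rw [← map_add]
    simp
  have hξ0 : ∀ i, ξ i ∈ vanishingIdeal q := fun i => by
    rw [mem_vanishingIdeal, hξ]; simp
  refine ⟨∑ i, K' i q • ξ i, ?_, ?_, ?_⟩
  · exact Submodule.sum_mem _ fun i _ => Submodule.smul_mem _ _
      (add_mem (ofP_mem_prodSpan _) (ofG_mem_prodSpan _))
  · refine Submodule.sum_mem _ fun i _ => ?_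
    have := hξ0 i
    rw [mem_vanishingIdeal] at this ⊢
    simp [this]
  -- The first bracket vanishes for all `x` near `q.2`; in the second sum each term is a product of
  -- two functions vanishing at `q`.
  · have e : f - ∑ i, K' i q • ξ i = (f - ∑ i, ξ i * K' i) +
        ∑ i, ξ i * (K' i - algebraMap ℝ _ (K' i q)) := by
      simp only [mul_sub, Finset.sum_sub_distrib, Algebra.smul_def, mul_comm]
      abel
    rw [e]
    refine add_mem (mem_vanishingIdeal_sq_of_eventuallyEq_zero hinv fun p hp => ?_) ?_
    · have h0 : f q = 0 := hf
      have hp' : κ (φ p.2) = p.2 := hp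
      have hq' : κ (φ q.2) = q.2 := hinv.self_of_nhds
      have := hFK (p.1, φ p.2)
      simp only [hp', hq'] at this
      rw [h0, zero_add] at this
      rw [ContMDiffMap.coe_sub, Pi.sub_apply, this, sub_eq_zero]
      have hs : (∑ i, ξ i * K' i : Fn E P G) p = ∑ i, (ξ i * K' i : Fn E P G) p :=
        map_sum (ContMDiffMap.evalRingHom p) _ _
      rw [hs]
      refine Finset.sum_congr rfl fun i _ => ?_
      rw [ContMDiffMap.coe_mul, Pi.mul_apply, hξ]
      rfl
    · refine Submodule.sum_mem _ fun i _ => ?_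
      rw [pow_two]
      refine Ideal.mul_mem_mul (hξ0 i) ?_
      rw [mem_vanishingIdeal]
      exact sub_self _

/-- The leading term of a product is the product of the leading terms, by `a c - w v = a (c - v) +
(a - w) v`; so the case of order one extends to all powers of the ideal. -/
theorem exists_prodSpan_sub_mem_pow_succ (q : P × G) (n : ℕ) {f : Fn E P G}
    (hf : f ∈ vanishingIdeal q ^ n) :
    ∃ w ∈ prodSpan E P G, w ∈ vanishingIdeal q ^ n ∧ f - w ∈ vanishingIdeal q ^ (n + 1) := by
  induction n generalizing f with
  | zero =>
    refine ⟨f q • ofP 1, Submodule.smul_mem _ _ (ofP_mem_prodSpan _), by simp, ?_⟩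
    rw [zero_add, pow_one, mem_vanishingIdeal]
    simp
  | succ n ih =>
    rw [pow_succ] at hf
    refine Submodule.smul_induction_on hf (fun a ha c hc => ?_) fun f g hf hg => ?_
    · obtain ⟨w, hw, hw1, hw2⟩ := ih ha
      obtain ⟨v, hv, hv1, hv2⟩ := exists_prodSpan_sub_mem_sq hc
      refine ⟨w * v, mul_mem_prodSpan hw hv, ?_, ?_⟩
      · rw [pow_succ]; exact Ideal.mul_mem_mul hw1 hv1
      · have : a • c - w * v = a * (c - v) + (a - w) * v := by rw [smul_eq_mul]; ring
        rw [this]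
        refine add_mem ?_ ?_
        · rw [show n + 1 + 1 = n + 2 from rfl, pow_add]
          exact Ideal.mul_mem_mul ha hv2
        · rw [pow_succ]
          exact Ideal.mul_mem_mul hw2 hv1
    · obtain ⟨w, hw, hw1, hw2⟩ := hf
      obtain ⟨v, hv, hv1, hv2⟩ := hg
      refine ⟨w + v, add_mem hw hv, add_mem hw1 hv1, ?_⟩
      rw [add_sub_add_comm]
      exact add_mem hw2 hv2

/-- Every Taylor polynomial is the Taylor polynomial of a sum of products `a(λ) u(x)`. -/
theorem exists_prodSpan_sub_mem_pow (q : P × G) (n : ℕ) (f : Fn E P G) :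
    ∃ w ∈ prodSpan E P G, f - w ∈ vanishingIdeal q ^ n := by
  induction n with
  | zero => exact ⟨0, zero_mem _, by simp⟩
  | succ n ih =>
    obtain ⟨w, hw, h⟩ := ih
    obtain ⟨v, hv, -, h'⟩ := exists_prodSpan_sub_mem_pow_succ q n h
    exact ⟨w + v, add_mem hw hv, by rwa [← sub_sub]⟩

/-- A bidifferential operator vanishes if it vanishes on products `a(λ) u(x)`. -/
theorem IsBidifferential.eq_zero {B : Fn E P G →ₗ[ℝ] Fn E P G →ₗ[ℝ] Fn E P G}
    (hB : IsBidifferential B) {S T : Submodule ℝ (Fn E P G)}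
    (hS : S = ⊤ ∨ prodSpan E P G ≤ S) (hT : T = ⊤ ∨ prodSpan E P G ≤ T)
    (h : ∀ f ∈ S, ∀ g ∈ T, B f g = 0) : B = 0 := by
  ext f g q
  obtain ⟨n, hn⟩ := hB q
  have hq := hn.self_of_nhds
  have key : ∀ (S : Submodule ℝ (Fn E P G)), (S = ⊤ ∨ prodSpan E P G ≤ S) → ∀ f,
      ∃ w ∈ S, f - w ∈ vanishingIdeal q ^ (n + 1) := by
    rintro S (rfl | hS) f
    · exact ⟨f, trivial, by simp⟩
    · obtain ⟨w, hw, h⟩ := exists_prodSpan_sub_mem_pow q (n + 1) f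
      exact ⟨w, hS hw, h⟩
  obtain ⟨w, hw, hfw⟩ := key S hS f
  obtain ⟨v, hv, hgv⟩ := key T hT g
  -- Both arguments may be changed, one after the other, by functions vanishing to order greater
  -- than `n` at `q`.
  have e1 := hq (f - w) g (Or.inl hfw)
  have e2 := hq w (g - v) (Or.inr hgv)
  rw [map_sub, LinearMap.sub_apply, ContMDiffMap.coe_sub, Pi.sub_apply, sub_eq_zero] at e1
  rw [map_sub, h w hw v hv, sub_zero] at e2
  rw [e1, e2]
  rfl

end Density

end DynQuant
end

noncomputable section

namespace DynQuant

/-! ### Separation of points in tensor products -/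

/-- Contracting `t` with `φ i` gives an element of `W` on which every `ψ j` vanishes, hence zero. So
every `φ i` vanishes on the coefficients of `t` with respect to a basis of `W`, and these
coefficients are zero too. -/
theorem tensor_eq_zero_of_separating {V W I J : Type*} [AddCommGroup V] [Module ℝ V]
    [AddCommGroup W] [Module ℝ W] (φ : I → V →ₗ[ℝ] ℝ) (ψ : J → W →ₗ[ℝ] ℝ)
    (hφ : ∀ v, (∀ i, φ i v = 0) → v = 0) (hψ : ∀ w, (∀ j, ψ j w = 0) → w = 0) (t : V ⊗[ℝ] W)
    (h : ∀ i j, LinearMap.mul' ℝ ℝ (TensorProduct.map (φ i) (ψ j) t) = 0) : t = 0 := by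
  classical
  have h1 : ∀ i, TensorProduct.lid ℝ W (LinearMap.rTensor W (φ i) t) = 0 := by
    refine fun i => hψ _ fun j => ?_
    rw [← h i j]
    generalize t = z
    induction z with
    | zero => simp
    | tmul v w => simp
    | add x y hx hy => simp only [map_add, hx, hy]
  let b := Module.Basis.ofVectorSpace ℝ W
  apply (TensorProduct.equivFinsuppOfBasisRight (M := V) b).injective
  rw [map_zero]
  ext k
  refine hφ _ fun i => ?_
  have h2 : ∀ z : V ⊗[ℝ] W, φ i (TensorProduct.equivFinsuppOfBasisRight b z k)
      = b.coord k (TensorProduct.lid ℝ W (LinearMap.rTensor W (φ i) z)) := by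
    intro z
    induction z with
    | zero => simp
    | tmul v w => simp [mul_comm]
    | add x y hx hy => simp only [map_add, Finsupp.add_apply, hx, hy]
  rw [h2, h1, map_zero]

/-! ### The filtration of the universal enveloping algebra -/

section Filtration

variable {𝔤 : Type*} [LieRing 𝔤] [LieAlgebra ℝ 𝔤]

section

attribute [local instance] LieRing.ofAssociativeRing

theorem incl_lie (X Y : 𝔤) : incl ⁅X, Y⁆ = incl X * incl Y - incl Y * incl X :=
  LieHom.map_lie (UniversalEnvelopingAlgebra.ι ℝ) X Y

end

theorem UEA.induction {p : UEA 𝔤 → Prop} (algebraMap : ∀ c : ℝ, p (algebraMap ℝ _ c))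
    (incl : ∀ X, p (incl X)) (mul : ∀ u v, p u → p v → p (u * v))
    (add : ∀ u v, p u → p v → p (u + v)) (u : UEA 𝔤) : p u := by
  obtain ⟨t, rfl⟩ : ∃ t, UniversalEnvelopingAlgebra.mkAlgHom ℝ 𝔤 t = u :=
    Quotient.exists_rep u
  induction t using TensorAlgebra.induction with
  | algebraMap r => simpa using algebraMap r
  | ι x => exact incl x
  | mul a b ha hb => simpa using mul _ _ ha hb
  | add a b ha hb => simpa using add _ _ ha hb

variable {ι : Type*} (e : Module.Basis ι ℝ 𝔤)

/-- The product of a word in the basis `e`. -/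
def word (w : List ι) : UEA 𝔤 := (w.map fun i => incl (e i)).prod

theorem word_cons (i : ι) (w : List ι) : word e (i :: w) = incl (e i) * word e w := by
  simp [word]

/-- The span of the words of length less than `n`. -/
def filt (n : ℕ) : Submodule ℝ (UEA 𝔤) := Submodule.span ℝ {u | ∃ w, w.length < n ∧ u = word e w}

theorem word_mem_filt {w : List ι} {n : ℕ} (h : w.length < n) : word e w ∈ filt e n :=
  Submodule.subset_span ⟨w, h, rfl⟩

theorem filt_mono {m n : ℕ} (h : m ≤ n) : filt e m ≤ filt e n :=
  Submodule.span_mono fun _ ⟨w, hw, hu⟩ => ⟨w, hw.trans_le h, hu⟩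

theorem filt_zero : filt e 0 = ⊥ := by
  rw [eq_bot_iff, filt, Submodule.span_le]
  rintro _ ⟨w, hw, -⟩
  exact absurd hw (by simp)

theorem incl_mul_mem_filt (X : 𝔤) {n : ℕ} {u : UEA 𝔤} (hu : u ∈ filt e n) :
    incl X * u ∈ filt e (n + 1) := by
  induction hu using Submodule.span_induction with
  | mem u hu =>
    obtain ⟨w, hw, rfl⟩ := hu
    rw [← e.linearCombination_repr X, Finsupp.linearCombination_apply, Finsupp.sum, map_sum,
      Finset.sum_mul]
    refine Submodule.sum_mem _ fun i _ => ?_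
    rw [map_smul, smul_mul_assoc, ← word_cons]
    exact Submodule.smul_mem _ _ (word_mem_filt e (by simpa using hw))
  | zero => simp
  | add u v _ _ hu hv => rw [mul_add]; exact add_mem hu hv
  | smul c u _ hu => rw [mul_smul_comm]; exact Submodule.smul_mem _ _ hu

theorem exists_mem_filt (u : UEA 𝔤) : ∃ n, u ∈ filt e n := by
  -- In this form the claim is stable under products in `u`; it is applied to `v = 1`.
  suffices h : ∀ m, ∀ v ∈ filt e m, ∃ n, u * v ∈ filt e n by
    obtain ⟨n, hn⟩ := h 1 1 (word_mem_filt e (w := []) (by simp))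
    exact ⟨n, by simpa using hn⟩
  induction u using UEA.induction with
  | algebraMap c =>
    refine fun m v hv => ⟨m, ?_⟩
    rw [← Algebra.smul_def]
    exact Submodule.smul_mem _ _ hv
  | incl X => exact fun m v hv => ⟨m + 1, incl_mul_mem_filt e X hv⟩
  | mul a b ha hb =>
    intro m v hv
    obtain ⟨n, hn⟩ := hb m v hv
    simpa only [mul_assoc] using ha n _ hn
  | add a b ha hb =>
    intro m v hv
    obtain ⟨n, hn⟩ := ha m v hv
    obtain ⟨n', hn'⟩ := hb m v hv
    refine ⟨max n n', ?_⟩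
    rw [add_mul]
    exact add_mem (filt_mono e (le_max_left _ _) hn) (filt_mono e (le_max_right _ _) hn')

/-- Exchanging two adjacent letters costs their commutator, which is an element of `𝔤` and thus
shortens the word by one. -/
theorem word_sub_word_mem_filt {v w : List ι} (h : v.Perm w) :
    word e v - word e w ∈ filt e v.length := by
  induction h with
  | nil => simp
  | cons i _ ih =>
    rw [word_cons, word_cons, ← mul_sub]
    exact incl_mul_mem_filt e _ ih
  | swap i j w =>
    simp only [word_cons, ← mul_assoc]
    rw [← sub_mul, ← incl_lie]
    exact incl_mul_mem_filt e _ (word_mem_filt e (by simp))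
  | trans h1 _ ih1 ih2 =>
    rw [← h1.length_eq] at ih2
    simpa using add_mem ih1 ih2

variable [LinearOrder ι]

/-- The linear map from polynomials to `U𝔤` that sends a monomial to the ordered monomial. -/
def ordered : MvPolynomial ι ℝ →ₗ[ℝ] UEA 𝔤 :=
  (MvPolynomial.basisMonomials ι ℝ).constr ℝ fun α => word e (α.toMultiset.sort (· ≤ ·))

theorem ordered_word (w : List ι) :
    ordered e (w.map MvPolynomial.X).prod = word e ((w : Multiset ι).sort (· ≤ ·)) := by
  have h : (w.map (MvPolynomial.X (R := ℝ))).prod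
      = MvPolynomial.basisMonomials ι ℝ (Multiset.toFinsupp (w : Multiset ι)) := by
    rw [MvPolynomial.coe_basisMonomials]
    induction w with
    | nil => simp
    | cons i w ih =>
      rw [List.map_cons, List.prod_cons, ih, ← Multiset.cons_coe, ← Multiset.singleton_add,
        map_add, Multiset.toFinsupp_singleton, MvPolynomial.X, MvPolynomial.monomial_mul, one_mul]
  rw [h, ordered, Module.Basis.constr_basis, Multiset.toFinsupp_toMultiset]

end Filtration

/-! ### Separation of points in the universal enveloping algebra -/

section Separation

theorem derivation_mem_pow {A : Type*} [CommRing A] {D : A → A}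
    (hadd : ∀ f g, D (f + g) = D f + D g)
    (hmul : ∀ f g, D (f * g) = f * D g + g * D f) (𝔪 : Ideal A) (n : ℕ) {f : A}
    (hf : f ∈ 𝔪 ^ (n + 1)) : D f ∈ 𝔪 ^ n := by
  induction n generalizing f with
  | zero => simp
  | succ n ih =>
    rw [pow_succ] at hf
    refine Submodule.smul_induction_on hf (fun a ha c hc => ?_) fun f g hf hg => ?_
    · rw [smul_eq_mul, hmul]
      refine add_mem (Ideal.mul_mem_right _ _ ha) ?_
      rw [pow_succ, mul_comm c]
      exact Ideal.mul_mem_mul (ih ha) hc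
    · rw [hadd]
      exact add_mem hf hg

variable {𝔤 : Type*} [LieRing 𝔤] [LieAlgebra ℝ 𝔤] {ι : Type*} (e : Module.Basis ι ℝ 𝔤)
  {A : Type*} [CommRing A] [Algebra ℝ A] (ρ : UEA 𝔤 →ₐ[ℝ] Module.End ℝ A)
  (hρ : ∀ X f g, ρ (incl X) (f * g) = f * ρ (incl X) g + g * ρ (incl X) f) (𝔪 : Ideal A)

include hρ in
-- Each letter acts as a derivation, lowering the exponent of `x` by one and producing this exponent
-- and a factor `ξ i`, up to terms of higher order. For `m = 0` this is the principal symbol of the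
-- word, multiplied by a factorial.
theorem word_apply_pow_sub_mem {x : A} {ξ : ι → ℝ} (hx : x ∈ 𝔪)
    (hξ : ∀ i, ρ (incl (e i)) x - algebraMap ℝ A (ξ i) ∈ 𝔪) (w : List ι) (m : ℕ) :
    ρ (word e w) (x ^ (m + w.length))
      - (((m + w.length).descFactorial w.length : ℝ) * (w.map ξ).prod) • x ^ m
      ∈ 𝔪 ^ (m + 1) := by
  induction w generalizing m with
  | nil => simp [word]
  | cons i w ih =>
    have h := ih (m + 1)
    set c : ℝ := ((m + 1 + w.length).descFactorial w.length : ℝ) * (w.map ξ).prod with hc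
    have hpow : ∀ k : ℕ, ρ (incl (e i)) (x ^ (k + 1)) = (k + 1 : ℝ) • (x ^ k * ρ (incl (e i)) x) := by
      intro k
      induction k with
      | zero => simp
      | succ k ih =>
        rw [pow_succ, hρ, ih, mul_smul_comm, ← mul_assoc, mul_comm x, ← pow_succ]
        push_cast
        module
    -- The induction hypothesis is used at `m + 1`, because the first letter of the word costs one
    -- order of vanishing in the error term.
    have h2 := derivation_mem_pow (D := ρ (incl (e i))) (map_add _) (hρ (e i)) 𝔪 (m + 1) h
    rw [map_sub, map_smul, hpow] at h2
    have h3 : x ^ m * (ρ (incl (e i)) x - algebraMap ℝ A (ξ i)) ∈ 𝔪 ^ (m + 1) := by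
      rw [pow_succ]
      exact Ideal.mul_mem_mul (Ideal.pow_mem_pow hx m) (hξ i)
    have h4 := add_mem h2 (Submodule.smul_of_tower_mem (𝔪 ^ (m + 1)) (c * (m + 1 : ℝ)) h3)
    have e1 : m + 1 + w.length = m + (i :: w).length := by simp; ring
    rw [e1] at h4 hc
    rw [word_cons, map_mul, Module.End.mul_apply]
    convert h4 using 1
    have e2 : ((m + (i :: w).length).descFactorial (i :: w).length : ℝ)
        = (m + 1) * ((m + (i :: w).length).descFactorial w.length : ℝ) := by
      rw [List.length_cons, Nat.descFactorial_succ, show m + (w.length + 1) - w.length = m + 1 by omega]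
      push_cast
      ring
    rw [e2, mul_sub, smul_sub, smul_smul, mul_comm (x ^ m) (algebraMap ℝ A _), ← Algebra.smul_def,
      smul_smul, hc, List.map_cons, List.prod_cons]
    rw [sub_add_sub_cancel]
    congr 2
    ring

variable [LinearOrder ι] (ev : A →ₐ[ℝ] ℝ)

include hρ in
-- `p` is the principal symbol of `u`: a word of length `n` contributes the commutative monomial in
-- its letters. It determines `u` modulo shorter words, and it is visible in the action of `u` on
-- `n`-th powers.
theorem exists_ordered_sub_mem_filt {n : ℕ} {u : UEA 𝔤} (hu : u ∈ filt e (n + 1)) :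
    ∃ p : MvPolynomial ι ℝ, u - ordered e p ∈ filt e n ∧ ∀ (x : A) (ξ : ι → ℝ), ev x = 0 →
      (∀ i, ev (ρ (incl (e i)) x) = ξ i) →
      ev (ρ u (x ^ n)) = (n.factorial : ℝ) * MvPolynomial.eval ξ p := by
  have hker : ∀ f, f ∈ RingHom.ker ev ↔ ev f = 0 := fun f => Iff.rfl
  induction hu using Submodule.span_induction with
  | mem u hu =>
    obtain ⟨w, hw, rfl⟩ := hu
    rcases (Nat.lt_succ_iff.1 hw).eq_or_lt with h | h
    · refine ⟨(w.map MvPolynomial.X).prod, ?_, fun x ξ hx hξ => ?_⟩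
      · rw [ordered_word, ← h]
        refine word_sub_word_mem_filt e ?_
        rw [← Multiset.coe_eq_coe, Multiset.sort_eq]
      · have := word_apply_pow_sub_mem e ρ hρ (RingHom.ker ev) (x := x) (ξ := ξ) hx
          (fun i => by rw [hker, map_sub, hξ]; simp) w 0
        rw [zero_add, zero_add, pow_one, hker, map_sub, sub_eq_zero, h] at this
        rw [this, Nat.descFactorial_self, map_list_prod, List.map_map]
        simp only [pow_zero, map_smul, map_one, smul_eq_mul, mul_one]
        congr 3
        ext i
        simp
    · refine ⟨0, by simpa using word_mem_filt e h, fun x ξ hx hξ => ?_⟩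
      -- A word shorter than `n` leaves a positive power of `x`, up to higher order, so its value at
      -- the point is zero.
      obtain ⟨m, rfl⟩ := Nat.exists_eq_add_of_lt h
      have := word_apply_pow_sub_mem e ρ hρ (RingHom.ker ev) (x := x) (ξ := ξ) hx
          (fun i => by rw [hker, map_sub, hξ]; simp) w (m + 1)
      have := Ideal.pow_le_self (by simp) this
      rw [hker, map_sub, map_smul, map_pow ev x, hx, sub_eq_zero] at this
      rw [show w.length + m + 1 = m + 1 + w.length by ring, this]
      simp
  | zero => exact ⟨0, by simp, fun x ξ _ _ => by simp⟩
  | add u v _ _ hu hv =>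
    obtain ⟨p, hp, hp'⟩ := hu
    obtain ⟨q, hq, hq'⟩ := hv
    refine ⟨p + q, ?_, fun x ξ hx hξ => ?_⟩
    · rw [map_add, add_sub_add_comm]; exact add_mem hp hq
    · rw [map_add, LinearMap.add_apply, map_add, hp' x ξ hx hξ, hq' x ξ hx hξ, map_add, mul_add]
  | smul c u _ hu =>
    obtain ⟨p, hp, hp'⟩ := hu
    refine ⟨c • p, ?_, fun x ξ hx hξ => ?_⟩
    · rw [map_smul, ← smul_sub]; exact Submodule.smul_mem _ _ hp
    · rw [map_smul, LinearMap.smul_apply, map_smul, hp' x ξ hx hξ, MvPolynomial.smul_eval,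
        smul_eq_mul]
      ring

include hρ in
/-- An element of `U𝔤` that acts by zero at a point on all powers of functions with given
differentials at this point is zero. -/
theorem UEA.eq_zero_of_forall_apply_pow (u : UEA 𝔤)
    (h : ∀ ξ : ι → ℝ, ∃ x : A, ev x = 0 ∧ (∀ i, ev (ρ (incl (e i)) x) = ξ i) ∧
      ∀ n, ev (ρ u (x ^ n)) = 0) : u = 0 := by
  obtain ⟨n, hn⟩ := exists_mem_filt e u
  induction n with
  | zero => simpa [filt_zero] using hn
  | succ n ih =>
    obtain ⟨p, hp, hp'⟩ := exists_ordered_sub_mem_filt e ρ hρ ev hn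
    -- A real polynomial that vanishes at all points is zero. Hence `u` is a combination of shorter
    -- words, and the degree drops; linear independence of the ordered monomials plays no role.
    have : p = 0 := MvPolynomial.funext fun ξ => by
      obtain ⟨x, hx, hξ, hu⟩ := h ξ
      have := hp' x ξ hx hξ
      rw [hu] at this
      have h0 : (n.factorial : ℝ) ≠ 0 := by exact_mod_cast n.factorial_ne_zero
      rw [map_zero]
      exact (mul_eq_zero.1 this.symm).resolve_left h0
    rw [this, map_zero, sub_zero] at hp
    exact ih hp

end Separation

end DynQuant
end

noncomputable section

namespace DynQuant

/-! ### Vector fields as derivations -/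

section Tderiv

variable {E N : Type*} [NormedAddCommGroup E] [NormedSpace ℝ E] [TopologicalSpace N]
  [ChartedSpace E N]

theorem tderiv_eq_fderiv {f : N → ℝ} {x : N} (hf : MDifferentiableAt 𝓘(ℝ, E) 𝓘(ℝ, ℝ) f x)
    (v : TangentSpace 𝓘(ℝ, E) x) : tderiv f x v =
      fderiv ℝ (f ∘ (extChartAt 𝓘(ℝ, E) x).symm) (extChartAt 𝓘(ℝ, E) x x) v := by
  have h : Set.range 𝓘(ℝ, E) = Set.univ := by simp
  have h' := hf.mfderiv
  rw [h, fderivWithin_univ] at h'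
  exact congrArg (fun L => L v) h'

theorem tderiv_mul {f g : N → ℝ} {x : N} (hf : MDifferentiableAt 𝓘(ℝ, E) 𝓘(ℝ, ℝ) f x)
    (hg : MDifferentiableAt 𝓘(ℝ, E) 𝓘(ℝ, ℝ) g x) (v : TangentSpace 𝓘(ℝ, E) x) :
    tderiv (fun y => f y * g y) x v = f x * tderiv g x v + g x * tderiv f x v := by
  have h := (hf.hasMFDerivAt.mul hg.hasMFDerivAt).mfderiv
  exact congrArg (fun L => L v) h

end Tderiv

section Fields

variable {E P P' G : Type*} [NormedAddCommGroup E] [NormedSpace ℝ E]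
  [NormedAddCommGroup P] [NormedSpace ℝ P] [NormedAddCommGroup P'] [NormedSpace ℝ P']
  [TopologicalSpace G] [ChartedSpace E G] [Group G] [LieGroup 𝓘(ℝ, E) ∞ G]

theorem leftInvField_apply (X : GroupLieAlgebra 𝓘(ℝ, E) G) (f : Fn E P G) (p : P × G) :
    leftInvField X f p = tderiv (fun y : G => f (p.1, p.2 * y)) 1 X :=
  tderiv_left_translate f X p

theorem partialP_apply (v : P) (f : Fn E P G) (p : P × G) :
    partialP v f p = fderiv ℝ (fun q => f (q, p.2)) p.1 v := rfl

theorem leftInvField_mul (X : GroupLieAlgebra 𝓘(ℝ, E) G) (f g : Fn E P G) :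
    leftInvField X (f * g) = f * leftInvField X g + g * leftInvField X f := by
  ext p
  exact tderiv_mul (((contMDiff_slice f p.1).mdifferentiable (by simp)) p.2)
    (((contMDiff_slice g p.1).mdifferentiable (by simp)) p.2) _

theorem partialP_mul (v : P) (f g : Fn E P G) :
    partialP v (f * g) = f * partialP v g + g * partialP v f := by
  ext p
  have hf : DifferentiableAt ℝ (fun q => f (q, p.2)) p.1 :=
    ((contMDiff_slice' f p.2).contDiff.differentiable (by simp)).differentiableAt
  have hg : DifferentiableAt ℝ (fun q => g (q, p.2)) p.1 :=
    ((contMDiff_slice' g p.2).contDiff.differentiable (by simp)).differentiableAt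
  exact congrArg (fun L => L v) (fderiv_mul hf hg)

theorem partialP_commute (v w : P) :
    Commute (partialP v : Module.End ℝ (Fn E P G)) (partialP w) := by
  ext f p
  have hf : ContDiff ℝ ∞ fun q => f (q, p.2) := (contMDiff_slice' f p.2).contDiff
  have hsymm : IsSymmSndFDerivAt ℝ (fun q => f (q, p.2)) p.1 :=
    hf.contDiffAt.isSymmSndFDerivAt
      (by simpa using ENat.LEInfty.out)
  have hd : ContDiff ℝ ∞ (fderiv ℝ fun q => f (q, p.2)) := hf.fderiv_right (by simp)
  have key : ∀ a b : P, fderiv ℝ (fun q => fderiv ℝ (fun q => f (q, p.2)) q a) p.1 b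
      = fderiv ℝ (fderiv ℝ fun q => f (q, p.2)) p.1 b a := by
    intro a b
    have := ((hd.differentiable (by simp) p.1).hasFDerivAt.clm_apply
      (hasFDerivAt_const a p.1)).fderiv
    rw [this]
    simp
  exact (key w v).trans ((hsymm v w).trans (key v w).symm)

/-- With an inverse chart `κ` at the unit, both fields are directional derivatives of the single
function `(q, y) ↦ f (q, x κ(y))` on `P × E`, and second derivatives are symmetric. -/
theorem leftInvField_commute_partialP [FiniteDimensional ℝ E]
    (X : GroupLieAlgebra 𝓘(ℝ, E) G) (v : P) :
    Commute (leftInvField X : Module.End ℝ (Fn E P G)) (partialP v) := by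
  obtain ⟨κ, hκ, hκ₀⟩ := exists_contMDiff_eq_extChartAt_symm (E := E) (1 : G)
  set y₀ := extChartAt 𝓘(ℝ, E) (1 : G) 1
  have hX : ∀ (f : Fn E P G) (p : P × G),
      leftInvField X f p = fderiv ℝ (fun y => f (p.1, p.2 * κ y)) y₀ (show E from X) := by
    intro f p
    have h : ContMDiff 𝓘(ℝ, E) 𝓘(ℝ, ℝ) ∞ fun y : G => f (p.1, p.2 * y) :=
      (contMDiff_slice f p.1).comp (contMDiff_mul_left (n := ∞))
    rw [leftInvField_apply, tderiv_eq_fderiv (h.mdifferentiable (by simp) 1)]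
    have e : (fun y => f (p.1, p.2 * κ y)) =ᶠ[𝓝 y₀]
        (fun y : G => f (p.1, p.2 * y)) ∘ (extChartAt 𝓘(ℝ, E) (1 : G)).symm := by
      filter_upwards [hκ₀] with y hy
      simp [hy]
    rw [e.fderiv_eq]
  ext f p
  set Ψ : P × E → ℝ := fun z => f (z.1, p.2 * κ z.2) with hΨdef
  have hΨ : ContDiff ℝ ∞ Ψ := by
    rw [← contMDiff_iff_contDiff]
    exact f.contMDiff.comp (contDiff_fst.contMDiff.prodMk
      ((contMDiff_mul_left (n := ∞)).comp (hκ.comp contDiff_snd.contMDiff)))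
  have hsymm : IsSymmSndFDerivAt ℝ Ψ (p.1, y₀) := hΨ.contDiffAt.isSymmSndFDerivAt
      (by simpa using ENat.LEInfty.out)
  have hd : ContDiff ℝ ∞ (fderiv ℝ Ψ) := hΨ.fderiv_right (by simp)
  have h1 : ∀ (q : P) (y : E) (a : P), fderiv ℝ (fun q => Ψ (q, y)) q a
      = fderiv ℝ Ψ (q, y) (a, 0) := by
    intro q y a
    have := (HasFDerivAt.comp (f := fun q => (q, y)) q
      (hΨ.differentiable (by simp) (q, y)).hasFDerivAt
      ((hasFDerivAt_id q).prodMk (hasFDerivAt_const y q))).fderiv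
    exact (congrArg (fun L => L a) this)
  have h2 : ∀ (q : P) (y : E) (a : E), fderiv ℝ (fun y => Ψ (q, y)) y a
      = fderiv ℝ Ψ (q, y) (0, a) := by
    intro q y a
    have := (HasFDerivAt.comp (f := fun y => (q, y)) y
      (hΨ.differentiable (by simp) (q, y)).hasFDerivAt
      ((hasFDerivAt_const q y).prodMk (hasFDerivAt_id y))).fderiv
    exact (congrArg (fun L => L a) this)
  have hdd := (hd.differentiable (by simp) (p.1, y₀)).hasFDerivAt
  have l1 : leftInvField X (partialP v f) p
      = fderiv ℝ (fderiv ℝ Ψ) (p.1, y₀) (0, (show E from X)) (v, 0) := by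
    rw [hX]
    have e : (fun y => partialP v f (p.1, p.2 * κ y)) = fun y => fderiv ℝ Ψ (p.1, y) (v, 0) := by
      ext y
      exact h1 p.1 y v
    rw [e]
    have := ((HasFDerivAt.comp (f := fun y => (p.1, y)) y₀ hdd
      ((hasFDerivAt_const p.1 y₀).prodMk (hasFDerivAt_id y₀))).clm_apply
      (hasFDerivAt_const ((v, 0) : P × E) y₀)).fderiv
    refine (congrArg (fun L => L (show E from X)) this).trans ?_
    rw [ContinuousLinearMap.comp_zero, zero_add]
    rfl
  have l2 : partialP v (leftInvField X f) p
      = fderiv ℝ (fderiv ℝ Ψ) (p.1, y₀) (v, 0) (0, (show E from X)) := by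
    rw [partialP_apply]
    have e : (fun q => leftInvField X f (q, p.2))
        = fun q => fderiv ℝ Ψ (q, y₀) (0, (show E from X)) := by
      ext q
      rw [hX]
      exact h2 q y₀ _
    rw [e]
    have := ((HasFDerivAt.comp (f := fun q => (q, y₀)) p.1 hdd
      ((hasFDerivAt_id p.1).prodMk (hasFDerivAt_const y₀ p.1))).clm_apply
      (hasFDerivAt_const ((0, (show E from X)) : P × E) p.1)).fderiv
    refine (congrArg (fun L => L v) this).trans ?_
    rw [ContinuousLinearMap.comp_zero, zero_add]
    rfl
  exact l1.trans ((hsymm _ _).trans l2.symm)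

@[simp]
theorem partialP_ofG (v : P) (f : C^∞⟮𝓘(ℝ, E), G; 𝓘(ℝ, ℝ), ℝ⟯) :
    partialP v (ofG f : Fn E P G) = 0 := by
  ext p
  rw [partialP_apply]
  simp

@[simp]
theorem leftInvField_ofP (X : GroupLieAlgebra 𝓘(ℝ, E) G)
    (a : C^∞⟮𝓘(ℝ, P), P; 𝓘(ℝ, ℝ), ℝ⟯) : leftInvField X (ofP a : Fn E P G) = 0 := by
  ext p
  rw [leftInvField_apply]
  simp only [ofP_apply, tderiv]
  rw [mfderiv_const]
  rfl

/-- The derivative of a smooth function on `P` in a constant direction. -/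
def dirDeriv (v : P) (a : C^∞⟮𝓘(ℝ, P), P; 𝓘(ℝ, ℝ), ℝ⟯) : C^∞⟮𝓘(ℝ, P), P; 𝓘(ℝ, ℝ), ℝ⟯ :=
  ⟨fun q => fderiv ℝ a q v,
    ((a.contMDiff.contDiff.fderiv_right (m := ∞) (by simp)).clm_apply contDiff_const).contMDiff⟩

theorem partialP_ofP (v : P) (a : C^∞⟮𝓘(ℝ, P), P; 𝓘(ℝ, ℝ), ℝ⟯) :
    partialP v (ofP a : Fn E P G) = ofP (dirDeriv v a) := rfl

/-- Change of the parameter space. -/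
def pullback (j : C^∞⟮𝓘(ℝ, P), P; 𝓘(ℝ, P'), P'⟯) : Fn E P' G →ₐ[ℝ] Fn E P G where
  toFun f := ⟨fun p => f (j p.1, p.2),
    f.contMDiff.comp ((j.contMDiff.comp contMDiff_fst).prodMk contMDiff_snd)⟩
  map_one' := rfl
  map_mul' _ _ := rfl
  map_zero' := rfl
  map_add' _ _ := rfl
  commutes' _ := rfl

omit [Group G] [LieGroup 𝓘(ℝ, E) ∞ G] in
theorem pullback_apply (j : C^∞⟮𝓘(ℝ, P), P; 𝓘(ℝ, P'), P'⟯) (f : Fn E P' G) (p : P × G) :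
    pullback j f p = f (j p.1, p.2) := rfl

/-- Translations, as a homomorphism of algebras. -/
def translateHom (a c : G) : Fn E P G →ₐ[ℝ] Fn E P G where
  toFun := translate a c
  map_one' := rfl
  map_mul' _ _ := rfl
  map_zero' := rfl
  map_add' _ _ := rfl
  commutes' _ := rfl

theorem translateHom_apply (a c : G) (f : Fn E P G) (p : P × G) :
    translateHom a c f p = f (p.1, a * p.2 * c) := rfl

end Fields

/-! ### The action of the universal enveloping algebra -/

section Action

variable {E P P' G : Type*} [NormedAddCommGroup E] [NormedSpace ℝ E] [FiniteDimensional ℝ E]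
  [NormedAddCommGroup P] [NormedSpace ℝ P] [NormedAddCommGroup P'] [NormedSpace ℝ P']
  [TopologicalSpace G] [ChartedSpace E G] [Group G] [LieGroup 𝓘(ℝ, E) ∞ G]

section Lift

attribute [local instance] LieRing.ofAssociativeRing

@[simp]
theorem leftInvOp_incl (X : GroupLieAlgebra 𝓘(ℝ, E) G) :
    leftInvOp E P G (incl X) = leftInvField X :=
  UniversalEnvelopingAlgebra.lift_ι_apply ℝ _ X

variable {𝔤 : Type*} [LieRing 𝔤] [LieAlgebra ℝ 𝔤]

@[simp]
theorem comul_incl (X : 𝔤) :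
    comul (incl X) = incl X ⊗ₜ[ℝ] (1 : UEA 𝔤) + (1 : UEA 𝔤) ⊗ₜ[ℝ] incl X :=
  UniversalEnvelopingAlgebra.lift_ι_apply ℝ _ X

@[simp]
theorem counit_incl (X : 𝔤) : counit (incl X) = 0 :=
  UniversalEnvelopingAlgebra.lift_ι_apply ℝ _ X

end Lift

/-- A property of operators on `C^∞(P × G)` that is stable under sums and compositions and holds
for left-invariant vector fields holds for all left-invariant differential operators. -/
theorem leftInvOp_induction {p : Module.End ℝ (Fn E P G) → Prop}
    (smul : ∀ c : ℝ, p (c • 1)) (field : ∀ X : GroupLieAlgebra 𝓘(ℝ, E) G, p (leftInvField X))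
    (mul : ∀ S T, p S → p T → p (S * T)) (add : ∀ S T, p S → p T → p (S + T))
    (u : UEA (GroupLieAlgebra 𝓘(ℝ, E) G)) : p (leftInvOp E P G u) := by
  induction u using UEA.induction with
  | algebraMap c => rw [AlgHom.commutes, Algebra.algebraMap_eq_smul_one]; exact smul c
  | incl X => rw [leftInvOp_incl]; exact field X
  | mul u v hu hv => rw [map_mul]; exact mul _ _ hu hv
  | add u v hu hv => rw [map_add]; exact add _ _ hu hv

theorem leftInvOp_commute_partialP (u : UEA (GroupLieAlgebra 𝓘(ℝ, E) G)) (v : P) :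
    Commute (leftInvOp E P G u) (partialP v) :=
  leftInvOp_induction (p := fun T => Commute T (partialP v))
    (fun c => (Commute.one_left _).smul_left c) (fun X => leftInvField_commute_partialP X v)
    (fun _ _ => Commute.mul_left) (fun _ _ => Commute.add_left) u

theorem leftInvOp_ofP (u : UEA (GroupLieAlgebra 𝓘(ℝ, E) G))
    (a : C^∞⟮𝓘(ℝ, P), P; 𝓘(ℝ, ℝ), ℝ⟯) :
    leftInvOp E P G u (ofP a) = counit u • (ofP a : Fn E P G) := by
  induction u using UEA.induction with
  | algebraMap c => rw [AlgHom.commutes, AlgHom.commutes]; rfl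
  | incl X => simp
  | mul u v hu hv => rw [map_mul, Module.End.mul_apply, hv, map_smul, hu, smul_smul, map_mul,
      mul_comm]
  | add u v hu hv => rw [map_add, LinearMap.add_apply, hu, hv, map_add, add_smul]

/-- Left-invariant operators differentiate only along `G`. This allows the parameter to be frozen,
and also a time variable to be added to it. -/
theorem leftInvOp_pullback (u : UEA (GroupLieAlgebra 𝓘(ℝ, E) G))
    (j : C^∞⟮𝓘(ℝ, P), P; 𝓘(ℝ, P'), P'⟯) (f : Fn E P' G) :
    leftInvOp E P G u (pullback j f) = pullback j (leftInvOp E P' G u f) := by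
  induction u using UEA.induction generalizing f with
  | algebraMap c => simp
  | incl X => rw [leftInvOp_incl, leftInvOp_incl]; rfl
  | mul u v hu hv => rw [map_mul, Module.End.mul_apply, hv, hu, map_mul, Module.End.mul_apply]
  | add u v hu hv => rw [map_add, LinearMap.add_apply, hu, hv, map_add, LinearMap.add_apply,
      map_add]

theorem leftInvOp_translate (u : UEA (GroupLieAlgebra 𝓘(ℝ, E) G)) (a : G) (f : Fn E P G) :
    leftInvOp E P G u (translateHom a 1 f) = translateHom a 1 (leftInvOp E P G u f) :=
  leftInvOp_induction (p := fun T => ∀ f, T (translateHom a 1 f) = translateHom a 1 (T f))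
    (fun c f => by simp)
    (fun X f => by
      ext p
      rw [leftInvField_apply, translateHom_apply, leftInvField_apply]
      simp only [translateHom_apply, mul_one, mul_assoc])
    (fun S T hS hT f => by simp [hS, hT]) (fun S T hS hT f => by simp [hS, hT]) u f

@[simp]
theorem leftInvOp₂_tmul (u v : UEA (GroupLieAlgebra 𝓘(ℝ, E) G)) :
    leftInvOp₂ E P G (u ⊗ₜ[ℝ] v)
      = TensorProduct.map (leftInvOp E P G u) (leftInvOp E P G v) := rfl

/-- For `u ∈ 𝔤` this is the Leibniz rule, and both sides are compatible with products and sums in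
`u`: the comultiplication encodes how differential operators act on products. -/
theorem mul'_leftInvOp₂_comul (u : UEA (GroupLieAlgebra 𝓘(ℝ, E) G))
    (y : Fn E P G ⊗[ℝ] Fn E P G) :
    LinearMap.mul' ℝ (Fn E P G) (leftInvOp₂ E P G (comul u) y)
      = leftInvOp E P G u (LinearMap.mul' ℝ (Fn E P G) y) := by
  induction u using UEA.induction generalizing y with
  | algebraMap c =>
    rw [AlgHom.commutes, AlgHom.commutes, AlgHom.commutes]
    simp [Algebra.algebraMap_eq_smul_one]
  | incl X =>
    rw [comul_incl, map_add, leftInvOp₂_tmul, leftInvOp₂_tmul, map_one, leftInvOp_incl]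
    induction y with
    | zero => simp
    | tmul f g =>
      simp [leftInvField_mul]
      ring
    | add y z hy hz => simp only [map_add, hy, hz]
  | mul u v hu hv => rw [map_mul, map_mul, Module.End.mul_apply, hu, hv, map_mul,
      Module.End.mul_apply]
  | add u v hu hv => rw [map_add, map_add, LinearMap.add_apply, map_add, hu, hv, map_add,
      LinearMap.add_apply]

variable (E P G) in
/-- The action of `U𝔤 ⊗ U𝔤 ⊗ U𝔤` on `C^∞(M) ⊗ C^∞(M) ⊗ C^∞(M)`. -/
def leftInvOp₃ :
    UEA₃ (GroupLieAlgebra 𝓘(ℝ, E) G) →ₐ[ℝ]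
      Module.End ℝ (Fn E P G ⊗[ℝ] (Fn E P G ⊗[ℝ] Fn E P G)) :=
  (Module.endTensorEndAlgHom (R := ℝ) (S := ℝ) (A := ℝ)).comp
    (Algebra.TensorProduct.map (leftInvOp E P G) (leftInvOp₂ E P G))

@[simp]
theorem leftInvOp₃_tmul (u : UEA (GroupLieAlgebra 𝓘(ℝ, E) G))
    (v : UEA₂ (GroupLieAlgebra 𝓘(ℝ, E) G)) :
    leftInvOp₃ E P G (u ⊗ₜ[ℝ] v)
      = TensorProduct.map (leftInvOp E P G u) (leftInvOp₂ E P G v) := rfl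

variable (E P G) in
/-- The multiplication of three functions. -/
def mul₃ : Fn E P G ⊗[ℝ] (Fn E P G ⊗[ℝ] Fn E P G) →ₗ[ℝ] Fn E P G :=
  LinearMap.mul' ℝ (Fn E P G) ∘ₗ TensorProduct.map LinearMap.id (LinearMap.mul' ℝ (Fn E P G))

omit [FiniteDimensional ℝ E] [Group G] [LieGroup 𝓘(ℝ, E) ∞ G] in
@[simp]
theorem mul₃_tmul (f g h : Fn E P G) : mul₃ E P G (f ⊗ₜ (g ⊗ₜ h)) = f * (g * h) := rfl

/-! ### Separation of points by the action -/

/-- The value at a point. -/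
def evalAt (q : P × G) : Fn E P G →ₐ[ℝ] ℝ where
  toFun f := f q
  map_one' := rfl
  map_mul' _ _ := rfl
  map_zero' := rfl
  map_add' _ _ := rfl
  commutes' _ := rfl

omit [FiniteDimensional ℝ E] [Group G] [LieGroup 𝓘(ℝ, E) ∞ G] in
theorem evalAt_apply (q : P × G) (f : Fn E P G) : evalAt q f = f q := rfl

variable [T2Space G]

/-- There are functions on `G` vanishing at the unit with any prescribed differential there, and
their powers are again functions on `G`, so the criterion on powers applies. -/
theorem leftInvOp_separating (p : P) (u : UEA (GroupLieAlgebra 𝓘(ℝ, E) G))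
    (h : ∀ f : C^∞⟮𝓘(ℝ, E), G; 𝓘(ℝ, ℝ), ℝ⟯, leftInvOp E P G u (ofG f) (p, 1) = 0) : u = 0 := by
  let e : Module.Basis (Fin (Module.finrank ℝ E)) ℝ (GroupLieAlgebra 𝓘(ℝ, E) G) :=
    Module.finBasis ℝ E
  refine UEA.eq_zero_of_forall_apply_pow e (leftInvOp E P G)
    (fun X f g => by rw [leftInvOp_incl, leftInvField_mul]) (evalAt (p, 1)) u fun ξ => ?_
  obtain ⟨x, hx, hx'⟩ := exists_contMDiff_tderiv_eq (E := E) (1 : G)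
    (LinearMap.toContinuousLinearMap ((Module.finBasis ℝ E).constr ℝ ξ))
  refine ⟨ofG x, hx, fun i => ?_, fun n => ?_⟩
  · rw [leftInvOp_incl, evalAt_apply, leftInvField_apply]
    simp only [ofG_apply, one_mul]
    refine (hx' (e i)).trans ?_
    exact (Module.finBasis ℝ E).constr_basis ℝ ξ i
  · have : (ofG x : Fn E P G) ^ n = ofG (x ^ n) := by
      ext q
      simp
    rw [this]
    exact h _

/-- The linear functional `u ↦ (u⃗ f)(p, 1)`. -/
def actionFunctional (p : P) (f : C^∞⟮𝓘(ℝ, E), G; 𝓘(ℝ, ℝ), ℝ⟯) :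
    UEA (GroupLieAlgebra 𝓘(ℝ, E) G) →ₗ[ℝ] ℝ :=
  (evalAt (p, 1)).toLinearMap ∘ₗ LinearMap.applyₗ (ofG f : Fn E P G) ∘ₗ
    (leftInvOp E P G).toLinearMap

theorem leftInvOp₂_separating (p : P) (u : UEA₂ (GroupLieAlgebra 𝓘(ℝ, E) G))
    (h : ∀ f g : C^∞⟮𝓘(ℝ, E), G; 𝓘(ℝ, ℝ), ℝ⟯,
      LinearMap.mul' ℝ _ (leftInvOp₂ E P G u (ofG f ⊗ₜ ofG g)) (p, 1) = 0) : u = 0 := by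
  refine tensor_eq_zero_of_separating (actionFunctional p) (actionFunctional p)
    (leftInvOp_separating p) (leftInvOp_separating p) u fun f g => (Eq.trans ?_ (h f g))
  rw [← evalAt_apply]
  clear h
  induction u using TensorProduct.induction_on with
  | zero => simp
  | tmul u v => rw [leftInvOp₂_tmul]; rfl
  | add u v hu hv => simp only [map_add, LinearMap.add_apply, hu, hv]

theorem leftInvOp₃_separating (p : P) (u : UEA₃ (GroupLieAlgebra 𝓘(ℝ, E) G))
    (h : ∀ f g k : C^∞⟮𝓘(ℝ, E), G; 𝓘(ℝ, ℝ), ℝ⟯,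
      mul₃ E P G (leftInvOp₃ E P G u (ofG f ⊗ₜ (ofG g ⊗ₜ ofG k))) (p, 1) = 0) : u = 0 := by
  let ψ : C^∞⟮𝓘(ℝ, E), G; 𝓘(ℝ, ℝ), ℝ⟯ × C^∞⟮𝓘(ℝ, E), G; 𝓘(ℝ, ℝ), ℝ⟯ →
      UEA₂ (GroupLieAlgebra 𝓘(ℝ, E) G) →ₗ[ℝ] ℝ := fun gk =>
    (evalAt (p, 1)).toLinearMap ∘ₗ LinearMap.mul' ℝ _ ∘ₗ
      LinearMap.applyₗ (ofG gk.1 ⊗ₜ ofG gk.2 : Fn E P G ⊗[ℝ] Fn E P G) ∘ₗ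
        (leftInvOp₂ E P G).toLinearMap
  refine tensor_eq_zero_of_separating (actionFunctional p) ψ
    (leftInvOp_separating p) (fun w hw => leftInvOp₂_separating p w fun f g => hw (f, g)) u
    fun f gk => (Eq.trans ?_ (h f gk.1 gk.2))
  rw [← evalAt_apply]
  clear h
  induction u using TensorProduct.induction_on with
  | zero => simp
  | tmul u v => rw [leftInvOp₃_tmul]; rfl
  | add u v hu hv => simp only [map_add, LinearMap.add_apply, hu, hv]

end Action

end DynQuant
end

noncomputable section

namespace DynQuant

/-! ### Calculus of smooth maps to a vector space without topology -/

section Calculus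

variable {P V W : Type*} [NormedAddCommGroup P] [NormedSpace ℝ P] [AddCommGroup V] [Module ℝ V]
  [AddCommGroup W] [Module ℝ W]

theorem IsSmooth.exists_eq_sum {F : P → V} (hF : IsSmooth F) (p₀ : P) :
    ∃ (m : ℕ) (v : Fin m → V) (a : Fin m → C^∞⟮𝓘(ℝ, P), P; 𝓘(ℝ, ℝ), ℝ⟯),
      ∀ᶠ p in 𝓝 p₀, F p = ∑ j, a j p • v j := by
  obtain ⟨m, v, a, ha, h⟩ := hF p₀
  exact ⟨m, v, fun j => ⟨a j, (ha j).contMDiff⟩, h⟩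

theorem isSmooth_const (v : V) : IsSmooth fun _ : P => v := fun _ =>
  ⟨1, fun _ => v, fun _ _ => 1, fun _ => contDiff_const, by simp⟩

theorem IsSmooth.add {F F' : P → V} (hF : IsSmooth F) (hF' : IsSmooth F') :
    IsSmooth (F + F') := by
  intro p₀
  obtain ⟨m, v, a, ha, h⟩ := hF p₀
  obtain ⟨m', v', a', ha', h'⟩ := hF' p₀
  refine ⟨m + m', Fin.append v v', Fin.append a a', fun j => ?_, ?_⟩
  · refine Fin.addCases (fun i => ?_) (fun i => ?_) j
    · simpa using ha i
    · simpa using ha' i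
  · filter_upwards [h, h'] with p hp hp'
    simp [Fin.sum_univ_add, hp, hp']

theorem IsSmooth.map {F : P → V} (hF : IsSmooth F) (L : V →ₗ[ℝ] W) :
    IsSmooth fun p => L (F p) := by
  intro p₀
  obtain ⟨m, v, a, ha, h⟩ := hF p₀
  refine ⟨m, fun j => L (v j), a, ha, ?_⟩
  filter_upwards [h] with p hp
  simp [hp]

theorem IsSmooth.smul {F : P → V} (hF : IsSmooth F) (c : ℝ) : IsSmooth (c • F) :=
  hF.map (LinearMap.lsmul ℝ V c)

/-- The termwise derivative satisfies the defining property of `partialDeriv`, and since linear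
forms separate the points of `V` there is only one such vector; so the choice in the definition is
forced. -/
theorem partialDeriv_eq_sum {F : P → V} {p : P} {m : ℕ} {v : Fin m → V} {a : Fin m → P → ℝ}
    (ha : ∀ j, ContDiff ℝ ∞ (a j)) (h : ∀ᶠ q in 𝓝 p, F q = ∑ j, a j q • v j) (ξ : P) :
    partialDeriv ξ F p = ∑ j, fderiv ℝ (a j) p ξ • v j := by
  have key : ∀ φ : Module.Dual ℝ V,
      HasLineDerivAt ℝ (fun q => φ (F q)) (φ (∑ j, fderiv ℝ (a j) p ξ • v j)) p ξ := by
    intro φ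
    have h1 : HasFDerivAt (fun q => ∑ j, a j q * φ (v j)) (∑ j, φ (v j) • fderiv ℝ (a j) p) p :=
      HasFDerivAt.fun_sum fun j _ =>
        (((ha j).differentiable (by simp) p).hasFDerivAt.mul_const (φ (v j)))
    have h2 : (fun q => φ (F q)) =ᶠ[𝓝 p] fun q => ∑ j, a j q * φ (v j) := by
      filter_upwards [h] with q hq
      simp [hq]
    have h3 := (h1.congr_of_eventuallyEq h2).hasLineDerivAt ξ
    convert h3 using 1
    simp [mul_comm]
  have hε := Classical.epsilon_spec (p := fun w : V => ∀ φ : Module.Dual ℝ V,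
    HasLineDerivAt ℝ (fun q => φ (F q)) (φ w) p ξ) ⟨_, key⟩
  rw [← sub_eq_zero, ← Module.forall_dual_apply_eq_zero_iff ℝ]
  intro φ
  rw [map_sub, sub_eq_zero]
  exact (hε φ).unique (key φ)

theorem IsSmooth.partialDeriv {F : P → V} (hF : IsSmooth F) (ξ : P) :
    IsSmooth (partialDeriv ξ F) := by
  intro p₀
  obtain ⟨m, v, a, ha, h⟩ := hF p₀
  refine ⟨m, v, fun j p => fderiv ℝ (a j) p ξ, fun j =>
    ((ha j).fderiv_right (m := ∞) (by simp)).clm_apply contDiff_const, ?_⟩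
  filter_upwards [h.eventually_nhds] with p hp
  exact partialDeriv_eq_sum ha hp ξ

theorem partialDeriv_map {F : P → V} (hF : IsSmooth F) (L : V →ₗ[ℝ] W) (ξ p : P) :
    partialDeriv ξ (fun p => L (F p)) p = L (partialDeriv ξ F p) := by
  obtain ⟨m, v, a, ha, h⟩ := hF p
  have h' : ∀ᶠ q in 𝓝 p, L (F q) = ∑ j, a j q • L (v j) := by
    filter_upwards [h] with q hq
    simp [hq]
  rw [partialDeriv_eq_sum ha h, partialDeriv_eq_sum ha h']
  simp

theorem partialDeriv_const (v : V) (ξ p : P) : partialDeriv ξ (fun _ => v) p = 0 := by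
  have := partialDeriv_eq_sum (F := fun _ : P => v) (p := p) (m := 1) (v := fun _ => v)
    (a := fun _ _ => 1) (fun _ => contDiff_const) (by simp) ξ
  rw [this]
  simp

theorem partialDeriv_add {F F' : P → V} (hF : IsSmooth F) (hF' : IsSmooth F') (ξ : P) :
    partialDeriv ξ (F + F') = partialDeriv ξ F + partialDeriv ξ F' := by
  ext p
  obtain ⟨m, v, a, ha, h⟩ := hF p
  obtain ⟨m', v', a', ha', h'⟩ := hF' p
  have hs : ∀ᶠ q in 𝓝 p,
      (F + F') q = ∑ j, (Fin.append a a') j q • (Fin.append v v') j := by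
    filter_upwards [h, h'] with q hq hq'
    simp [Fin.sum_univ_add, hq, hq']
  rw [Pi.add_apply, partialDeriv_eq_sum ha h, partialDeriv_eq_sum ha' h',
    partialDeriv_eq_sum (fun j => ?_) hs]
  · simp [Fin.sum_univ_add]
  · refine Fin.addCases (fun i => ?_) (fun i => ?_) j
    · simpa using ha i
    · simpa using ha' i

variable (P) in
/-- The space of smooth maps from `P` to `V` with values in a subspace `K`. -/
def smoothMaps (K : Submodule ℝ V) : Submodule ℝ (P → V) where
  carrier := {F | IsSmooth F ∧ ∀ p, F p ∈ K}
  add_mem' h h' := ⟨h.1.add h'.1, fun p => add_mem (h.2 p) (h'.2 p)⟩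
  zero_mem' := ⟨isSmooth_const 0, fun _ => zero_mem _⟩
  smul_mem' c _ h := ⟨h.1.smul c, fun p => K.smul_mem c (h.2 p)⟩

/-- The derivative in a constant direction, on smooth maps. -/
def smoothDeriv {K : Submodule ℝ V} (ξ : P) : Module.End ℝ (smoothMaps P K) where
  toFun F := ⟨partialDeriv ξ F, F.2.1.partialDeriv ξ, fun p => by
    -- Modulo `K` the map is constantly zero, so its derivative is zero modulo `K`.
    rw [← Submodule.Quotient.mk_eq_zero, ← Submodule.mkQ_apply, ← partialDeriv_map F.2.1]
    have : (fun p => K.mkQ (F.1 p)) = fun _ => 0 := by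
      ext p
      exact (Submodule.Quotient.mk_eq_zero K).2 (F.2.2 p)
    rw [this, partialDeriv_const]⟩
  map_add' F F' := Subtype.ext (partialDeriv_add F.2.1 F'.2.1 ξ)
  map_smul' c F := Subtype.ext (funext fun p =>
    partialDeriv_map F.2.1 (LinearMap.lsmul ℝ V c) ξ p)

theorem smoothDeriv_coe {K : Submodule ℝ V} (ξ : P) (F : smoothMaps P K) :
    (smoothDeriv ξ F : P → V) = partialDeriv ξ F := rfl

end Calculus

/-! ### Bidifferential operators with coefficients depending on the parameter -/

section Coefficients

variable {E P G : Type*} [NormedAddCommGroup E] [NormedSpace ℝ E] [FiniteDimensional ℝ E]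
  [NormedAddCommGroup P] [NormedSpace ℝ P]
  [TopologicalSpace G] [ChartedSpace E G] [Group G] [LieGroup 𝓘(ℝ, E) ∞ G]

/-- The value at `p` of the bidifferential operator with coefficient `F(λ)`. -/
def coeffApply (F : P → UEA₂ (GroupLieAlgebra 𝓘(ℝ, E) G)) (y : Fn E P G ⊗[ℝ] Fn E P G)
    (p : P × G) : ℝ :=
  LinearMap.mul' ℝ (Fn E P G) (leftInvOp₂ E P G (F p.1) y) p

/-- Near a point, `F⃗(λ)` is a finite sum of left-invariant operators with smooth coefficients. -/
theorem exists_coeffApply_eq {F : P → UEA₂ (GroupLieAlgebra 𝓘(ℝ, E) G)} {p₀ : P} {m : ℕ}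
    {v : Fin m → UEA₂ (GroupLieAlgebra 𝓘(ℝ, E) G)}
    {a : Fin m → C^∞⟮𝓘(ℝ, P), P; 𝓘(ℝ, ℝ), ℝ⟯}
    (h : F p₀ = ∑ j, a j p₀ • v j) (y : Fn E P G ⊗[ℝ] Fn E P G) (x : G) :
    coeffApply F y (p₀, x)
      = (∑ j, ofP (a j) * LinearMap.mul' ℝ (Fn E P G) (leftInvOp₂ E P G (v j) y) :
          Fn E P G) (p₀, x) := by
  rw [coeffApply, h, ← evalAt_apply, ← evalAt_apply]
  simp only [map_sum, map_smul, LinearMap.sum_apply, LinearMap.smul_apply, map_mul, smul_eq_mul]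
  rfl

theorem contMDiff_coeffApply {F : P → UEA₂ (GroupLieAlgebra 𝓘(ℝ, E) G)} (hF : IsSmooth F)
    (y : Fn E P G ⊗[ℝ] Fn E P G) :
    ContMDiff ((𝓘(ℝ, P)).prod 𝓘(ℝ, E)) 𝓘(ℝ, ℝ) ∞ (coeffApply F y) := by
  intro p₀
  obtain ⟨m, v, a, h⟩ := hF.exists_eq_sum p₀.1
  refine (ContMDiffMap.contMDiff (∑ j, ofP (a j) * LinearMap.mul' ℝ (Fn E P G)
    (leftInvOp₂ E P G (v j) y) : Fn E P G) p₀).congr_of_eventuallyEq ?_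
  filter_upwards [(continuous_fst.tendsto p₀).eventually h] with p hp
  exact exists_coeffApply_eq hp y p.2

variable {K : Submodule ℝ (UEA₂ (GroupLieAlgebra 𝓘(ℝ, E) G))}

theorem coeffApply_add_left (F F' : P → UEA₂ (GroupLieAlgebra 𝓘(ℝ, E) G))
    (y : Fn E P G ⊗[ℝ] Fn E P G) (p : P × G) :
    coeffApply (F + F') y p = coeffApply F y p + coeffApply F' y p := by
  rw [coeffApply, Pi.add_apply, map_add, LinearMap.add_apply, map_add]
  rfl

theorem coeffApply_smul_left (c : ℝ) (F : P → UEA₂ (GroupLieAlgebra 𝓘(ℝ, E) G))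
    (y : Fn E P G ⊗[ℝ] Fn E P G) (p : P × G) :
    coeffApply (c • F) y p = c * coeffApply F y p := by
  rw [coeffApply, Pi.smul_apply, map_smul, LinearMap.smul_apply, map_smul]
  rfl

theorem coeffApply_add_right (F : P → UEA₂ (GroupLieAlgebra 𝓘(ℝ, E) G))
    (y z : Fn E P G ⊗[ℝ] Fn E P G) (p : P × G) :
    coeffApply F (y + z) p = coeffApply F y p + coeffApply F z p := by
  rw [coeffApply, map_add, map_add]
  rfl

theorem coeffApply_smul_right (c : ℝ) (F : P → UEA₂ (GroupLieAlgebra 𝓘(ℝ, E) G))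
    (y : Fn E P G ⊗[ℝ] Fn E P G) (p : P × G) :
    coeffApply F (c • y) p = c * coeffApply F y p := by
  rw [coeffApply, map_smul, map_smul]
  rfl

/-- The bidifferential operators `F⃗(λ)`, as maps to smooth functions. -/
def coeffOp : smoothMaps P K →ₗ[ℝ] Fn E P G ⊗[ℝ] Fn E P G →ₗ[ℝ] Fn E P G :=
  LinearMap.mk₂ ℝ (fun F y => ⟨coeffApply F.1 y, contMDiff_coeffApply F.2.1 y⟩)
    (fun F F' y => ContMDiffMap.ext fun p => coeffApply_add_left F.1 F'.1 y p)
    (fun c F y => ContMDiffMap.ext fun p => coeffApply_smul_left c F.1 y p)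
    (fun F y z => ContMDiffMap.ext fun p => coeffApply_add_right F.1 y z p)
    (fun c F y => ContMDiffMap.ext fun p => coeffApply_smul_right c F.1 y p)

theorem coeffOp_apply (F : smoothMaps P K) (y : Fn E P G ⊗[ℝ] Fn E P G) (p : P × G) :
    coeffOp F y p = LinearMap.mul' ℝ (Fn E P G) (leftInvOp₂ E P G (F.1 p.1) y) p := rfl

/-- `D ⊗ 1 + 1 ⊗ D`. -/
def leibniz (D : Module.End ℝ (Fn E P G)) : Module.End ℝ (Fn E P G ⊗[ℝ] Fn E P G) :=
  TensorProduct.map D LinearMap.id + TensorProduct.map LinearMap.id D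

theorem leibniz_commute_leftInvOp₂ {D : Module.End ℝ (Fn E P G)}
    (hD : ∀ u, Commute (leftInvOp E P G u) D) (v : UEA₂ (GroupLieAlgebra 𝓘(ℝ, E) G)) :
    Commute (leftInvOp₂ E P G v) (leibniz D) := by
  induction v using TensorProduct.induction_on with
  | zero => rw [map_zero]; exact Commute.zero_left _
  | tmul u v =>
    rw [leftInvOp₂_tmul, leibniz]
    refine Commute.add_right ?_ ?_
    · rw [commute_iff_eq, Module.End.mul_eq_comp, Module.End.mul_eq_comp,
        ← TensorProduct.map_comp, ← TensorProduct.map_comp]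
      exact congrArg₂ TensorProduct.map (hD u) rfl
    · rw [commute_iff_eq, Module.End.mul_eq_comp, Module.End.mul_eq_comp,
        ← TensorProduct.map_comp, ← TensorProduct.map_comp]
      exact congrArg₂ TensorProduct.map rfl (hD v)
  | add u v hu hv => rw [map_add]; exact hu.add_left hv

omit [FiniteDimensional ℝ E] [Group G] [LieGroup 𝓘(ℝ, E) ∞ G] in
theorem mul'_leibniz {D : Module.End ℝ (Fn E P G)}
    (hD : ∀ f g, D (f * g) = f * D g + g * D f) (y : Fn E P G ⊗[ℝ] Fn E P G) :
    LinearMap.mul' ℝ (Fn E P G) (leibniz D y) = D (LinearMap.mul' ℝ (Fn E P G) y) := by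
  induction y using TensorProduct.induction_on with
  | zero => simp
  | tmul f g => simp [leibniz, hD]; ring
  | add y z hy hz => simp only [map_add, hy, hz]

omit [FiniteDimensional ℝ E] in
theorem partialP_congr {f g : Fn E P G} {p : P × G} (ξ : P)
    (h : ∀ᶠ q in 𝓝 p.1, f (q, p.2) = g (q, p.2)) : partialP ξ f p = partialP ξ g p := by
  have h' : (fun q => f (q, p.2)) =ᶠ[𝓝 p.1] fun q => g (q, p.2) := h
  rw [partialP_apply, partialP_apply, h'.fderiv_eq]

/-- Near a point `F` is a finite sum of functions times constant elements. The Leibniz rule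
differentiates the functions, and past the constant elements the derivative moves to the two
arguments, since it commutes with left-invariant operators. -/
theorem partialP_coeffOp (ξ : P) (F : smoothMaps P K) (y : Fn E P G ⊗[ℝ] Fn E P G) :
    partialP ξ (coeffOp F y)
      = coeffOp (smoothDeriv ξ F) y + coeffOp F (leibniz (partialP ξ) y) := by
  ext p
  obtain ⟨m, v, a, h⟩ := F.2.1.exists_eq_sum p.1
  have h0 := h.self_of_nhds
  have hd : (smoothDeriv ξ F : P → UEA₂ (GroupLieAlgebra 𝓘(ℝ, E) G)) p.1
      = ∑ j, dirDeriv ξ (a j) p.1 • v j :=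
    partialDeriv_eq_sum (fun j => (a j).contMDiff.contDiff) h ξ
  have e1 : coeffOp (smoothDeriv ξ F) y p = _ := exists_coeffApply_eq hd y p.2
  have e2 : coeffOp F (leibniz (partialP ξ) y) p = _ := exists_coeffApply_eq h0 _ p.2
  have e3 : partialP ξ (coeffOp F y) p = partialP ξ (∑ j, ofP (a j) *
      LinearMap.mul' ℝ (Fn E P G) (leftInvOp₂ E P G (v j) y) : Fn E P G) p :=
    partialP_congr ξ (h.mono fun q hq => exists_coeffApply_eq hq y p.2)
  rw [ContMDiffMap.coe_add, Pi.add_apply, e1, e2, e3,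
    ← Pi.add_apply, ← ContMDiffMap.coe_add, map_sum, ← Finset.sum_add_distrib]
  refine DFunLike.congr_fun (Finset.sum_congr rfl fun j _ => ?_) p
  rw [partialP_mul, partialP_ofP, ← mul'_leibniz (partialP_mul ξ),
    ← Module.End.mul_apply (leibniz _),
    ← (leibniz_commute_leftInvOp₂ (fun u => leftInvOp_commute_partialP u ξ) (v j)).eq,
    Module.End.mul_apply]
  ring

/-- Pulling back along the constant map `p` makes the two functions equal everywhere. -/
theorem leftInvOp_congr {f g : Fn E P G} {p : P} (h : ∀ x, f (p, x) = g (p, x))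
    (u : UEA (GroupLieAlgebra 𝓘(ℝ, E) G)) (x : G) :
    leftInvOp E P G u f (p, x) = leftInvOp E P G u g (p, x) := by
  let j : C^∞⟮𝓘(ℝ, P), P; 𝓘(ℝ, P), P⟯ := ⟨fun _ => p, contMDiff_const⟩
  have e : pullback j f = (pullback j g : Fn E P G) := by
    ext q
    exact h q.2
  have := congrArg (leftInvOp E P G u) e
  rw [leftInvOp_pullback, leftInvOp_pullback] at this
  exact DFunLike.congr_fun this (p, x)

/-- As `u⃗` acts only along `G`, the coefficient can be frozen at `λ`, and the comultiplication rule
applies. This is the origin of `Δ` in the cocycle equation. -/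
theorem leftInvOp_coeffOp (u : UEA (GroupLieAlgebra 𝓘(ℝ, E) G)) (F : smoothMaps P K)
    (y : Fn E P G ⊗[ℝ] Fn E P G) (p : P × G) :
    leftInvOp E P G u (coeffOp F y) p
      = LinearMap.mul' ℝ (Fn E P G) (leftInvOp₂ E P G (comul u * F.1 p.1) y) p := by
  rw [map_mul, Module.End.mul_apply, mul'_leftInvOp₂_comul]
  exact leftInvOp_congr (p := p.1) (fun x => coeffOp_apply F y (p.1, x)) u p.2

theorem leftInvOp₂_comul_incl (X : GroupLieAlgebra 𝓘(ℝ, E) G) :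
    leftInvOp₂ E P G (comul (incl X)) = leibniz (leftInvField X) := by
  rw [comul_incl, map_add, leftInvOp₂_tmul, leftInvOp₂_tmul, map_one, leftInvOp_incl]
  rfl

/-- The zero weight subspace of `U𝔤 ⊗ U𝔤`. -/
def zeroWeight (𝔥 : LieSubalgebra ℝ (GroupLieAlgebra 𝓘(ℝ, E) G)) :
    Submodule ℝ (UEA₂ (GroupLieAlgebra 𝓘(ℝ, E) G)) where
  carrier := {v | ∀ h ∈ 𝔥, Commute (comul (incl h)) v}
  add_mem' hv hw h hh := (hv h hh).add_right (hw h hh)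
  zero_mem' _ _ := Commute.zero_right _
  smul_mem' c _ hv h hh := (hv h hh).smul_right c

/-- `Δh` commutes with coefficients of zero weight, so it can be moved past them to the arguments.
-/
theorem leftInvField_coeffOp {𝔥 : LieSubalgebra ℝ (GroupLieAlgebra 𝓘(ℝ, E) G)}
    (F : smoothMaps P (zeroWeight 𝔥)) {h : GroupLieAlgebra 𝓘(ℝ, E) G} (hh : h ∈ 𝔥)
    (y : Fn E P G ⊗[ℝ] Fn E P G) :
    leftInvField h (coeffOp F y) = coeffOp F (leibniz (leftInvField h) y) := by
  ext p
  rw [← leftInvOp_incl, leftInvOp_coeffOp, coeffOp_apply, leftInvOp_incl,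
    ← leftInvOp₂_comul_incl, (F.2.2 p.1 h hh).eq, map_mul, Module.End.mul_apply]

end Coefficients

end DynQuant
end

noncomputable section

namespace DynQuant

/-! ### Divided powers of operators -/

section Exponential

open Finset HasAntidiagonal

variable {V W Z : Type*} [AddCommGroup V] [Module ℝ V] [AddCommGroup W] [Module ℝ W]
  [AddCommGroup Z] [Module ℝ Z]

/-- The divided power `Xᵏ / k!`, the coefficient of `ħᵏ` in `exp (ħ X)`. -/
def divPow (X : Module.End ℝ V) (k : ℕ) : Module.End ℝ V := ((k.factorial : ℝ))⁻¹ • X ^ k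

@[simp]
theorem divPow_zero (X : Module.End ℝ V) : divPow X 0 = 1 := by simp [divPow]

@[simp]
theorem divPow_one (X : Module.End ℝ V) : divPow X 1 = X := by simp [divPow]

theorem divPow_add {X Y : Module.End ℝ V} (h : Commute X Y) (n : ℕ) :
    divPow (X + Y) n = ∑ ij ∈ antidiagonal n, divPow X ij.1 * divPow Y ij.2 := by
  rw [divPow, h.add_pow', Finset.smul_sum]
  refine Finset.sum_congr rfl fun ij hij => ?_
  obtain rfl := HasAntidiagonal.mem_antidiagonal.1 hij
  rw [divPow, divPow, smul_mul_smul_comm, ← Nat.cast_smul_eq_nsmul ℝ, smul_smul]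
  congr 1
  have h1 : (((ij.1 + ij.2).choose ij.1 * ij.1.factorial * ij.2.factorial : ℕ) : ℝ)
      = ((ij.1 + ij.2).factorial : ℝ) := by
    rw [Nat.choose_symm_add, Nat.add_choose_mul_factorial_mul_factorial]
  have h2 : ((ij.1 + ij.2).factorial : ℝ) ≠ 0 := by exact_mod_cast Nat.factorial_ne_zero _
  have h3 : (ij.1.factorial : ℝ) ≠ 0 := by exact_mod_cast Nat.factorial_ne_zero _
  have h4 : (ij.2.factorial : ℝ) ≠ 0 := by exact_mod_cast Nat.factorial_ne_zero _
  push_cast at h1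
  field_simp
  linarith

theorem divPow_intertwine {m : V →ₗ[ℝ] W} {X : Module.End ℝ V} {Y : Module.End ℝ W}
    (h : ∀ v, m (X v) = Y (m v)) (k : ℕ) (v : V) : m (divPow X k v) = divPow Y k (m v) := by
  have key : ∀ v, m ((X ^ k) v) = (Y ^ k) (m v) := by
    induction k with
    | zero => simp
    | succ k ih => intro v; rw [pow_succ, Module.End.mul_apply, ih, h, pow_succ,
        Module.End.mul_apply]
  rw [divPow, LinearMap.smul_apply, map_smul, key, divPow, LinearMap.smul_apply]

theorem sum_pow_eq_sum_list_prod {R : Type*} [Semiring R] {l : ℕ} (x : Fin l → R) (k : ℕ) :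
    (∑ i, x i) ^ k = ∑ I : Fin k → Fin l, (List.ofFn fun j => x (I j)).prod := by
  induction k with
  | zero => simp
  | succ k ih =>
    rw [pow_succ', ih, Finset.sum_mul_sum, ← Fintype.sum_prod_type',
      ← (Fin.consEquiv fun _ : Fin (k + 1) => Fin l).sum_comp]
    refine Finset.sum_congr rfl fun p _ => ?_
    simp [Fin.consEquiv, List.ofFn_succ]

theorem map_list_prod_tensor {l k : ℕ} (x : Fin l → Module.End ℝ V) (y : Fin l → Module.End ℝ W)
    (I : Fin k → Fin l) :
    (List.ofFn fun j => TensorProduct.map (x (I j)) (y (I j))).prod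
      = (TensorProduct.map (List.ofFn fun j => x (I j)).prod (List.ofFn fun j => y (I j)).prod :
          Module.End ℝ (V ⊗[ℝ] W)) := by
  induction k with
  | zero => simp
  | succ k ih =>
    rw [List.ofFn_succ, List.ofFn_succ, List.ofFn_succ, List.prod_cons, List.prod_cons,
      List.prod_cons, ih fun j => I j.succ, TensorProduct.map_mul]

/-- If `θ Ψ_F = Ψ_F σ + c ∑ᵢ Ψ_{∂ᵢF} ηᵢ`, then `exp (ħθ) Ψ_F` is given by the formal Taylor
expansion of `F`. -/
theorem divPow_shift {S : Type*} [AddCommGroup S] [Module ℝ S] {l : ℕ}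
    (d : Fin l → Module.End ℝ S) (Ψ : S →ₗ[ℝ] V →ₗ[ℝ] W) (θ : Module.End ℝ W)
    (η : Fin l → Module.End ℝ V) (σ : Module.End ℝ V) (c : ℝ) (hησ : ∀ i, Commute (η i) σ)
    (h : ∀ F y, θ (Ψ F y) = Ψ F (σ y) + c • ∑ i, Ψ (d i F) (η i y)) (n : ℕ) (F : S) (y : V) :
    divPow θ n (Ψ F y) = ∑ ks ∈ antidiagonal n, ((ks.1.factorial : ℝ)⁻¹ * c ^ ks.1) •
      ∑ I : Fin ks.1 → Fin l, Ψ ((List.ofFn fun j => d (I j)).prod F)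
        ((List.ofFn fun j => η (I j)).prod (divPow σ ks.2 y)) := by
  -- The coefficient is made a tensor factor of its own. Under the map `F ⊗ y ↦ Ψ F y`, `θ`
  -- corresponds to `τ + σ'`; these commute, so the exponential splits, and the powers of `τ` give
  -- the Taylor expansion in `F`.
  set τ : Module.End ℝ (S ⊗[ℝ] V) := c • ∑ i, TensorProduct.map (d i) (η i) with hτ
  set σ' : Module.End ℝ (S ⊗[ℝ] V) := TensorProduct.map 1 σ with hσ'
  have hcomm : Commute τ σ' := by
    refine Commute.smul_left ?_ c
    refine Commute.sum_left _ _ _ fun i _ => ?_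
    rw [commute_iff_eq, ← TensorProduct.map_mul, ← TensorProduct.map_mul, (hησ i).eq, mul_one,
      one_mul]
  have hint : ∀ t, TensorProduct.lift Ψ ((τ + σ') t) = θ (TensorProduct.lift Ψ t) := by
    intro t
    induction t using TensorProduct.induction_on with
    | zero => simp
    | tmul F y =>
      rw [TensorProduct.lift.tmul, h, LinearMap.add_apply, map_add, add_comm]
      simp [hτ, hσ', map_sum]
    | add s t hs ht => simp only [map_add, hs, ht]
  have key := divPow_intertwine hint n (F ⊗ₜ y)
  rw [TensorProduct.lift.tmul] at key
  rw [← key, divPow_add hcomm, LinearMap.sum_apply, map_sum]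
  refine Finset.sum_congr rfl fun ks _ => ?_
  have e1 : divPow σ' ks.2 (F ⊗ₜ y) = F ⊗ₜ divPow σ ks.2 y := by
    rw [hσ', divPow, TensorProduct.map_pow, one_pow, divPow]
    simp
  have e2 : divPow τ ks.1 = ((ks.1.factorial : ℝ)⁻¹ * c ^ ks.1) • ∑ I : Fin ks.1 → Fin l,
      TensorProduct.map (List.ofFn fun j => d (I j)).prod (List.ofFn fun j => η (I j)).prod := by
    rw [divPow, hτ, smul_pow, smul_smul, sum_pow_eq_sum_list_prod]
    simp only [map_list_prod_tensor]
  rw [Module.End.mul_apply, e1, e2]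
  simp [map_sum]

/-- Both sides sum over all quintuples of natural numbers with total `n`; they differ only in the
bracketing. -/
theorem sum_antidiagonal_reindex {M : Type*} [AddCommMonoid M] (T : ℕ → ℕ → ℕ → ℕ → ℕ → M)
    (n : ℕ) :
    ∑ uv ∈ antidiagonal n, ∑ ae ∈ antidiagonal uv.1, ∑ md ∈ antidiagonal uv.2,
      ∑ ks ∈ antidiagonal ae.2, T ae.1 ks.1 ks.2 md.1 md.2
    = ∑ qt ∈ antidiagonal n, ∑ az ∈ antidiagonal qt.1, ∑ km ∈ antidiagonal az.2,
      ∑ sd ∈ antidiagonal qt.2, T az.1 km.1 sd.1 km.2 sd.2 := by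
  simp only [Finset.sum_sigma']
  refine Finset.sum_nbij'
    (fun x => ⟨(x.2.1.1 + x.2.2.2.1 + x.2.2.1.1, x.2.2.2.2 + x.2.2.1.2),
      (x.2.1.1, x.2.2.2.1 + x.2.2.1.1), (x.2.2.2.1, x.2.2.1.1), (x.2.2.2.2, x.2.2.1.2)⟩)
    (fun x => ⟨(x.2.1.1 + x.2.2.1.1 + x.2.2.2.1, x.2.2.1.2 + x.2.2.2.2),
      (x.2.1.1, x.2.2.1.1 + x.2.2.2.1), (x.2.2.1.2, x.2.2.2.2), (x.2.2.1.1, x.2.2.2.1)⟩)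
    ?_ ?_ ?_ ?_ ?_
  · rintro ⟨⟨u, v⟩, ⟨a, e⟩, ⟨m, d⟩, ⟨k, s⟩⟩ h
    simp only [mem_sigma, HasAntidiagonal.mem_antidiagonal] at h ⊢
    obtain ⟨h1, rfl, rfl, rfl⟩ := h
    refine ⟨?_, ?_, trivial, trivial⟩
    · rw [← h1]; ring
    · ring
  · rintro ⟨⟨u, v⟩, ⟨a, e⟩, ⟨m, d⟩, ⟨k, s⟩⟩ h
    simp only [mem_sigma, HasAntidiagonal.mem_antidiagonal] at h ⊢
    obtain ⟨h1, rfl, rfl, rfl⟩ := h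
    refine ⟨?_, ?_, trivial, trivial⟩
    · rw [← h1]; ring
    · ring
  · rintro ⟨⟨u, v⟩, ⟨a, e⟩, ⟨m, d⟩, ⟨k, s⟩⟩ h
    simp only [mem_sigma, HasAntidiagonal.mem_antidiagonal] at h
    obtain ⟨h1, rfl, rfl, rfl⟩ := h
    simp only [add_assoc]
  · rintro ⟨⟨u, v⟩, ⟨a, e⟩, ⟨m, d⟩, ⟨k, s⟩⟩ h
    simp only [mem_sigma, HasAntidiagonal.mem_antidiagonal] at h
    obtain ⟨h1, rfl, rfl, rfl⟩ := h
    simp only [add_assoc]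
  · rintro ⟨⟨u, v⟩, ⟨a, e⟩, ⟨m, d⟩, ⟨k, s⟩⟩ h
    rfl

/-- Composition of two series of operators of the form `Φ exp (ħθ)`, in terms of formal Taylor
expansions of the coefficients of the inner one. -/
theorem comp_divPow_shift {S : Type*} [AddCommGroup S] [Module ℝ S] {l : ℕ}
    (d : Fin l → Module.End ℝ S) (Ψ : S →ₗ[ℝ] V →ₗ[ℝ] W) (θ : Module.End ℝ W)
    (η : Fin l → Module.End ℝ V) (σ ρ : Module.End ℝ V) (c : ℝ) (hησ : ∀ i, Commute (η i) σ)
    (hσρ : Commute σ ρ)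
    (h : ∀ F y, θ (Ψ F y) = Ψ F (σ y) + c • ∑ i, Ψ (d i F) (η i y)) (Φ : ℕ → W →ₗ[ℝ] Z)
    (F : ℕ → S) (n : ℕ) (y : V) :
    ∑ uv ∈ antidiagonal n, ∑ ae ∈ antidiagonal uv.1,
      Φ ae.1 (divPow θ ae.2 (∑ md ∈ antidiagonal uv.2, Ψ (F md.1) (divPow ρ md.2 y)))
    = ∑ qt ∈ antidiagonal n, ∑ az ∈ antidiagonal qt.1, ∑ km ∈ antidiagonal az.2,
      ((km.1.factorial : ℝ)⁻¹ * c ^ km.1) • ∑ I : Fin km.1 → Fin l,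
        Φ az.1 (Ψ ((List.ofFn fun j => d (I j)).prod (F km.2))
          ((List.ofFn fun j => η (I j)).prod (divPow (σ + ρ) qt.2 y))) := by
  have := sum_antidiagonal_reindex (fun a k s m t => ((k.factorial : ℝ)⁻¹ * c ^ k) •
    ∑ I : Fin k → Fin l, Φ a (Ψ ((List.ofFn fun j => d (I j)).prod (F m))
      ((List.ofFn fun j => η (I j)).prod (divPow σ s (divPow ρ t y))))) n
  simp only [map_sum, divPow_shift d Ψ θ η σ c hησ h, map_smul]
  rw [this]
  refine Finset.sum_congr rfl fun qt _ => Finset.sum_congr rfl fun az _ =>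
    Finset.sum_congr rfl fun km _ => ?_
  -- The exponential of `σ`, coming from the outer product, and that of `ρ`, from the inner one,
  -- combine to the exponential of `σ + ρ`.
  rw [divPow_add hσρ, ← Finset.smul_sum, Finset.sum_comm]
  simp only [LinearMap.sum_apply, map_sum, Module.End.mul_apply]

end Exponential

end DynQuant
end

noncomputable section

namespace DynQuant

/-! ### Operators on three functions -/

section Legs

variable {A : Type*} [AddCommGroup A] [Module ℝ A]

/-- The operators acting on one of three functions. -/
def leg : Fin 3 → Module.End ℝ A →ₐ[ℝ] Module.End ℝ (A ⊗[ℝ] (A ⊗[ℝ] A)) :=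
  ![Module.End.rTensorAlgHom ℝ A (A ⊗[ℝ] A),
    (Module.End.lTensorAlgHom ℝ (A ⊗[ℝ] A) A).comp (Module.End.rTensorAlgHom ℝ A A),
    (Module.End.lTensorAlgHom ℝ (A ⊗[ℝ] A) A).comp (Module.End.lTensorAlgHom ℝ A A)]

@[simp]
theorem leg_zero_tmul (D : Module.End ℝ A) (f g k : A) :
    leg 0 D (f ⊗ₜ (g ⊗ₜ k)) = D f ⊗ₜ (g ⊗ₜ k) := rfl

@[simp]
theorem leg_one_tmul (D : Module.End ℝ A) (f g k : A) :
    leg 1 D (f ⊗ₜ (g ⊗ₜ k)) = f ⊗ₜ (D g ⊗ₜ k) := rfl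

@[simp]
theorem leg_two_tmul (D : Module.End ℝ A) (f g k : A) :
    leg 2 D (f ⊗ₜ (g ⊗ₜ k)) = f ⊗ₜ (g ⊗ₜ D k) := rfl

theorem tensor₃_ext {B : Type*} [AddCommGroup B] [Module ℝ B]
    {S T : A ⊗[ℝ] (A ⊗[ℝ] A) →ₗ[ℝ] B} (h : ∀ f g k, S (f ⊗ₜ (g ⊗ₜ k)) = T (f ⊗ₜ (g ⊗ₜ k))) :
    S = T := by
  ext f g k
  exact h f g k

theorem leg_commute {D D' : Module.End ℝ A} (h : Commute D D') (a c : Fin 3) :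
    Commute (leg a D) (leg c D') := by
  by_cases hac : a = c
  · subst hac
    exact h.map (leg a)
  · refine tensor₃_ext fun f g k => ?_
    fin_cases a <;> fin_cases c <;> first | exact absurd rfl hac | rfl

end Legs

/-! ### Iterated products and the formal shift of coefficients -/

section DynamicalAction

open Finset HasAntidiagonal

variable {A S : Type*} [AddCommGroup A] [Module ℝ A] [AddCommGroup S] [Module ℝ S] {l : ℕ}

/-- `½ ∑ᵢ (hᵢ ⊗ dᵢ - dᵢ ⊗ hᵢ)`. -/
def thetaOf (h d : Fin l → Module.End ℝ A) : Module.End ℝ (A ⊗[ℝ] A) :=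
  (1 / 2 : ℝ) • ∑ i, (TensorProduct.map (h i) (d i) - TensorProduct.map (d i) (h i))

/-- The operator `½ ∑ᵢ (hᵢ ⊗ dᵢ - dᵢ ⊗ hᵢ)` acting on the functions with indices `a` and `c`. -/
def thetaLeg (h d : Fin l → Module.End ℝ A) (a c : Fin 3) :
    Module.End ℝ (A ⊗[ℝ] (A ⊗[ℝ] A)) :=
  (1 / 2 : ℝ) • ∑ i, (leg a (h i) * leg c (d i) - leg a (d i) * leg c (h i))

theorem thetaOf_tmul (h d : Fin l → Module.End ℝ A) (f g : A) :
    thetaOf h d (f ⊗ₜ g) = (1 / 2 : ℝ) • ∑ i, (h i f ⊗ₜ d i g - d i f ⊗ₜ h i g) := by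
  rw [thetaOf, LinearMap.smul_apply, LinearMap.sum_apply]
  rfl

theorem commute_thetaLeg {h d : Fin l → Module.End ℝ A}
    {X : Module.End ℝ (A ⊗[ℝ] (A ⊗[ℝ] A))} (hh : ∀ a i, Commute X (leg a (h i)))
    (hd : ∀ a i, Commute X (leg a (d i))) (a c : Fin 3) : Commute X (thetaLeg h d a c) :=
  (Commute.sum_right _ _ _ fun i _ => ((hh a i).mul_right (hd c i)).sub_right
    ((hd a i).mul_right (hh c i))).smul_right _

/-- `θ` acting on the first two functions. -/
theorem assoc_symm_thetaLeg (h d : Fin l → Module.End ℝ A) (y : A ⊗[ℝ] (A ⊗[ℝ] A)) :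
    (TensorProduct.assoc ℝ A A A).symm (thetaLeg h d 0 1 y)
      = LinearMap.rTensor A (thetaOf h d) ((TensorProduct.assoc ℝ A A A).symm y) := by
  have : (TensorProduct.assoc ℝ A A A).symm.toLinearMap ∘ₗ thetaLeg h d 0 1
      = LinearMap.rTensor A (thetaOf h d) ∘ₗ (TensorProduct.assoc ℝ A A A).symm.toLinearMap := by
    refine tensor₃_ext fun f g k => ?_
    simp only [LinearMap.comp_apply, LinearEquiv.coe_coe, TensorProduct.assoc_symm_tmul,
      LinearMap.rTensor_tmul, thetaOf_tmul, thetaLeg,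
      LinearMap.smul_apply, LinearMap.sum_apply, LinearMap.sub_apply, Module.End.mul_apply,
      leg_zero_tmul, leg_one_tmul, map_smul, map_sum, map_sub, ← TensorProduct.smul_tmul',
      TensorProduct.sum_tmul, TensorProduct.sub_tmul]
  exact DFunLike.congr_fun this y

/-- `θ` acting on the last two functions. -/
theorem thetaLeg_one_two (h d : Fin l → Module.End ℝ A) :
    thetaLeg h d 1 2 = LinearMap.lTensor A (thetaOf h d) := by
  refine tensor₃_ext fun f g k => ?_
  simp only [LinearMap.lTensor_tmul, thetaOf_tmul, thetaLeg,
    LinearMap.smul_apply, LinearMap.sum_apply, LinearMap.sub_apply, Module.End.mul_apply,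
    leg_two_tmul, leg_one_tmul, TensorProduct.tmul_smul, TensorProduct.tmul_sum,
    TensorProduct.tmul_sub]

/-- A bilinear operator on the first two of three functions. -/
def onLeft (Φ : S →ₗ[ℝ] A ⊗[ℝ] A →ₗ[ℝ] A) : S →ₗ[ℝ] A ⊗[ℝ] (A ⊗[ℝ] A) →ₗ[ℝ] A ⊗[ℝ] A :=
  LinearMap.lcomp ℝ (A ⊗[ℝ] A) (TensorProduct.assoc ℝ A A A).symm.toLinearMap ∘ₗ
    LinearMap.rTensorHom A ∘ₗ Φ

/-- A bilinear operator on the last two of three functions. -/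
def onRight (Φ : S →ₗ[ℝ] A ⊗[ℝ] A →ₗ[ℝ] A) : S →ₗ[ℝ] A ⊗[ℝ] (A ⊗[ℝ] A) →ₗ[ℝ] A ⊗[ℝ] A :=
  LinearMap.lTensorHom A ∘ₗ Φ

theorem onLeft_apply (Φ : S →ₗ[ℝ] A ⊗[ℝ] A →ₗ[ℝ] A) (F : S) (y : A ⊗[ℝ] (A ⊗[ℝ] A)) :
    onLeft Φ F y = LinearMap.rTensor A (Φ F) ((TensorProduct.assoc ℝ A A A).symm y) := rfl

theorem onRight_apply (Φ : S →ₗ[ℝ] A ⊗[ℝ] A →ₗ[ℝ] A) (F : S) (y : A ⊗[ℝ] (A ⊗[ℝ] A)) :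
    onRight Φ F y = LinearMap.lTensor A (Φ F) y := rfl

@[simp]
theorem onLeft_tmul (Φ : S →ₗ[ℝ] A ⊗[ℝ] A →ₗ[ℝ] A) (F : S) (f g k : A) :
    onLeft Φ F (f ⊗ₜ (g ⊗ₜ k)) = Φ F (f ⊗ₜ g) ⊗ₜ k := rfl

@[simp]
theorem onRight_tmul (Φ : S →ₗ[ℝ] A ⊗[ℝ] A →ₗ[ℝ] A) (F : S) (f g k : A) :
    onRight Φ F (f ⊗ₜ (g ⊗ₜ k)) = f ⊗ₜ Φ F (g ⊗ₜ k) := rfl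

/-- Commuting operators `hᵢ` and `dᵢ` that act on the values `Φ_F (f, g)` by the Leibniz rule,
where `hᵢ` kills the coefficients `F` and `dᵢ` acts on them by `δᵢ`. -/
structure IsDynamicalAction (h d : Fin l → Module.End ℝ A) (δ : Fin l → Module.End ℝ S)
    (Φ : S →ₗ[ℝ] A ⊗[ℝ] A →ₗ[ℝ] A) : Prop where
  commute_h_h : ∀ i j, Commute (h i) (h j)
  commute_h_d : ∀ i j, Commute (h i) (d j)
  commute_d_d : ∀ i j, Commute (d i) (d j)
  h_apply : ∀ i F f g, h i (Φ F (f ⊗ₜ g)) = Φ F (h i f ⊗ₜ g) + Φ F (f ⊗ₜ h i g)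
  d_apply : ∀ i F f g, d i (Φ F (f ⊗ₜ g))
    = Φ (δ i F) (f ⊗ₜ g) + (Φ F (d i f ⊗ₜ g) + Φ F (f ⊗ₜ d i g))

variable {h d : Fin l → Module.End ℝ A} {δ : Fin l → Module.End ℝ S}
  {Φ : S →ₗ[ℝ] A ⊗[ℝ] A →ₗ[ℝ] A}

namespace IsDynamicalAction

variable (H : IsDynamicalAction h d δ Φ)
include H

theorem leg_h_commute_thetaLeg (e : Fin 3) (i : Fin l) (a c : Fin 3) :
    Commute (leg e (h i)) (thetaLeg h d a c) :=
  commute_thetaLeg (fun _ _ => leg_commute (H.commute_h_h _ _) _ _)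
    (fun _ _ => leg_commute (H.commute_h_d _ _) _ _) a c

theorem thetaLeg_commute_thetaLeg (a c a' c' : Fin 3) :
    Commute (thetaLeg h d a c) (thetaLeg h d a' c') :=
  commute_thetaLeg (fun _ _ => (H.leg_h_commute_thetaLeg _ _ _ _).symm)
    (fun _ _ => (commute_thetaLeg (fun _ _ => leg_commute (H.commute_h_d _ _).symm _ _)
      (fun _ _ => leg_commute (H.commute_d_d _ _) _ _) a c).symm) a' c'

/-- By the Leibniz rule, `θ` is distributed over the first two functions, while `dᵢ` also hits the
coefficient. In `θ` this derivative stands in the first factor with sign `-½`, next to `hᵢ` on the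
third function: hence the shift `λ - ½ħh⁽³⁾`. -/
theorem theta_onLeft (F : S) (y : A ⊗[ℝ] (A ⊗[ℝ] A)) :
    thetaOf h d (onLeft Φ F y) = onLeft Φ F ((thetaLeg h d 0 2 + thetaLeg h d 1 2) y)
      + (-(1 / 2) : ℝ) • ∑ i, onLeft Φ (δ i F) (leg 2 (h i) y) := by
  have : thetaOf h d ∘ₗ onLeft Φ F = onLeft Φ F ∘ₗ (thetaLeg h d 0 2 + thetaLeg h d 1 2)
      + (-(1 / 2) : ℝ) • ∑ i, onLeft Φ (δ i F) ∘ₗ leg 2 (h i) := by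
    refine tensor₃_ext fun f g k => ?_
    simp only [LinearMap.comp_apply, LinearMap.add_apply, onLeft_tmul, thetaOf_tmul, thetaLeg,
      H.h_apply, H.d_apply, LinearMap.smul_apply, LinearMap.sum_apply, LinearMap.sub_apply,
      Module.End.mul_apply, leg_zero_tmul, leg_one_tmul, leg_two_tmul, map_smul, map_sum, map_sub,
      map_add, TensorProduct.add_tmul, Finset.smul_sum, ← Finset.sum_add_distrib]
    refine Finset.sum_congr rfl fun i _ => ?_
    module
  have key := DFunLike.congr_fun this y
  simpa only [LinearMap.comp_apply, LinearMap.add_apply, LinearMap.smul_apply,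
    LinearMap.sum_apply] using key

/-- Here the coefficient is in the second factor of `θ`, where `dᵢ` has the sign `+½` and is paired
with `hᵢ` on the first function: hence the shift `λ + ½ħh⁽¹⁾`. -/
theorem theta_onRight (F : S) (y : A ⊗[ℝ] (A ⊗[ℝ] A)) :
    thetaOf h d (onRight Φ F y) = onRight Φ F ((thetaLeg h d 0 1 + thetaLeg h d 0 2) y)
      + (1 / 2 : ℝ) • ∑ i, onRight Φ (δ i F) (leg 0 (h i) y) := by
  have : thetaOf h d ∘ₗ onRight Φ F = onRight Φ F ∘ₗ (thetaLeg h d 0 1 + thetaLeg h d 0 2)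
      + (1 / 2 : ℝ) • ∑ i, onRight Φ (δ i F) ∘ₗ leg 0 (h i) := by
    refine tensor₃_ext fun f g k => ?_
    simp only [LinearMap.comp_apply, LinearMap.add_apply, onRight_tmul, thetaOf_tmul, thetaLeg,
      H.h_apply, H.d_apply, LinearMap.smul_apply, LinearMap.sum_apply, LinearMap.sub_apply,
      Module.End.mul_apply, leg_zero_tmul, leg_one_tmul, leg_two_tmul, map_smul, map_sum, map_sub,
      map_add, TensorProduct.tmul_add, Finset.smul_sum, ← Finset.sum_add_distrib]
    refine Finset.sum_congr rfl fun i _ => ?_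
    module
  have key := DFunLike.congr_fun this y
  simpa only [LinearMap.comp_apply, LinearMap.add_apply, LinearMap.smul_apply,
    LinearMap.sum_apply] using key

end IsDynamicalAction

/-- The coefficient of `ħⁿ` in `Φ_F exp (ħθ)`, for a series `F`. -/
def seriesOp (h d : Fin l → Module.End ℝ A) (Φ : S →ₗ[ℝ] A ⊗[ℝ] A →ₗ[ℝ] A) (F : ℕ → S) (n : ℕ) :
    A ⊗[ℝ] A →ₗ[ℝ] A :=
  ∑ ij ∈ antidiagonal n, Φ (F ij.1) ∘ₗ divPow (thetaOf h d) ij.2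

theorem seriesOp_apply (F : ℕ → S) (n : ℕ) (y : A ⊗[ℝ] A) :
    seriesOp h d Φ F n y = ∑ ij ∈ antidiagonal n, Φ (F ij.1) (divPow (thetaOf h d) ij.2 y) := by
  rw [seriesOp, LinearMap.sum_apply]
  rfl

theorem rTensor_seriesOp (F : ℕ → S) (n : ℕ) (y : A ⊗[ℝ] (A ⊗[ℝ] A)) :
    LinearMap.rTensor A (seriesOp h d Φ F n) ((TensorProduct.assoc ℝ A A A).symm y)
      = ∑ ij ∈ antidiagonal n, onLeft Φ (F ij.1) (divPow (thetaLeg h d 0 1) ij.2 y) := by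
  have e : LinearMap.rTensor A (seriesOp h d Φ F n)
      = ∑ ij ∈ antidiagonal n, LinearMap.rTensor A (Φ (F ij.1)) ∘ₗ
        LinearMap.rTensor A (divPow (thetaOf h d) ij.2) := by
    rw [seriesOp]
    simp only [← LinearMap.rTensor_comp]
    exact map_sum (LinearMap.rTensorHom A) _ _
  rw [e, LinearMap.sum_apply]
  refine Finset.sum_congr rfl fun ij _ => ?_
  have h1 : LinearMap.rTensor A (divPow (thetaOf h d) ij.2)
      = divPow (LinearMap.rTensor A (thetaOf h d)) ij.2 := by
    rw [divPow, LinearMap.rTensor_smul, ← LinearMap.rTensor_pow, divPow]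
  rw [onLeft_apply, LinearMap.comp_apply, h1]
  congr 1
  exact (divPow_intertwine (m := (TensorProduct.assoc ℝ A A A).symm.toLinearMap)
    (assoc_symm_thetaLeg h d) ij.2 y).symm

theorem lTensor_seriesOp (F : ℕ → S) (n : ℕ) (y : A ⊗[ℝ] (A ⊗[ℝ] A)) :
    LinearMap.lTensor A (seriesOp h d Φ F n) y
      = ∑ ij ∈ antidiagonal n, onRight Φ (F ij.1) (divPow (thetaLeg h d 1 2) ij.2 y) := by
  have e : LinearMap.lTensor A (seriesOp h d Φ F n)
      = ∑ ij ∈ antidiagonal n, LinearMap.lTensor A (Φ (F ij.1)) ∘ₗ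
        LinearMap.lTensor A (divPow (thetaOf h d) ij.2) := by
    rw [seriesOp]
    simp only [← LinearMap.lTensor_comp]
    exact map_sum (LinearMap.lTensorHom A) _ _
  rw [e, LinearMap.sum_apply]
  refine Finset.sum_congr rfl fun ij _ => ?_
  have h1 : LinearMap.lTensor A (divPow (thetaOf h d) ij.2)
      = divPow (LinearMap.lTensor A (thetaOf h d)) ij.2 := by
    rw [divPow, LinearMap.lTensor_smul, ← LinearMap.lTensor_pow, divPow]
  rw [onRight_apply, LinearMap.comp_apply, h1, thetaLeg_one_two]

/-- The outer exponential contributes `θ₁₃ + θ₂₃`, the inner one `θ₁₂`. The total exponent is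
symmetric in the bracketing, the same as in `seriesOp_lTensor`, so only the coefficients have to be
compared. -/
theorem IsDynamicalAction.seriesOp_rTensor (H : IsDynamicalAction h d δ Φ) (F : ℕ → S) (n : ℕ)
    (y : A ⊗[ℝ] (A ⊗[ℝ] A)) :
    ∑ uv ∈ antidiagonal n, seriesOp h d Φ F uv.1
      (LinearMap.rTensor A (seriesOp h d Φ F uv.2) ((TensorProduct.assoc ℝ A A A).symm y))
    = ∑ qt ∈ antidiagonal n, ∑ az ∈ antidiagonal qt.1, ∑ km ∈ antidiagonal az.2,
      ((km.1.factorial : ℝ)⁻¹ * (-(1 / 2)) ^ km.1) • ∑ I : Fin km.1 → Fin l,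
        Φ (F az.1) (onLeft Φ ((List.ofFn fun j => δ (I j)).prod (F km.2))
          ((List.ofFn fun j => leg 2 (h (I j))).prod
            (divPow (thetaLeg h d 0 1 + thetaLeg h d 0 2 + thetaLeg h d 1 2) qt.2 y))) := by
  have key := comp_divPow_shift δ (onLeft Φ) (thetaOf h d) (fun i => leg 2 (h i))
    (thetaLeg h d 0 2 + thetaLeg h d 1 2) (thetaLeg h d 0 1) (-(1 / 2))
    (fun i => (H.leg_h_commute_thetaLeg _ _ _ _).add_right (H.leg_h_commute_thetaLeg _ _ _ _))
    ((H.thetaLeg_commute_thetaLeg _ _ _ _).add_left (H.thetaLeg_commute_thetaLeg _ _ _ _))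
    H.theta_onLeft (fun a => Φ (F a)) F n y
  rw [show thetaLeg h d 0 2 + thetaLeg h d 1 2 + thetaLeg h d 0 1
    = thetaLeg h d 0 1 + thetaLeg h d 0 2 + thetaLeg h d 1 2 by abel] at key
  rw [← key]
  refine Finset.sum_congr rfl fun uv _ => ?_
  rw [rTensor_seriesOp, seriesOp_apply]

theorem IsDynamicalAction.seriesOp_lTensor (H : IsDynamicalAction h d δ Φ) (F : ℕ → S) (n : ℕ)
    (y : A ⊗[ℝ] (A ⊗[ℝ] A)) :
    ∑ uv ∈ antidiagonal n, seriesOp h d Φ F uv.1 (LinearMap.lTensor A (seriesOp h d Φ F uv.2) y)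
    = ∑ qt ∈ antidiagonal n, ∑ az ∈ antidiagonal qt.1, ∑ km ∈ antidiagonal az.2,
      ((km.1.factorial : ℝ)⁻¹ * (1 / 2) ^ km.1) • ∑ I : Fin km.1 → Fin l,
        Φ (F az.1) (onRight Φ ((List.ofFn fun j => δ (I j)).prod (F km.2))
          ((List.ofFn fun j => leg 0 (h (I j))).prod
            (divPow (thetaLeg h d 0 1 + thetaLeg h d 0 2 + thetaLeg h d 1 2) qt.2 y))) := by
  have key := comp_divPow_shift δ (onRight Φ) (thetaOf h d) (fun i => leg 0 (h i))
    (thetaLeg h d 0 1 + thetaLeg h d 0 2) (thetaLeg h d 1 2) (1 / 2)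
    (fun i => (H.leg_h_commute_thetaLeg _ _ _ _).add_right (H.leg_h_commute_thetaLeg _ _ _ _))
    ((H.thetaLeg_commute_thetaLeg _ _ _ _).add_left (H.thetaLeg_commute_thetaLeg _ _ _ _))
    H.theta_onRight (fun a => Φ (F a)) F n y
  rw [← key]
  refine Finset.sum_congr rfl fun uv _ => ?_
  rw [lTensor_seriesOp, seriesOp_apply]

end DynamicalAction

end DynQuant
end

noncomputable section

namespace DynQuant

/-! ### Products of operators and multiplication -/

section ThreeFunctions

variable {E P G : Type*} [NormedAddCommGroup E] [NormedSpace ℝ E] [FiniteDimensional ℝ E]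
  [NormedAddCommGroup P] [NormedSpace ℝ P]
  [TopologicalSpace G] [ChartedSpace E G] [Group G] [LieGroup 𝓘(ℝ, E) ∞ G]

theorem mul₃_leftInvOp₃_assoc (s : UEA₂ (GroupLieAlgebra 𝓘(ℝ, E) G))
    (w : UEA (GroupLieAlgebra 𝓘(ℝ, E) G)) (f g k : Fn E P G) :
    mul₃ E P G (leftInvOp₃ E P G (Algebra.TensorProduct.assoc ℝ ℝ ℝ
      (UEA (GroupLieAlgebra 𝓘(ℝ, E) G)) (UEA (GroupLieAlgebra 𝓘(ℝ, E) G))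
      (UEA (GroupLieAlgebra 𝓘(ℝ, E) G)) (s ⊗ₜ[ℝ] w)) (f ⊗ₜ (g ⊗ₜ k)))
      = LinearMap.mul' ℝ (Fn E P G) (leftInvOp₂ E P G s (f ⊗ₜ g)) * leftInvOp E P G w k := by
  induction s using TensorProduct.induction_on with
  | zero => simp only [TensorProduct.zero_tmul, map_zero, LinearMap.zero_apply, zero_mul]
  | tmul u v =>
    rw [Algebra.TensorProduct.assoc_tmul, leftInvOp₃_tmul, leftInvOp₂_tmul, leftInvOp₂_tmul,
      TensorProduct.map_tmul, TensorProduct.map_tmul, TensorProduct.map_tmul, mul₃_tmul,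
      LinearMap.mul'_apply, mul_assoc]
  | add s t hs ht => simp only [TensorProduct.add_tmul, map_add, LinearMap.add_apply, hs, ht,
      add_mul]

theorem mul₃_leftInvOp₃_tmul (u : UEA (GroupLieAlgebra 𝓘(ℝ, E) G))
    (s : UEA₂ (GroupLieAlgebra 𝓘(ℝ, E) G)) (f g k : Fn E P G) :
    mul₃ E P G (leftInvOp₃ E P G (u ⊗ₜ[ℝ] s) (f ⊗ₜ (g ⊗ₜ k)))
      = leftInvOp E P G u f * LinearMap.mul' ℝ (Fn E P G) (leftInvOp₂ E P G s (g ⊗ₜ k)) := rfl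

variable {K : Submodule ℝ (UEA₂ (GroupLieAlgebra 𝓘(ℝ, E) G))}

/-- The first leg `u` of `v` acts on `F⃗(λ)(f, g)` through `Δu · F(λ)`, the second leg acts on the
third function; nesting of operators thus becomes a product in `U𝔤 ⊗ U𝔤 ⊗ U𝔤`. -/
theorem mul'_leftInvOp₂_onLeft (v : UEA₂ (GroupLieAlgebra 𝓘(ℝ, E) G)) (F : smoothMaps P K)
    (y : Fn E P G ⊗[ℝ] (Fn E P G ⊗[ℝ] Fn E P G)) (p : P × G) :
    LinearMap.mul' ℝ (Fn E P G) (leftInvOp₂ E P G v (onLeft coeffOp F y)) p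
      = mul₃ E P G (leftInvOp₃ E P G (comulLeft v * leg12 (F.1 p.1)) y) p := by
  rw [← evalAt_apply, ← evalAt_apply]
  induction v using TensorProduct.induction_on with
  | zero => simp only [map_zero, LinearMap.zero_apply, zero_mul]
  | add s t hs ht => simp only [map_add, LinearMap.add_apply, hs, ht, add_mul]
  | tmul u w =>
    have e : comulLeft (u ⊗ₜ[ℝ] w) * leg12 (F.1 p.1) = Algebra.TensorProduct.assoc ℝ ℝ ℝ
      (UEA (GroupLieAlgebra 𝓘(ℝ, E) G)) (UEA (GroupLieAlgebra 𝓘(ℝ, E) G))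
      (UEA (GroupLieAlgebra 𝓘(ℝ, E) G)) ((comul u * F.1 p.1) ⊗ₜ[ℝ] w) := by
      have : ((comul u * F.1 p.1) ⊗ₜ[ℝ] w : UEA₂ (GroupLieAlgebra 𝓘(ℝ, E) G) ⊗[ℝ]
          UEA (GroupLieAlgebra 𝓘(ℝ, E) G)) = (comul u ⊗ₜ[ℝ] w) * (F.1 p.1 ⊗ₜ[ℝ] 1) := by
        rw [Algebra.TensorProduct.tmul_mul_tmul, mul_one]
      rw [this, map_mul]
      rfl
    rw [e]
    induction y using TensorProduct.induction_on with
    | zero => simp only [LinearMap.map_zero, map_zero (evalAt p)]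
    | add y z hy hz => simp only [LinearMap.map_add, map_add (evalAt p), hy, hz]
    | tmul f z =>
      induction z using TensorProduct.induction_on with
      | zero => simp only [TensorProduct.tmul_zero, LinearMap.map_zero, map_zero (evalAt p)]
      | add y z hy hz =>
        simp only [TensorProduct.tmul_add, LinearMap.map_add, map_add (evalAt p), hy, hz]
      | tmul g k =>
        rw [mul₃_leftInvOp₃_assoc, onLeft_tmul, leftInvOp₂_tmul, TensorProduct.map_tmul,
          LinearMap.mul'_apply, map_mul, map_mul, evalAt_apply, leftInvOp_coeffOp]
        rfl

theorem mul'_leftInvOp₂_onRight (v : UEA₂ (GroupLieAlgebra 𝓘(ℝ, E) G)) (F : smoothMaps P K)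
    (y : Fn E P G ⊗[ℝ] (Fn E P G ⊗[ℝ] Fn E P G)) (p : P × G) :
    LinearMap.mul' ℝ (Fn E P G) (leftInvOp₂ E P G v (onRight coeffOp F y)) p
      = mul₃ E P G (leftInvOp₃ E P G (comulRight v * leg23 (F.1 p.1)) y) p := by
  rw [← evalAt_apply, ← evalAt_apply]
  induction v using TensorProduct.induction_on with
  | zero => simp only [map_zero, LinearMap.zero_apply, zero_mul]
  | add s t hs ht => simp only [map_add, LinearMap.add_apply, hs, ht, add_mul]
  | tmul u w =>
    have e : comulRight (u ⊗ₜ[ℝ] w) * leg23 (F.1 p.1) = u ⊗ₜ[ℝ] (comul w * F.1 p.1) := by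
      have : (u ⊗ₜ[ℝ] (comul w * F.1 p.1) : UEA₃ (GroupLieAlgebra 𝓘(ℝ, E) G))
          = (u ⊗ₜ[ℝ] comul w) * (1 ⊗ₜ[ℝ] F.1 p.1) := by
        rw [Algebra.TensorProduct.tmul_mul_tmul, mul_one]
      rw [this]
      rfl
    rw [e]
    induction y using TensorProduct.induction_on with
    | zero => simp only [LinearMap.map_zero, map_zero (evalAt p)]
    | add y z hy hz => simp only [LinearMap.map_add, map_add (evalAt p), hy, hz]
    | tmul f z =>
      induction z using TensorProduct.induction_on with
      | zero => simp only [TensorProduct.tmul_zero, LinearMap.map_zero, map_zero (evalAt p)]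
      | add y z hy hz =>
        simp only [TensorProduct.tmul_add, LinearMap.map_add, map_add (evalAt p), hy, hz]
      | tmul g k =>
        rw [mul₃_leftInvOp₃_tmul, onRight_tmul, leftInvOp₂_tmul, TensorProduct.map_tmul,
          LinearMap.mul'_apply, map_mul, map_mul, evalAt_apply _ (leftInvOp E P G w _),
          leftInvOp_coeffOp]
        rfl

theorem leftInvOp₃_leg1 (u : UEA (GroupLieAlgebra 𝓘(ℝ, E) G)) :
    leftInvOp₃ E P G (leg1 u) = leg 0 (leftInvOp E P G u) := by
  refine tensor₃_ext fun f g k => ?_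
  rw [leg1, leftInvOp₃_tmul, map_one, leg_zero_tmul]
  rfl

theorem leftInvOp₃_leg3 (u : UEA (GroupLieAlgebra 𝓘(ℝ, E) G)) :
    leftInvOp₃ E P G (leg3 u) = leg 2 (leftInvOp E P G u) := by
  refine tensor₃_ext fun f g k => ?_
  rw [leg3, leftInvOp₃_tmul, leftInvOp₂_tmul, map_one, leg_two_tmul]
  rfl

/-- The value at a point of a tridifferential operator, as a function of its symbol. -/
def eval₃ (y : Fn E P G ⊗[ℝ] (Fn E P G ⊗[ℝ] Fn E P G)) (p : P × G) :
    UEA₃ (GroupLieAlgebra 𝓘(ℝ, E) G) →ₗ[ℝ] ℝ :=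
  (evalAt p).toLinearMap ∘ₗ mul₃ E P G ∘ₗ LinearMap.applyₗ y ∘ₗ (leftInvOp₃ E P G).toLinearMap

theorem eval₃_apply (y : Fn E P G ⊗[ℝ] (Fn E P G ⊗[ℝ] Fn E P G)) (p : P × G)
    (u : UEA₃ (GroupLieAlgebra 𝓘(ℝ, E) G)) :
    eval₃ y p u = mul₃ E P G (leftInvOp₃ E P G u y) p := rfl

theorem eval₃_mul (y : Fn E P G ⊗[ℝ] (Fn E P G ⊗[ℝ] Fn E P G)) (p : P × G)
    (u v : UEA₃ (GroupLieAlgebra 𝓘(ℝ, E) G)) :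
    eval₃ y p (u * v) = eval₃ (leftInvOp₃ E P G v y) p u := by
  rw [eval₃_apply, eval₃_apply, map_mul, Module.End.mul_apply]

end ThreeFunctions

/-! ### The product defined by a coefficient function -/

section Star

variable {E P G : Type*} [NormedAddCommGroup E] [NormedSpace ℝ E] [FiniteDimensional ℝ E]
  [NormedAddCommGroup P] [NormedSpace ℝ P]
  [TopologicalSpace G] [ChartedSpace E G] [Group G] [LieGroup 𝓘(ℝ, E) ∞ G]
  {𝔥 : LieSubalgebra ℝ (GroupLieAlgebra 𝓘(ℝ, E) G)} {l : ℕ} (b : Module.Basis (Fin l) ℝ 𝔥)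
  (ξ : Fin l → P)

variable (P) in
/-- `h⃗ᵢ`. -/
def hOp (i : Fin l) : Module.End ℝ (Fn E P G) :=
  leftInvField (b i : GroupLieAlgebra 𝓘(ℝ, E) G)

variable (E G) in
/-- `∂/∂λⁱ`. -/
def dOp (i : Fin l) : Module.End ℝ (Fn E P G) := partialP (ξ i)

omit [FiniteDimensional ℝ E] in
theorem leftInvField_zero :
    (leftInvField (0 : GroupLieAlgebra 𝓘(ℝ, E) G) : Module.End ℝ (Fn E P G)) = 0 := by
  have := leftInvField_smul (E := E) (P := P) 0 (0 : GroupLieAlgebra 𝓘(ℝ, E) G)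
  rwa [zero_smul, zero_smul] at this

theorem leftInvField_commute [IsLieAbelian 𝔥] (X Y : 𝔥) :
    Commute (leftInvField (X : GroupLieAlgebra 𝓘(ℝ, E) G) : Module.End ℝ (Fn E P G))
      (leftInvField (Y : GroupLieAlgebra 𝓘(ℝ, E) G)) := by
  have h : ⁅(X : GroupLieAlgebra 𝓘(ℝ, E) G), (Y : GroupLieAlgebra 𝓘(ℝ, E) G)⁆ = 0 := by
    rw [← LieSubalgebra.coe_bracket, trivial_lie_zero]
    rfl
  have := leftInvField_lie (E := E) (P := P) (X : GroupLieAlgebra 𝓘(ℝ, E) G)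
    (Y : GroupLieAlgebra 𝓘(ℝ, E) G)
  rw [h, leftInvField_zero] at this
  exact sub_eq_zero.1 this.symm

/-- This is where the two assumptions behind the shift formula enter: `𝔥` is abelian, so that the
`h⃗ᵢ` commute, and the coefficients have zero weight, so that the `h⃗ᵢ` pass through them. -/
theorem isDynamicalAction [IsLieAbelian 𝔥] :
    IsDynamicalAction (hOp P b) (dOp E G ξ) (fun i => smoothDeriv (ξ i))
      (coeffOp (K := zeroWeight 𝔥)) where
  commute_h_h _ _ := leftInvField_commute _ _
  commute_h_d _ _ := leftInvField_commute_partialP _ _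
  commute_d_d _ _ := partialP_commute _ _
  h_apply i F f g := by
    rw [← map_add]
    exact leftInvField_coeffOp F (b i).2 (f ⊗ₜ g)
  d_apply i F f g := by
    rw [← map_add]
    exact partialP_coeffOp (ξ i) F (f ⊗ₜ g)

theorem leftInvOp₃_leg3_hMonomial {k : ℕ} (I : Fin k → Fin l) :
    leftInvOp₃ E P G (leg3 (hMonomial b I))
      = (List.ofFn fun j => leg 2 (hOp P b (I j))).prod := by
  rw [leftInvOp₃_leg3, hMonomial, map_list_prod, map_list_prod, List.map_map, List.map_ofFn]
  refine congrArg List.prod (congrArg List.ofFn (funext fun j => ?_))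
  exact congrArg (leg 2) (leftInvOp_incl _)

theorem leg1_commute_leg23 {𝔤 : Type*} [LieRing 𝔤] [LieAlgebra ℝ 𝔤] (u : UEA 𝔤) (v : UEA₂ 𝔤) :
    Commute (leg1 u) (leg23 v) := by
  have e : leg23 v = (1 : UEA 𝔤) ⊗ₜ[ℝ] v := rfl
  rw [commute_iff_eq, leg1, e, Algebra.TensorProduct.tmul_mul_tmul,
    Algebra.TensorProduct.tmul_mul_tmul, one_mul, one_mul, mul_one, mul_one]

theorem leftInvOp₃_leg1_hMonomial {k : ℕ} (I : Fin k → Fin l) :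
    leftInvOp₃ E P G (leg1 (hMonomial b I))
      = (List.ofFn fun j => leg 0 (hOp P b (I j))).prod := by
  rw [leftInvOp₃_leg1, hMonomial, map_list_prod, map_list_prod, List.map_map, List.map_ofFn]
  refine congrArg List.prod (congrArg List.ofFn (funext fun j => ?_))
  exact congrArg (leg 0) (leftInvOp_incl _)

/-- Iterated partial derivatives. -/
def iterDeriv {V : Type*} [AddCommGroup V] [Module ℝ V] {k : ℕ} (i : Fin k → Fin l) (F : P → V) :
    P → V :=
  (List.ofFn i).foldr (fun j F' => partialDeriv (ξ j) F') F

theorem coe_prod_smoothDeriv {k : ℕ} (I : Fin k → Fin l)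
    (F : smoothMaps P (zeroWeight 𝔥)) :
    ((List.ofFn fun j => smoothDeriv (ξ (I j))).prod F :
      P → UEA₂ (GroupLieAlgebra 𝓘(ℝ, E) G)) = iterDeriv ξ I F := by
  have : (List.ofFn fun j => (smoothDeriv (ξ (I j)) :
      Module.End ℝ (smoothMaps P (zeroWeight 𝔥))))
      = (List.ofFn I).map fun j => smoothDeriv (ξ j) := by
    rw [List.map_ofFn]
    rfl
  rw [this, iterDeriv]
  induction List.ofFn I with
  | nil => rfl
  | cons j L ih =>
    rw [List.map_cons, List.prod_cons, Module.End.mul_apply, smoothDeriv_coe, ih]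
    rfl

/-- The coefficient of `ħⁿ` in `F⃗(λ) Θ`. -/
def starOp (F : ℕ → smoothMaps P (zeroWeight 𝔥)) (n : ℕ) :
    Fn E P G ⊗[ℝ] Fn E P G →ₗ[ℝ] Fn E P G :=
  seriesOp (hOp P b) (dOp E G ξ) coeffOp F n

/-- `½ ∑ᵢ hᵢ ∧ ∂/∂λⁱ` acting on three functions. -/
def theta₃ : Module.End ℝ (Fn E P G ⊗[ℝ]
    (Fn E P G ⊗[ℝ] Fn E P G)) :=
  thetaLeg (hOp P b) (dOp E G ξ) 0 1 + thetaLeg (hOp P b) (dOp E G ξ) 0 2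
    + thetaLeg (hOp P b) (dOp E G ξ) 1 2

/-- `F¹²(λ - ½ ħ h⁽³⁾)`. -/
def taylor12 (F : P → PowerSeries (UEA₂ (GroupLieAlgebra 𝓘(ℝ, E) G))) (p : P) :
    PowerSeries (UEA₃ (GroupLieAlgebra 𝓘(ℝ, E) G)) :=
  PowerSeries.mk fun n => ∑ km ∈ Finset.HasAntidiagonal.antidiagonal n,
    (((km.1.factorial : ℝ))⁻¹ * (-(1 / 2 : ℝ)) ^ km.1) •
      ∑ i : Fin km.1 → Fin l,
        leg12 (iterDeriv ξ i (fun q => PowerSeries.coeff km.2 (F q)) p) * leg3 (hMonomial b i)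

/-- `F²³(λ + ½ ħ h⁽¹⁾)`. -/
def taylor23 (F : P → PowerSeries (UEA₂ (GroupLieAlgebra 𝓘(ℝ, E) G))) (p : P) :
    PowerSeries (UEA₃ (GroupLieAlgebra 𝓘(ℝ, E) G)) :=
  PowerSeries.mk fun n => ∑ km ∈ Finset.HasAntidiagonal.antidiagonal n,
    (((km.1.factorial : ℝ))⁻¹ * (1 / 2 : ℝ) ^ km.1) •
      ∑ i : Fin km.1 → Fin l,
        leg1 (hMonomial b i) * leg23 (iterDeriv ξ i (fun q => PowerSeries.coeff km.2 (F q)) p)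

variable [IsLieAbelian 𝔥] {F : P → PowerSeries (UEA₂ (GroupLieAlgebra 𝓘(ℝ, E) G))}
  {Fs : ℕ → smoothMaps P (zeroWeight 𝔥)}

omit [IsLieAbelian 𝔥] in
theorem coeffOp_onLeft_prod {k : ℕ} (I : Fin k → Fin l) (F F' : smoothMaps P (zeroWeight 𝔥))
    (y : Fn E P G ⊗[ℝ] (Fn E P G ⊗[ℝ] Fn E P G)) (p : P × G) :
    evalAt p (coeffOp F (onLeft coeffOp ((List.ofFn fun j => smoothDeriv (ξ (I j))).prod F')
      ((List.ofFn fun j => leg 2 (hOp P b (I j))).prod y)))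
    = eval₃ y p (comulLeft (F.1 p.1) * (leg12 (iterDeriv ξ I F'.1 p.1) * leg3 (hMonomial b I))) := by
  rw [← mul_assoc, eval₃_mul, leftInvOp₃_leg3_hMonomial, eval₃_apply, evalAt_apply,
    coeffOp_apply, mul'_leftInvOp₂_onLeft, coe_prod_smoothDeriv]

omit [IsLieAbelian 𝔥] in
theorem coeffOp_onRight_prod {k : ℕ} (I : Fin k → Fin l) (F F' : smoothMaps P (zeroWeight 𝔥))
    (y : Fn E P G ⊗[ℝ] (Fn E P G ⊗[ℝ] Fn E P G)) (p : P × G) :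
    evalAt p (coeffOp F (onRight coeffOp ((List.ofFn fun j => smoothDeriv (ξ (I j))).prod F')
      ((List.ofFn fun j => leg 0 (hOp P b (I j))).prod y)))
    = eval₃ y p (comulRight (F.1 p.1) *
        (leg1 (hMonomial b I) * leg23 (iterDeriv ξ I F'.1 p.1))) := by
  -- The monomial in the `hᵢ` stands on the left in the shifted series; it commutes with the other
  -- legs and can therefore be made to act first on the functions.
  rw [(leg1_commute_leg23 _ _).eq, ← mul_assoc, eval₃_mul, leftInvOp₃_leg1_hMonomial,
    eval₃_apply, evalAt_apply, coeffOp_apply, mul'_leftInvOp₂_onRight, coe_prod_smoothDeriv]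

/-- The iterated product `(f * g) * k` is an operator whose coefficient is the left-hand side of the
shifted cocycle equation, preceded by `exp(ħ(θ₁₂ + θ₁₃ + θ₂₃))`. -/
theorem starOp_rTensor
    (hF : ∀ n, (Fs n).1 = fun p => PowerSeries.coeff n (F p)) (n : ℕ)
    (y : Fn E P G ⊗[ℝ] (Fn E P G ⊗[ℝ] Fn E P G))
    (p : P × G) :
    (∑ uv ∈ Finset.HasAntidiagonal.antidiagonal n,
      starOp b ξ Fs uv.1 (LinearMap.rTensor (Fn E P G) (starOp b ξ Fs uv.2)
        ((TensorProduct.assoc ℝ (Fn E P G) (Fn E P G)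
          (Fn E P G)).symm y))) p
    = ∑ qt ∈ Finset.HasAntidiagonal.antidiagonal n,
      eval₃ (divPow (theta₃ b ξ) qt.2 y) p (PowerSeries.coeff qt.1
        (PowerSeries.map (comulLeft (𝔤 := GroupLieAlgebra 𝓘(ℝ, E) G)).toRingHom (F p.1)
          * taylor12 b ξ F p.1)) := by
  have key := (isDynamicalAction b ξ).seriesOp_rTensor Fs n y
  refine (DFunLike.congr_fun key p).trans ?_
  rw [← evalAt_apply, map_sum]
  refine Finset.sum_congr rfl fun qt _ => ?_
  rw [PowerSeries.coeff_mul, map_sum, map_sum]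
  refine Finset.sum_congr rfl fun az _ => ?_
  rw [taylor12, PowerSeries.coeff_mk, Finset.mul_sum, map_sum, map_sum]
  refine Finset.sum_congr rfl fun km _ => ?_
  rw [mul_smul_comm, map_smul, map_smul, Finset.mul_sum, map_sum, map_sum]
  congr 1
  refine Finset.sum_congr rfl fun I _ => ?_
  rw [coeffOp_onLeft_prod, hF, hF, PowerSeries.coeff_map]
  rfl

theorem starOp_lTensor
    (hF : ∀ n, (Fs n).1 = fun p => PowerSeries.coeff n (F p)) (n : ℕ)
    (y : Fn E P G ⊗[ℝ] (Fn E P G ⊗[ℝ] Fn E P G))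
    (p : P × G) :
    (∑ uv ∈ Finset.HasAntidiagonal.antidiagonal n,
      starOp b ξ Fs uv.1 (LinearMap.lTensor (Fn E P G) (starOp b ξ Fs uv.2) y)) p
    = ∑ qt ∈ Finset.HasAntidiagonal.antidiagonal n,
      eval₃ (divPow (theta₃ b ξ) qt.2 y) p (PowerSeries.coeff qt.1
        (PowerSeries.map (comulRight (𝔤 := GroupLieAlgebra 𝓘(ℝ, E) G)).toRingHom (F p.1)
          * taylor23 b ξ F p.1)) := by
  have key := (isDynamicalAction b ξ).seriesOp_lTensor Fs n y
  refine (DFunLike.congr_fun key p).trans ?_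
  rw [← evalAt_apply, map_sum]
  refine Finset.sum_congr rfl fun qt _ => ?_
  rw [PowerSeries.coeff_mul, map_sum, map_sum]
  refine Finset.sum_congr rfl fun az _ => ?_
  rw [taylor23, PowerSeries.coeff_mk, Finset.mul_sum, map_sum, map_sum]
  refine Finset.sum_congr rfl fun km _ => ?_
  rw [mul_smul_comm, map_smul, map_smul, Finset.mul_sum, map_sum, map_sum]
  congr 1
  refine Finset.sum_congr rfl fun I _ => ?_
  rw [coeffOp_onRight_prod, hF, hF, PowerSeries.coeff_map]
  rfl

end Star

end DynQuant
end

noncomputable section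

namespace DynQuant

/-! ### Tensors with one factor in a given set -/

section Stable

variable {A : Type*} [AddCommGroup A] [Module ℝ A] {R : Set A}

theorem divPow_mem {V : Type*} [AddCommGroup V] [Module ℝ V] {X : Module.End ℝ V}
    {N : Submodule ℝ V} (h : ∀ v ∈ N, X v ∈ N) (k : ℕ) {v : V} (hv : v ∈ N) : divPow X k v ∈ N := by
  have key : (X ^ k) v ∈ N := by
    induction k with
    | zero => simpa using hv
    | succ k ih => rw [pow_succ', Module.End.mul_apply]; exact h _ ih
  rw [divPow, LinearMap.smul_apply]
  exact N.smul_mem _ key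

theorem divPow_apply_of_eq_zero {V : Type*} [AddCommGroup V] [Module ℝ V] {X : Module.End ℝ V}
    {v : V} (h : X v = 0) (k : ℕ) : divPow X k v = if k = 0 then v else 0 := by
  cases k with
  | zero => simp
  | succ k => simp [divPow, pow_succ, h]

/-- The tensors `∑ f ⊗ g` with `f ∈ R`. -/
def leftSub (R : Set A) : Submodule ℝ (A ⊗[ℝ] A) := Submodule.span ℝ {y | ∃ f ∈ R, ∃ g, y = f ⊗ₜ g}

/-- The tensors `∑ f ⊗ g` with `g ∈ R`. -/
def rightSub (R : Set A) : Submodule ℝ (A ⊗[ℝ] A) := Submodule.span ℝ {y | ∃ f, ∃ g ∈ R, y = f ⊗ₜ g}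

theorem tmul_mem_leftSub {f : A} (hf : f ∈ R) (g : A) : f ⊗ₜ g ∈ leftSub R :=
  Submodule.subset_span ⟨f, hf, g, rfl⟩

theorem tmul_mem_rightSub (f : A) {g : A} (hg : g ∈ R) : f ⊗ₜ g ∈ rightSub R :=
  Submodule.subset_span ⟨f, g, hg, rfl⟩

theorem map_mem_leftSub {D D' : Module.End ℝ A} (hD : ∀ f ∈ R, D f ∈ R) {y : A ⊗[ℝ] A}
    (hy : y ∈ leftSub R) : TensorProduct.map D D' y ∈ leftSub R := by
  induction hy using Submodule.span_induction with
  | mem y hy =>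
    obtain ⟨f, hf, g, rfl⟩ := hy
    exact Submodule.subset_span ⟨D f, hD f hf, D' g, rfl⟩
  | zero => rw [map_zero]; exact zero_mem _
  | add y z _ _ hy hz => rw [map_add]; exact add_mem hy hz
  | smul c y _ hy => rw [map_smul]; exact Submodule.smul_mem _ c hy

theorem map_mem_rightSub {D D' : Module.End ℝ A} (hD : ∀ f ∈ R, D' f ∈ R) {y : A ⊗[ℝ] A}
    (hy : y ∈ rightSub R) : TensorProduct.map D D' y ∈ rightSub R := by
  induction hy using Submodule.span_induction with
  | mem y hy =>
    obtain ⟨f, g, hg, rfl⟩ := hy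
    exact Submodule.subset_span ⟨D f, D' g, hD g hg, rfl⟩
  | zero => rw [map_zero]; exact zero_mem _
  | add y z _ _ hy hz => rw [map_add]; exact add_mem hy hz
  | smul c y _ hy => rw [map_smul]; exact Submodule.smul_mem _ c hy

/-- The tensors `∑ f ⊗ g ⊗ k` whose factor with index `j` is in `R`. -/
def legSub (R : Set A) (j : Fin 3) : Submodule ℝ (A ⊗[ℝ] (A ⊗[ℝ] A)) :=
  Submodule.span ℝ {y | ∃ f : Fin 3 → A, f j ∈ R ∧ y = f 0 ⊗ₜ (f 1 ⊗ₜ f 2)}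

theorem tmul_mem_legSub {f g k : A} {j : Fin 3} (h : ![f, g, k] j ∈ R) :
    f ⊗ₜ (g ⊗ₜ k) ∈ legSub R j := Submodule.subset_span ⟨![f, g, k], h, rfl⟩

theorem leg_mem_legSub {D : Module.End ℝ A} (hD : ∀ f ∈ R, D f ∈ R) (a : Fin 3) {j : Fin 3}
    {y : A ⊗[ℝ] (A ⊗[ℝ] A)} (hy : y ∈ legSub R j) : leg a D y ∈ legSub R j := by
  induction hy using Submodule.span_induction with
  | mem y hy =>
    obtain ⟨f, hf, rfl⟩ := hy
    refine Submodule.subset_span ⟨Function.update f a (D (f a)), ?_, ?_⟩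
    · by_cases h : j = a
      · subst h
        rw [Function.update_self]
        exact hD _ hf
      · rwa [Function.update_of_ne h]
    · fin_cases a <;> rfl
  | zero => rw [map_zero]; exact zero_mem _
  | add y z _ _ hy hz => rw [map_add]; exact add_mem hy hz
  | smul c y _ hy => rw [map_smul]; exact Submodule.smul_mem _ c hy

variable {l : ℕ} {h d : Fin l → Module.End ℝ A}

theorem thetaOf_mem_leftSub (hh : ∀ i, ∀ f ∈ R, h i f ∈ R) (hd : ∀ i, ∀ f ∈ R, d i f ∈ R)
    {y : A ⊗[ℝ] A} (hy : y ∈ leftSub R) : thetaOf h d y ∈ leftSub R := by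
  rw [thetaOf, LinearMap.smul_apply, LinearMap.sum_apply]
  exact Submodule.smul_mem _ _ (sum_mem fun i _ =>
    sub_mem (map_mem_leftSub (hh i) hy) (map_mem_leftSub (hd i) hy))

theorem thetaOf_mem_rightSub (hh : ∀ i, ∀ f ∈ R, h i f ∈ R) (hd : ∀ i, ∀ f ∈ R, d i f ∈ R)
    {y : A ⊗[ℝ] A} (hy : y ∈ rightSub R) : thetaOf h d y ∈ rightSub R := by
  rw [thetaOf, LinearMap.smul_apply, LinearMap.sum_apply]
  exact Submodule.smul_mem _ _ (sum_mem fun i _ =>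
    sub_mem (map_mem_rightSub (hd i) hy) (map_mem_rightSub (hh i) hy))

theorem thetaLeg_mem_legSub (hh : ∀ i, ∀ f ∈ R, h i f ∈ R) (hd : ∀ i, ∀ f ∈ R, d i f ∈ R)
    (a c : Fin 3) {j : Fin 3} {y : A ⊗[ℝ] (A ⊗[ℝ] A)} (hy : y ∈ legSub R j) :
    thetaLeg h d a c y ∈ legSub R j := by
  rw [thetaLeg, LinearMap.smul_apply, LinearMap.sum_apply]
  exact Submodule.smul_mem _ _ (sum_mem fun i _ => sub_mem
    (leg_mem_legSub (hh i) a (leg_mem_legSub (hd i) c hy))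
    (leg_mem_legSub (hd i) a (leg_mem_legSub (hh i) c hy)))

end Stable

/-! ### Counits -/

section Counits

variable {𝔤 : Type*} [LieRing 𝔤] [LieAlgebra ℝ 𝔤]

/-- The counit applied to one of three factors. -/
def counitLeg : Fin 3 → UEA₃ 𝔤 →ₐ[ℝ] UEA₂ 𝔤 :=
  ![(Algebra.TensorProduct.lid ℝ (UEA₂ 𝔤)).toAlgHom.comp
      (Algebra.TensorProduct.map counit (AlgHom.id ℝ (UEA₂ 𝔤))),
    Algebra.TensorProduct.map (AlgHom.id ℝ (UEA 𝔤)) counitLeft,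
    Algebra.TensorProduct.map (AlgHom.id ℝ (UEA 𝔤)) counitRight]

theorem counitLeg_zero_tmul (u : UEA 𝔤) (v : UEA₂ 𝔤) :
    counitLeg 0 (u ⊗ₜ[ℝ] v) = counit u • v := rfl

theorem counitLeg_one_tmul (u : UEA 𝔤) (v : UEA₂ 𝔤) :
    counitLeg 1 (u ⊗ₜ[ℝ] v) = u ⊗ₜ counitLeft v := rfl

theorem counitLeg_two_tmul (u : UEA 𝔤) (v : UEA₂ 𝔤) :
    counitLeg 2 (u ⊗ₜ[ℝ] v) = u ⊗ₜ counitRight v := rfl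

theorem counitLeft_tmul (u v : UEA 𝔤) : counitLeft (u ⊗ₜ[ℝ] v) = counit u • v := rfl

theorem counitRight_tmul (u v : UEA 𝔤) : counitRight (u ⊗ₜ[ℝ] v) = counit v • u := rfl

theorem counitLeft_comul (u : UEA 𝔤) : counitLeft (comul u) = u := by
  induction u using UEA.induction with
  | algebraMap c => rw [AlgHom.commutes, AlgHom.commutes]
  | incl X => rw [comul_incl, map_add, counitLeft_tmul, counitLeft_tmul, counit_incl, map_one,
      zero_smul, one_smul, zero_add]
  | mul u v hu hv => rw [map_mul, map_mul, hu, hv]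
  | add u v hu hv => rw [map_add, map_add, hu, hv]

theorem counitRight_comul (u : UEA 𝔤) : counitRight (comul u) = u := by
  induction u using UEA.induction with
  | algebraMap c => rw [AlgHom.commutes, AlgHom.commutes]
  | incl X => rw [comul_incl, map_add, counitRight_tmul, counitRight_tmul, counit_incl, map_one,
      zero_smul, one_smul, add_zero]
  | mul u v hu hv => rw [map_mul, map_mul, hu, hv]
  | add u v hu hv => rw [map_add, map_add, hu, hv]

theorem algHom_tmul_ext {B : Type*} [Semiring B] [Algebra ℝ B] {φ ψ : UEA₂ 𝔤 →ₐ[ℝ] B}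
    (h : ∀ u w, φ (u ⊗ₜ w) = ψ (u ⊗ₜ w)) : φ = ψ := by
  refine AlgHom.ext fun v => ?_
  induction v using TensorProduct.induction_on with
  | zero => rw [map_zero, map_zero]
  | tmul u w => exact h u w
  | add v w hv hw => rw [map_add, map_add, hv, hw]

/-- `s ⊗ w`, for `s ∈ U𝔤 ⊗ U𝔤`, as an element of `U𝔤 ⊗ U𝔤 ⊗ U𝔤`. -/
def assocTmul (s : UEA₂ 𝔤) (w : UEA 𝔤) : UEA₃ 𝔤 :=
  Algebra.TensorProduct.assoc ℝ ℝ ℝ (UEA 𝔤) (UEA 𝔤) (UEA 𝔤) (s ⊗ₜ[ℝ] w)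

theorem assocTmul_tmul (u v w : UEA 𝔤) : assocTmul (u ⊗ₜ v) w = u ⊗ₜ (v ⊗ₜ w) := rfl

theorem assocTmul_add (s t : UEA₂ 𝔤) (w : UEA 𝔤) :
    assocTmul (s + t) w = assocTmul s w + assocTmul t w := by
  rw [assocTmul, TensorProduct.add_tmul, map_add]
  rfl

theorem assocTmul_zero (w : UEA 𝔤) : assocTmul (0 : UEA₂ 𝔤) w = 0 := by
  rw [assocTmul, TensorProduct.zero_tmul, map_zero]

theorem comulLeft_tmul (u w : UEA 𝔤) : comulLeft (u ⊗ₜ w) = assocTmul (comul u) w := rfl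

theorem comulRight_tmul (u w : UEA 𝔤) : comulRight (u ⊗ₜ w) = u ⊗ₜ[ℝ] comul w := rfl

theorem leg12_eq (s : UEA₂ 𝔤) : leg12 s = assocTmul s 1 := rfl

theorem leg23_eq (s : UEA₂ 𝔤) : leg23 s = (1 : UEA 𝔤) ⊗ₜ[ℝ] s := rfl

theorem counitLeg_zero_assocTmul (s : UEA₂ 𝔤) (w : UEA 𝔤) :
    counitLeg 0 (assocTmul s w) = counitLeft s ⊗ₜ w := by
  induction s using TensorProduct.induction_on with
  | zero => rw [assocTmul_zero, map_zero, map_zero, TensorProduct.zero_tmul]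
  | tmul u v => rw [assocTmul_tmul, counitLeg_zero_tmul, counitLeft_tmul, TensorProduct.smul_tmul']
  | add s t hs ht => rw [assocTmul_add, map_add, map_add, hs, ht, TensorProduct.add_tmul]

theorem counitLeg_one_assocTmul (s : UEA₂ 𝔤) (w : UEA 𝔤) :
    counitLeg 1 (assocTmul s w) = counitRight s ⊗ₜ w := by
  induction s using TensorProduct.induction_on with
  | zero => rw [assocTmul_zero, map_zero, map_zero, TensorProduct.zero_tmul]
  | tmul u v => rw [assocTmul_tmul, counitLeg_one_tmul, counitLeft_tmul, counitRight_tmul,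
      TensorProduct.tmul_smul, TensorProduct.smul_tmul']
  | add s t hs ht => rw [assocTmul_add, map_add, map_add, hs, ht, TensorProduct.add_tmul]

theorem counitLeg_two_assocTmul (s : UEA₂ 𝔤) (w : UEA 𝔤) :
    counitLeg 2 (assocTmul s w) = counit w • s := by
  induction s using TensorProduct.induction_on with
  | zero => rw [assocTmul_zero, map_zero, smul_zero]
  | tmul u v => rw [assocTmul_tmul, counitLeg_two_tmul, counitRight_tmul, TensorProduct.tmul_smul]
  | add s t hs ht => rw [assocTmul_add, map_add, hs, ht, smul_add]

theorem counitLeg_zero_comulLeft : (counitLeg 0).comp comulLeft = AlgHom.id ℝ (UEA₂ 𝔤) :=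
  algHom_tmul_ext fun u w => by
    rw [AlgHom.comp_apply, comulLeft_tmul, counitLeg_zero_assocTmul, counitLeft_comul]
    rfl

theorem counitLeg_one_comulLeft : (counitLeg 1).comp comulLeft = AlgHom.id ℝ (UEA₂ 𝔤) :=
  algHom_tmul_ext fun u w => by
    rw [AlgHom.comp_apply, comulLeft_tmul, counitLeg_one_assocTmul, counitRight_comul]
    rfl

/-- On a leg produced by `Δ` the counit undoes `Δ`; here it falls on the other leg and leaves `Δ` of
a counit, which is trivial for normalized series. -/
theorem counitLeg_two_comulLeft : (counitLeg 2).comp comulLeft = comul.comp (counitRight (𝔤 := 𝔤)) :=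
  algHom_tmul_ext fun u w => by
    rw [AlgHom.comp_apply, comulLeft_tmul, counitLeg_two_assocTmul, AlgHom.comp_apply,
      counitRight_tmul, map_smul]

theorem counitLeg_zero_comulRight :
    (counitLeg 0).comp comulRight = comul.comp (counitLeft (𝔤 := 𝔤)) :=
  algHom_tmul_ext fun u w => by
    rw [AlgHom.comp_apply, comulRight_tmul, counitLeg_zero_tmul, AlgHom.comp_apply,
      counitLeft_tmul, map_smul]

theorem counitLeg_one_comulRight : (counitLeg 1).comp comulRight = AlgHom.id ℝ (UEA₂ 𝔤) :=
  algHom_tmul_ext fun u w => by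
    rw [AlgHom.comp_apply, comulRight_tmul, counitLeg_one_tmul, counitLeft_comul]
    rfl

theorem counitLeg_two_comulRight : (counitLeg 2).comp comulRight = AlgHom.id ℝ (UEA₂ 𝔤) :=
  algHom_tmul_ext fun u w => by
    rw [AlgHom.comp_apply, comulRight_tmul, counitLeg_two_tmul, counitRight_comul]
    rfl

end Counits

end DynQuant
end

noncomputable section

namespace DynQuant

/-! ### Counits of the two sides of the shifted cocycle equation -/

section IterDeriv

variable {P V W : Type*} [NormedAddCommGroup P] [NormedSpace ℝ P] [AddCommGroup V] [Module ℝ V]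
  [AddCommGroup W] [Module ℝ W] {l : ℕ} (ξ : Fin l → P)

theorem iterDeriv_map {F : P → V} (hF : IsSmooth F) (L : V →ₗ[ℝ] W) {k : ℕ} (I : Fin k → Fin l) :
    iterDeriv ξ I (fun p => L (F p)) = fun p => L (iterDeriv ξ I F p) := by
  -- Smoothness of the intermediate derivatives is carried along, because it is needed to commute
  -- the next derivative with `L`.
  have key : ∀ T : List (Fin l), T.foldr (fun j F' => partialDeriv (ξ j) F') (fun p => L (F p))
      = (fun p => L (T.foldr (fun j F' => partialDeriv (ξ j) F') F p))
      ∧ IsSmooth (T.foldr (fun j F' => partialDeriv (ξ j) F') F) := by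
    intro T
    induction T with
    | nil => exact ⟨rfl, hF⟩
    | cons j T ih =>
      refine ⟨?_, ih.2.partialDeriv _⟩
      rw [List.foldr_cons, ih.1]
      funext p
      exact partialDeriv_map ih.2 L _ p
  exact (key _).1

theorem iterDeriv_const (v : V) {k : ℕ} (I : Fin (k + 1) → Fin l) (p : P) :
    iterDeriv ξ I (fun _ => v) p = 0 := by
  have key : ∀ (T : List (Fin l)) (j : Fin l),
      (j :: T).foldr (fun j F' => partialDeriv (ξ j) F') (fun _ => v) = fun _ => 0 := by
    intro T
    induction T with
    | nil => exact fun j => funext fun p => partialDeriv_const v _ p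
    | cons i T ih =>
      intro j
      rw [List.foldr_cons, ih]
      exact funext fun p => partialDeriv_const 0 _ p
  rw [iterDeriv, List.ofFn_succ, key]

end IterDeriv

section Series

variable {E P G : Type*} [NormedAddCommGroup E] [NormedSpace ℝ E] [FiniteDimensional ℝ E]
  [NormedAddCommGroup P] [NormedSpace ℝ P]
  [TopologicalSpace G] [ChartedSpace E G] [Group G] [LieGroup 𝓘(ℝ, E) ∞ G]
  {𝔥 : LieSubalgebra ℝ (GroupLieAlgebra 𝓘(ℝ, E) G)} {l : ℕ} (b : Module.Basis (Fin l) ℝ 𝔥)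
  (ξ : Fin l → P) {F : P → PowerSeries (UEA₂ (GroupLieAlgebra 𝓘(ℝ, E) G))}

theorem hMonomial_zero (I : Fin 0 → Fin l) : hMonomial b I = 1 := by
  rw [hMonomial, List.ofFn_zero, List.prod_nil]

theorem counit_hMonomial_succ {k : ℕ} (I : Fin (k + 1) → Fin l) :
    counit (hMonomial b I) = 0 := by
  rw [hMonomial, List.ofFn_succ, List.prod_cons, map_mul, counit_incl, zero_mul]

/-- The hypothesis kills all terms with at least one derivative, so `φ` does not see the shift. -/
theorem map_taylor12 {B : Type*} [Semiring B] [Algebra ℝ B]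
    (φ : UEA₃ (GroupLieAlgebra 𝓘(ℝ, E) G) →ₐ[ℝ] B) (p : P)
    (h : ∀ (k m : ℕ) (I : Fin (k + 1) → Fin l),
      φ (leg12 (iterDeriv ξ I (fun q => PowerSeries.coeff m (F q)) p)
        * leg3 (hMonomial b I)) = 0) (n : ℕ) :
    φ (PowerSeries.coeff n (taylor12 b ξ F p)) = φ (leg12 (PowerSeries.coeff n (F p))) := by
  rw [taylor12, PowerSeries.coeff_mk, map_sum, Finset.sum_eq_single (0, n)]
  · rw [Fintype.sum_unique, hMonomial_zero]
    have : leg3 (1 : UEA (GroupLieAlgebra 𝓘(ℝ, E) G)) = 1 := rfl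
    rw [this, mul_one, Nat.factorial_zero, pow_zero, Nat.cast_one, inv_one, one_mul, one_smul]
    rfl
  · rintro ⟨k, m⟩ hkm hne
    rw [Finset.HasAntidiagonal.mem_antidiagonal] at hkm
    cases k with
    | zero => simp_all
    | succ k =>
      rw [map_smul, map_sum, Finset.sum_eq_zero fun I _ => h k m I, smul_zero]
  · intro hn
    exact absurd (Finset.HasAntidiagonal.mem_antidiagonal.2 (zero_add n)) hn

theorem map_taylor23 {B : Type*} [Semiring B] [Algebra ℝ B]
    (φ : UEA₃ (GroupLieAlgebra 𝓘(ℝ, E) G) →ₐ[ℝ] B) (p : P)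
    (h : ∀ (k m : ℕ) (I : Fin (k + 1) → Fin l),
      φ (leg1 (hMonomial b I)
        * leg23 (iterDeriv ξ I (fun q => PowerSeries.coeff m (F q)) p)) = 0) (n : ℕ) :
    φ (PowerSeries.coeff n (taylor23 b ξ F p)) = φ (leg23 (PowerSeries.coeff n (F p))) := by
  rw [taylor23, PowerSeries.coeff_mk, map_sum, Finset.sum_eq_single (0, n)]
  · rw [Fintype.sum_unique, hMonomial_zero]
    have : leg1 (1 : UEA (GroupLieAlgebra 𝓘(ℝ, E) G)) = 1 := rfl
    rw [this, one_mul, Nat.factorial_zero, pow_zero, Nat.cast_one, inv_one, one_mul, one_smul]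
    rfl
  · rintro ⟨k, m⟩ hkm hne
    rw [Finset.HasAntidiagonal.mem_antidiagonal] at hkm
    cases k with
    | zero => simp_all
    | succ k =>
      rw [map_smul, map_sum, Finset.sum_eq_zero fun I _ => h k m I, smul_zero]
  · intro hn
    exact absurd (Finset.HasAntidiagonal.mem_antidiagonal.2 (zero_add n)) hn

/-- Smooth maps to `(U𝔤 ⊗ U𝔤)[[ħ]]` with counits equal to `1`. -/
structure IsNormalized (F : P → PowerSeries (UEA₂ (GroupLieAlgebra 𝓘(ℝ, E) G))) : Prop where
  smooth : ∀ n, IsSmooth fun p => PowerSeries.coeff n (F p)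
  left : ∀ n p, counitLeft (PowerSeries.coeff n (F p)) = if n = 0 then 1 else 0
  right : ∀ n p, counitRight (PowerSeries.coeff n (F p)) = if n = 0 then 1 else 0

namespace IsNormalized

variable (hF : IsNormalized F)
include hF

/-- The counit commutes with derivatives, and the counit of a normalized series does not depend on
`λ`. -/
theorem counitLeft_iterDeriv {k m : ℕ} (I : Fin (k + 1) → Fin l) (p : P) :
    counitLeft (iterDeriv ξ I (fun q => PowerSeries.coeff m (F q)) p) = 0 := by
  have := congrFun (iterDeriv_map ξ (hF.smooth m) counitLeft.toLinearMap I) p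
  refine this.symm.trans ?_
  simp only [AlgHom.toLinearMap_apply, hF.left]
  exact iterDeriv_const ξ _ I p

theorem counitRight_iterDeriv {k m : ℕ} (I : Fin (k + 1) → Fin l) (p : P) :
    counitRight (iterDeriv ξ I (fun q => PowerSeries.coeff m (F q)) p) = 0 := by
  have := congrFun (iterDeriv_map ξ (hF.smooth m) counitRight.toLinearMap I) p
  refine this.symm.trans ?_
  simp only [AlgHom.toLinearMap_apply, hF.right]
  exact iterDeriv_const ξ _ I p

/-- On the first two legs the counit falls on a derivative of `F`, on the third one on a nonempty
monomial in the `hᵢ`; in either case a shifted term gives zero. -/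
theorem counitLeg_taylor12 (j : Fin 3) (p : P) (n : ℕ) :
    counitLeg j (PowerSeries.coeff n (taylor12 b ξ F p))
      = counitLeg j (leg12 (PowerSeries.coeff n (F p))) := by
  refine map_taylor12 b ξ (counitLeg j) p (fun k m I => ?_) n
  rw [map_mul]
  fin_cases j
  · exact mul_eq_zero_of_left (by
      rw [leg12_eq]
      exact (counitLeg_zero_assocTmul _ _).trans
        (by rw [hF.counitLeft_iterDeriv, TensorProduct.zero_tmul])) _
  · exact mul_eq_zero_of_left (by
      rw [leg12_eq]
      exact (counitLeg_one_assocTmul _ _).trans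
        (by rw [hF.counitRight_iterDeriv, TensorProduct.zero_tmul])) _
  · refine mul_eq_zero_of_right _ ?_
    rw [leg3]
    exact (counitLeg_two_tmul _ _).trans
      (by rw [counitRight_tmul, counit_hMonomial_succ, zero_smul, TensorProduct.tmul_zero])

theorem counitLeg_taylor23 (j : Fin 3) (p : P) (n : ℕ) :
    counitLeg j (PowerSeries.coeff n (taylor23 b ξ F p))
      = counitLeg j (leg23 (PowerSeries.coeff n (F p))) := by
  refine map_taylor23 b ξ (counitLeg j) p (fun k m I => ?_) n
  rw [map_mul]
  fin_cases j
  · refine mul_eq_zero_of_left ?_ _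
    rw [leg1]
    exact (counitLeg_zero_tmul _ _).trans (by rw [counit_hMonomial_succ, zero_smul])
  · refine mul_eq_zero_of_right _ ?_
    rw [leg23_eq]
    exact (counitLeg_one_tmul _ _).trans
      (by rw [hF.counitLeft_iterDeriv, TensorProduct.tmul_zero])
  · refine mul_eq_zero_of_right _ ?_
    rw [leg23_eq]
    exact (counitLeg_two_tmul _ _).trans
      (by rw [hF.counitRight_iterDeriv, TensorProduct.tmul_zero])

theorem counitLeg_leg12 (j : Fin 3) (p : P) (n : ℕ) :
    counitLeg j (leg12 (PowerSeries.coeff n (F p)))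
      = if j = 2 then PowerSeries.coeff n (F p) else if n = 0 then 1 else 0 := by
  rw [leg12_eq]
  fin_cases j
  · refine (counitLeg_zero_assocTmul _ _).trans ?_
    rw [hF.left]
    split_ifs <;> simp_all [Algebra.TensorProduct.one_def]
  · refine (counitLeg_one_assocTmul _ _).trans ?_
    rw [hF.right]
    split_ifs <;> simp_all [Algebra.TensorProduct.one_def]
  · refine (counitLeg_two_assocTmul _ _).trans ?_
    rw [map_one, one_smul]
    rfl

theorem counitLeg_leg23 (j : Fin 3) (p : P) (n : ℕ) :
    counitLeg j (leg23 (PowerSeries.coeff n (F p)))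
      = if j = 0 then PowerSeries.coeff n (F p) else if n = 0 then 1 else 0 := by
  rw [leg23_eq]
  fin_cases j
  · refine (counitLeg_zero_tmul _ _).trans ?_
    rw [map_one, one_smul]
    rfl
  · refine (counitLeg_one_tmul _ _).trans ?_
    rw [hF.left]
    split_ifs <;> simp_all [Algebra.TensorProduct.one_def]
  · refine (counitLeg_two_tmul _ _).trans ?_
    rw [hF.right]
    split_ifs <;> simp_all [Algebra.TensorProduct.one_def]

theorem counitLeg_comulLeft (j : Fin 3) (p : P) (n : ℕ) :
    counitLeg j (comulLeft (PowerSeries.coeff n (F p)))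
      = if j = 2 then (if n = 0 then 1 else 0) else PowerSeries.coeff n (F p) := by
  fin_cases j
  · exact (DFunLike.congr_fun (counitLeg_zero_comulLeft (𝔤 := GroupLieAlgebra 𝓘(ℝ, E) G))
      (PowerSeries.coeff n (F p))).trans rfl
  · exact (DFunLike.congr_fun (counitLeg_one_comulLeft (𝔤 := GroupLieAlgebra 𝓘(ℝ, E) G))
      (PowerSeries.coeff n (F p))).trans rfl
  · refine (DFunLike.congr_fun (counitLeg_two_comulLeft (𝔤 := GroupLieAlgebra 𝓘(ℝ, E) G))
      (PowerSeries.coeff n (F p))).trans ?_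
    rw [AlgHom.comp_apply, hF.right, apply_ite comul, map_one, map_zero]
    rfl

theorem counitLeg_comulRight (j : Fin 3) (p : P) (n : ℕ) :
    counitLeg j (comulRight (PowerSeries.coeff n (F p)))
      = if j = 0 then (if n = 0 then 1 else 0) else PowerSeries.coeff n (F p) := by
  fin_cases j
  · refine (DFunLike.congr_fun (counitLeg_zero_comulRight (𝔤 := GroupLieAlgebra 𝓘(ℝ, E) G))
      (PowerSeries.coeff n (F p))).trans ?_
    rw [AlgHom.comp_apply, hF.left, apply_ite comul, map_one, map_zero]
    rfl
  · exact (DFunLike.congr_fun (counitLeg_one_comulRight (𝔤 := GroupLieAlgebra 𝓘(ℝ, E) G))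
      (PowerSeries.coeff n (F p))).trans rfl
  · exact (DFunLike.congr_fun (counitLeg_two_comulRight (𝔤 := GroupLieAlgebra 𝓘(ℝ, E) G))
      (PowerSeries.coeff n (F p))).trans rfl

/-- For each leg the counit turns one of the two factors into `1` and the other one into `F`. The
same happens in `counitLeg_coeff_right`, so the two sides of the cocycle equation agree after any
counit by normalization alone. -/
theorem counitLeg_coeff_left (j : Fin 3) (p : P) (n : ℕ) :
    counitLeg j (PowerSeries.coeff n
      (PowerSeries.map (comulLeft (𝔤 := GroupLieAlgebra 𝓘(ℝ, E) G)).toRingHom (F p)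
        * taylor12 b ξ F p)) = PowerSeries.coeff n (F p) := by
  have e : ∀ m, PowerSeries.coeff m
      (PowerSeries.map (comulLeft (𝔤 := GroupLieAlgebra 𝓘(ℝ, E) G)).toRingHom (F p))
      = comulLeft (PowerSeries.coeff m (F p)) := fun m => PowerSeries.coeff_map _ _ _
  rw [PowerSeries.coeff_mul, map_sum]
  simp only [map_mul, e, hF.counitLeg_taylor12, hF.counitLeg_leg12, hF.counitLeg_comulLeft]
  split_ifs with hj
  · rw [Finset.sum_eq_single (0, n)]
    · simp
    · rintro ⟨k, m⟩ hkm hne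
      rw [Finset.HasAntidiagonal.mem_antidiagonal] at hkm
      rcases Nat.eq_zero_or_pos k with rfl | hk
      · simp_all
      · rw [if_neg hk.ne', zero_mul]
    · intro hn
      exact absurd (Finset.HasAntidiagonal.mem_antidiagonal.2 (zero_add n)) hn
  · rw [Finset.sum_eq_single (n, 0)]
    · simp
    · rintro ⟨k, m⟩ hkm hne
      rw [Finset.HasAntidiagonal.mem_antidiagonal] at hkm
      rcases Nat.eq_zero_or_pos m with rfl | hk
      · simp_all
      · rw [if_neg hk.ne', mul_zero]
    · intro hn
      exact absurd (Finset.HasAntidiagonal.mem_antidiagonal.2 (add_zero n)) hn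

theorem counitLeg_coeff_right (j : Fin 3) (p : P) (n : ℕ) :
    counitLeg j (PowerSeries.coeff n
      (PowerSeries.map (comulRight (𝔤 := GroupLieAlgebra 𝓘(ℝ, E) G)).toRingHom (F p)
        * taylor23 b ξ F p)) = PowerSeries.coeff n (F p) := by
  have e : ∀ m, PowerSeries.coeff m
      (PowerSeries.map (comulRight (𝔤 := GroupLieAlgebra 𝓘(ℝ, E) G)).toRingHom (F p))
      = comulRight (PowerSeries.coeff m (F p)) := fun m => PowerSeries.coeff_map _ _ _
  rw [PowerSeries.coeff_mul, map_sum]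
  simp only [map_mul, e, hF.counitLeg_taylor23, hF.counitLeg_leg23, hF.counitLeg_comulRight]
  split_ifs with hj
  · rw [Finset.sum_eq_single (0, n)]
    · simp
    · rintro ⟨k, m⟩ hkm hne
      rw [Finset.HasAntidiagonal.mem_antidiagonal] at hkm
      rcases Nat.eq_zero_or_pos k with rfl | hk
      · simp_all
      · rw [if_neg hk.ne', zero_mul]
    · intro hn
      exact absurd (Finset.HasAntidiagonal.mem_antidiagonal.2 (zero_add n)) hn
  · rw [Finset.sum_eq_single (n, 0)]
    · simp
    · rintro ⟨k, m⟩ hkm hne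
      rw [Finset.HasAntidiagonal.mem_antidiagonal] at hkm
      rcases Nat.eq_zero_or_pos m with rfl | hk
      · simp_all
      · rw [if_neg hk.ne', mul_zero]
    · intro hn
      exact absurd (Finset.HasAntidiagonal.mem_antidiagonal.2 (add_zero n)) hn

end IsNormalized

end Series

end DynQuant
end

noncomputable section

namespace DynQuant

/-! ### Functions of the parameter in a product -/

section ParamFunctions

variable {E P G : Type*} [NormedAddCommGroup E] [NormedSpace ℝ E] [FiniteDimensional ℝ E]
  [NormedAddCommGroup P] [NormedSpace ℝ P]
  [TopologicalSpace G] [ChartedSpace E G] [Group G] [LieGroup 𝓘(ℝ, E) ∞ G]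
  {𝔥 : LieSubalgebra ℝ (GroupLieAlgebra 𝓘(ℝ, E) G)} {l : ℕ} (b : Module.Basis (Fin l) ℝ 𝔥)
  (ξ : Fin l → P)

variable (E P G) in
/-- The functions of the parameter. -/
def paramFns : Set (Fn E P G) := Set.range ofP

omit [FiniteDimensional ℝ E] [Group G] [LieGroup 𝓘(ℝ, E) ∞ G] in
theorem ofP_mem_paramFns (a : C^∞⟮𝓘(ℝ, P), P; 𝓘(ℝ, ℝ), ℝ⟯) : (ofP a : Fn E P G) ∈ paramFns E P G :=
  ⟨a, rfl⟩

omit [FiniteDimensional ℝ E] [Group G] [LieGroup 𝓘(ℝ, E) ∞ G] in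
theorem one_mem_paramFns : (1 : Fn E P G) ∈ paramFns E P G := ⟨1, rfl⟩

theorem hOp_mem_paramFns (i : Fin l) : ∀ f ∈ paramFns E P G, hOp P b i f ∈ paramFns E P G := by
  rintro _ ⟨a, rfl⟩
  exact ⟨0, (leftInvField_ofP _ a).symm⟩

omit [FiniteDimensional ℝ E] in
theorem dOp_mem_paramFns (i : Fin l) : ∀ f ∈ paramFns E P G, dOp E G ξ i f ∈ paramFns E P G := by
  rintro _ ⟨a, rfl⟩
  exact ⟨dirDeriv (ξ i) a, rfl⟩

/-- Functions of `λ` are constants for left-invariant operators, which act on them by the counit. -/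
theorem mul'_leftInvOp₂_leftSub {y : Fn E P G ⊗[ℝ] Fn E P G} (hy : y ∈ leftSub (paramFns E P G))
    (v : UEA₂ (GroupLieAlgebra 𝓘(ℝ, E) G)) :
    LinearMap.mul' ℝ (Fn E P G) (leftInvOp₂ E P G v y) = LinearMap.mul' ℝ (Fn E P G)
      (leftInvOp₂ E P G (1 ⊗ₜ counitLeft v) y) := by
  induction hy using Submodule.span_induction with
  | zero => simp only [LinearMap.map_zero]
  | add y z _ _ hy hz => simp only [LinearMap.map_add, hy, hz]
  | smul c y _ hy => simp only [LinearMap.map_smul, hy]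
  | mem y hy =>
    obtain ⟨_, ⟨a, rfl⟩, g, rfl⟩ := hy
    induction v using TensorProduct.induction_on with
    | zero => simp only [map_zero, TensorProduct.tmul_zero, LinearMap.zero_apply]
    | add s t hs ht => simp only [map_add, LinearMap.add_apply, TensorProduct.tmul_add, hs, ht]
    | tmul u w =>
      rw [counitLeft_tmul, TensorProduct.tmul_smul, map_smul, leftInvOp₂_tmul, leftInvOp₂_tmul,
        LinearMap.smul_apply, map_smul, TensorProduct.map_tmul, TensorProduct.map_tmul, map_one,
        LinearMap.mul'_apply, LinearMap.mul'_apply, leftInvOp_ofP, smul_mul_assoc]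
      rfl

theorem mul'_leftInvOp₂_rightSub {y : Fn E P G ⊗[ℝ] Fn E P G} (hy : y ∈ rightSub (paramFns E P G))
    (v : UEA₂ (GroupLieAlgebra 𝓘(ℝ, E) G)) :
    LinearMap.mul' ℝ (Fn E P G) (leftInvOp₂ E P G v y) = LinearMap.mul' ℝ (Fn E P G)
      (leftInvOp₂ E P G (counitRight v ⊗ₜ 1) y) := by
  induction hy using Submodule.span_induction with
  | zero => simp only [LinearMap.map_zero]
  | add y z _ _ hy hz => simp only [LinearMap.map_add, hy, hz]
  | smul c y _ hy => simp only [LinearMap.map_smul, hy]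
  | mem y hy =>
    obtain ⟨f, _, ⟨a, rfl⟩, rfl⟩ := hy
    induction v using TensorProduct.induction_on with
    | zero => simp only [map_zero, TensorProduct.zero_tmul, LinearMap.zero_apply]
    | add s t hs ht => simp only [map_add, LinearMap.add_apply, TensorProduct.add_tmul, hs, ht]
    | tmul u w =>
      rw [counitRight_tmul, ← TensorProduct.smul_tmul', map_smul, leftInvOp₂_tmul, leftInvOp₂_tmul,
        LinearMap.smul_apply, map_smul, TensorProduct.map_tmul, TensorProduct.map_tmul, map_one,
        LinearMap.mul'_apply, LinearMap.mul'_apply, leftInvOp_ofP, mul_smul_comm]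
      rfl

/-- A function of `λ` in leg `j` behaves as a scalar, so only the counit of the symbol in this leg
is seen; `j.succAbove` enumerates the two other legs in order. -/
theorem mul₃_leftInvOp₃_of_counitLeg_eq_zero {u : UEA₃ (GroupLieAlgebra 𝓘(ℝ, E) G)} {j : Fin 3}
    (f : Fin 3 → Fn E P G) (hf : f j ∈ paramFns E P G) :
    mul₃ E P G (leftInvOp₃ E P G u (f 0 ⊗ₜ (f 1 ⊗ₜ f 2)))
      = f j * LinearMap.mul' ℝ (Fn E P G) (leftInvOp₂ E P G (counitLeg j u)
          (f (j.succAbove 0) ⊗ₜ f (j.succAbove 1))) := by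
  obtain ⟨a, ha⟩ := hf
  induction u using TensorProduct.induction_on with
  | zero => simp only [map_zero, LinearMap.zero_apply, mul_zero]
  | add s t hs ht => simp only [map_add, LinearMap.add_apply, hs, ht, mul_add]
  | tmul u v =>
    induction v using TensorProduct.induction_on with
    | zero => simp only [TensorProduct.tmul_zero, map_zero, LinearMap.zero_apply, mul_zero]
    | add s t hs ht =>
      simp only [TensorProduct.tmul_add, map_add, LinearMap.add_apply, hs, ht, mul_add]
    | tmul v w =>
      rw [mul₃_leftInvOp₃_tmul, leftInvOp₂_tmul, TensorProduct.map_tmul, LinearMap.mul'_apply]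
      fin_cases j
      · change _ = f 0 * LinearMap.mul' ℝ (Fn E P G)
          (leftInvOp₂ E P G (counit u • v ⊗ₜ[ℝ] w) (f 1 ⊗ₜ f 2))
        have e : leftInvOp E P G u (f 0) = counit u • f 0 :=
          (congrArg _ ha.symm).trans ((leftInvOp_ofP u a).trans (congrArg _ ha))
        rw [map_smul, LinearMap.smul_apply, map_smul, leftInvOp₂_tmul, TensorProduct.map_tmul,
          LinearMap.mul'_apply, e, smul_mul_assoc, mul_smul_comm]
      · change _ = f 1 * LinearMap.mul' ℝ (Fn E P G)
          (leftInvOp₂ E P G (u ⊗ₜ[ℝ] (counit v • w)) (f 0 ⊗ₜ f 2))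
        have e : leftInvOp E P G v (f 1) = counit v • f 1 :=
          (congrArg _ ha.symm).trans ((leftInvOp_ofP v a).trans (congrArg _ ha))
        rw [leftInvOp₂_tmul, TensorProduct.map_tmul, LinearMap.mul'_apply, e, map_smul,
          LinearMap.smul_apply, smul_mul_assoc, mul_smul_comm, mul_smul_comm, mul_smul_comm,
          mul_left_comm]
      · change _ = f 2 * LinearMap.mul' ℝ (Fn E P G)
          (leftInvOp₂ E P G (u ⊗ₜ[ℝ] (counit w • v)) (f 0 ⊗ₜ f 1))
        have e : leftInvOp E P G w (f 2) = counit w • f 2 :=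
          (congrArg _ ha.symm).trans ((leftInvOp_ofP w a).trans (congrArg _ ha))
        rw [leftInvOp₂_tmul, TensorProduct.map_tmul, LinearMap.mul'_apply, e, map_smul,
          LinearMap.smul_apply, mul_smul_comm, mul_smul_comm, mul_smul_comm, mul_smul_comm,
          ← mul_assoc, mul_comm]

theorem eval₃_eq_of_counitLeg_eq {y : Fn E P G ⊗[ℝ] (Fn E P G ⊗[ℝ] Fn E P G)} {j : Fin 3}
    (hy : y ∈ legSub (paramFns E P G) j) {u v : UEA₃ (GroupLieAlgebra 𝓘(ℝ, E) G)}
    (huv : counitLeg j u = counitLeg j v) (p : P × G) : eval₃ y p u = eval₃ y p v := by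
  rw [eval₃_apply, eval₃_apply]
  refine DFunLike.congr_fun ?_ p
  induction hy using Submodule.span_induction with
  | zero => simp only [LinearMap.map_zero]
  | add y z _ _ hy hz => simp only [LinearMap.map_add, hy, hz]
  | smul c y _ hy => simp only [LinearMap.map_smul, hy]
  | mem y hy =>
    obtain ⟨f, hf, rfl⟩ := hy
    rw [mul₃_leftInvOp₃_of_counitLeg_eq_zero f hf, mul₃_leftInvOp₃_of_counitLeg_eq_zero f hf, huv]

variable {F : P → PowerSeries (UEA₂ (GroupLieAlgebra 𝓘(ℝ, E) G))}
  {Fs : ℕ → smoothMaps P (zeroWeight 𝔥)}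

section Assoc

variable [IsLieAbelian 𝔥]

/-- If one of three functions depends only on the parameter, their product is associative. -/
theorem starOp_assoc_of_mem_legSub (hF : ∀ n, (Fs n).1 = fun p => PowerSeries.coeff n (F p))
    (hN : IsNormalized F) (n : ℕ) {j : Fin 3} {y : Fn E P G ⊗[ℝ] (Fn E P G ⊗[ℝ] Fn E P G)}
    (hy : y ∈ legSub (paramFns E P G) j) :
    ∑ uv ∈ Finset.HasAntidiagonal.antidiagonal n,
      starOp b ξ Fs uv.1 (LinearMap.rTensor (Fn E P G) (starOp b ξ Fs uv.2)
        ((TensorProduct.assoc ℝ (Fn E P G) (Fn E P G) (Fn E P G)).symm y))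
    = ∑ uv ∈ Finset.HasAntidiagonal.antidiagonal n,
      starOp b ξ Fs uv.1 (LinearMap.lTensor (Fn E P G) (starOp b ξ Fs uv.2) y) := by
  ext p
  rw [starOp_rTensor b ξ hF, starOp_lTensor b ξ hF]
  refine Finset.sum_congr rfl fun qt _ => ?_
  -- `θ₁₂ + θ₁₃ + θ₂₃` keeps a function of `λ` in leg `j`, so after the exponential it still
  -- suffices to compare the symbols under the counit of this leg.
  refine eval₃_eq_of_counitLeg_eq (j := j) (divPow_mem (fun v hv => ?_) _ hy)
    ((hN.counitLeg_coeff_left b ξ j p.1 qt.1).trans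
      (hN.counitLeg_coeff_right b ξ j p.1 qt.1).symm) p
  exact add_mem (add_mem (thetaLeg_mem_legSub (hOp_mem_paramFns b) (dOp_mem_paramFns ξ) _ _ hv)
    (thetaLeg_mem_legSub (hOp_mem_paramFns b) (dOp_mem_paramFns ξ) _ _ hv))
    (thetaLeg_mem_legSub (hOp_mem_paramFns b) (dOp_mem_paramFns ξ) _ _ hv)

/-- The shifted cocycle equation implies associativity. -/
theorem starOp_assoc (hF : ∀ n, (Fs n).1 = fun p => PowerSeries.coeff n (F p))
    (hc : ∀ p, PowerSeries.map (comulLeft (𝔤 := GroupLieAlgebra 𝓘(ℝ, E) G)).toRingHom (F p)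
        * taylor12 b ξ F p
      = PowerSeries.map (comulRight (𝔤 := GroupLieAlgebra 𝓘(ℝ, E) G)).toRingHom (F p)
        * taylor23 b ξ F p) (n : ℕ) (y : Fn E P G ⊗[ℝ] (Fn E P G ⊗[ℝ] Fn E P G)) :
    ∑ uv ∈ Finset.HasAntidiagonal.antidiagonal n,
      starOp b ξ Fs uv.1 (LinearMap.rTensor (Fn E P G) (starOp b ξ Fs uv.2)
        ((TensorProduct.assoc ℝ (Fn E P G) (Fn E P G) (Fn E P G)).symm y))
    = ∑ uv ∈ Finset.HasAntidiagonal.antidiagonal n,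
      starOp b ξ Fs uv.1 (LinearMap.lTensor (Fn E P G) (starOp b ξ Fs uv.2) y) := by
  ext p
  rw [starOp_rTensor b ξ hF, starOp_lTensor b ξ hF, hc]

end Assoc

theorem starOp_apply (n : ℕ) (y : Fn E P G ⊗[ℝ] Fn E P G) :
    starOp b ξ Fs n y = ∑ ij ∈ Finset.HasAntidiagonal.antidiagonal n,
      coeffOp (Fs ij.1) (divPow (thetaOf (hOp P b) (dOp E G ξ)) ij.2 y) := seriesOp_apply _ _ _

/-- Normalization makes `F⃗(λ)` act as `1` on tensors with a function of `λ` in the first factor,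
and `θ` preserves these tensors, so only `Θ` remains. -/
theorem starOp_leftSub (hF : ∀ n, (Fs n).1 = fun p => PowerSeries.coeff n (F p))
    (hN : IsNormalized F) (n : ℕ) {y : Fn E P G ⊗[ℝ] Fn E P G}
    (hy : y ∈ leftSub (paramFns E P G)) :
    starOp b ξ Fs n y = LinearMap.mul' ℝ (Fn E P G)
      (divPow (thetaOf (hOp P b) (dOp E G ξ)) n y) := by
  have hc : ∀ m (z : Fn E P G ⊗[ℝ] Fn E P G), z ∈ leftSub (paramFns E P G) →
      coeffOp (Fs m) z = if m = 0 then LinearMap.mul' ℝ (Fn E P G) z else 0 := by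
    intro m z hz
    ext p
    rw [coeffOp_apply, mul'_leftInvOp₂_leftSub hz, hF, hN.left]
    split_ifs
    · rw [← Algebra.TensorProduct.one_def, map_one]
      rfl
    · rw [TensorProduct.tmul_zero, map_zero, LinearMap.zero_apply, map_zero]
  have hy' : ∀ k, divPow (thetaOf (hOp P b) (dOp E G ξ)) k y ∈ leftSub (paramFns E P G) := fun k =>
    divPow_mem (fun _ => thetaOf_mem_leftSub (hOp_mem_paramFns b) (dOp_mem_paramFns ξ)) k hy
  rw [starOp_apply, Finset.sum_eq_single (0, n)]
  · rw [hc _ _ (hy' n), if_pos rfl]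
  · rintro ⟨k, m⟩ hkm hne
    rw [Finset.HasAntidiagonal.mem_antidiagonal] at hkm
    rw [hc _ _ (hy' m), if_neg]
    rintro rfl
    simp_all
  · intro hn
    exact absurd (Finset.HasAntidiagonal.mem_antidiagonal.2 (zero_add n)) hn

theorem starOp_rightSub (hF : ∀ n, (Fs n).1 = fun p => PowerSeries.coeff n (F p))
    (hN : IsNormalized F) (n : ℕ) {y : Fn E P G ⊗[ℝ] Fn E P G}
    (hy : y ∈ rightSub (paramFns E P G)) :
    starOp b ξ Fs n y = LinearMap.mul' ℝ (Fn E P G)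
      (divPow (thetaOf (hOp P b) (dOp E G ξ)) n y) := by
  have hc : ∀ m (z : Fn E P G ⊗[ℝ] Fn E P G), z ∈ rightSub (paramFns E P G) →
      coeffOp (Fs m) z = if m = 0 then LinearMap.mul' ℝ (Fn E P G) z else 0 := by
    intro m z hz
    ext p
    rw [coeffOp_apply, mul'_leftInvOp₂_rightSub hz, hF, hN.right]
    split_ifs
    · rw [← Algebra.TensorProduct.one_def, map_one]
      rfl
    · rw [TensorProduct.zero_tmul, map_zero, LinearMap.zero_apply, map_zero]
  have hy' : ∀ k, divPow (thetaOf (hOp P b) (dOp E G ξ)) k y ∈ rightSub (paramFns E P G) :=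
    fun k => divPow_mem (fun _ => thetaOf_mem_rightSub (hOp_mem_paramFns b) (dOp_mem_paramFns ξ))
      k hy
  rw [starOp_apply, Finset.sum_eq_single (0, n)]
  · rw [hc _ _ (hy' n), if_pos rfl]
  · rintro ⟨k, m⟩ hkm hne
    rw [Finset.HasAntidiagonal.mem_antidiagonal] at hkm
    rw [hc _ _ (hy' m), if_neg]
    rintro rfl
    simp_all
  · intro hn
    exact absurd (Finset.HasAntidiagonal.mem_antidiagonal.2 (zero_add n)) hn

theorem theta_ofG_ofG (f g : C^∞⟮𝓘(ℝ, E), G; 𝓘(ℝ, ℝ), ℝ⟯) :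
    thetaOf (hOp P b) (dOp E G ξ) (ofG f ⊗ₜ ofG g) = 0 := by
  have e : ∀ (i : Fin l) (f : C^∞⟮𝓘(ℝ, E), G; 𝓘(ℝ, ℝ), ℝ⟯),
    dOp E G ξ i (ofG f) = 0 := fun i f => partialP_ofG _ f
  rw [thetaOf_tmul, Finset.sum_eq_zero, smul_zero]
  intro i _
  rw [e, e, TensorProduct.zero_tmul, TensorProduct.tmul_zero, sub_zero]

theorem theta_ofP_ofP (f g : C^∞⟮𝓘(ℝ, P), P; 𝓘(ℝ, ℝ), ℝ⟯) :
    thetaOf (hOp P b) (dOp E G ξ) (ofP f ⊗ₜ ofP g) = 0 := by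
  have e : ∀ (i : Fin l) (f : C^∞⟮𝓘(ℝ, P), P; 𝓘(ℝ, ℝ), ℝ⟯),
    hOp P b i (ofP f) = 0 := fun i f => leftInvField_ofP _ f
  rw [thetaOf_tmul, Finset.sum_eq_zero, smul_zero]
  intro i _
  rw [e, e, TensorProduct.zero_tmul, TensorProduct.tmul_zero, sub_zero]

theorem starOp_ofG_ofG (n : ℕ) (f g : C^∞⟮𝓘(ℝ, E), G; 𝓘(ℝ, ℝ), ℝ⟯) :
    starOp b ξ Fs n (ofG f ⊗ₜ ofG g) = coeffOp (Fs n) (ofG f ⊗ₜ ofG g) := by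
  rw [starOp_apply, Finset.sum_eq_single (n, 0)]
  · rw [divPow_zero, Module.End.one_apply]
  · rintro ⟨k, m⟩ hkm hne
    rw [Finset.HasAntidiagonal.mem_antidiagonal] at hkm
    rw [divPow_apply_of_eq_zero (theta_ofG_ofG b ξ f g), if_neg, map_zero]
    rintro rfl
    simp_all
  · intro hn
    exact absurd (Finset.HasAntidiagonal.mem_antidiagonal.2 (add_zero n)) hn

theorem starOp_ofP_ofP (hF : ∀ n, (Fs n).1 = fun p => PowerSeries.coeff n (F p))
    (hN : IsNormalized F) (n : ℕ) (f g : C^∞⟮𝓘(ℝ, P), P; 𝓘(ℝ, ℝ), ℝ⟯) :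
    starOp b ξ Fs n (ofP f ⊗ₜ ofP g) = if n = 0 then (ofP f * ofP g : Fn E P G) else 0 := by
  rw [starOp_leftSub b ξ hF hN n (tmul_mem_leftSub (ofP_mem_paramFns f) _),
    divPow_apply_of_eq_zero (theta_ofP_ofP b ξ f g), apply_ite (LinearMap.mul' ℝ (Fn E P G)),
    map_zero, LinearMap.mul'_apply]

theorem hOp_one (i : Fin l) : hOp P b i 1 = 0 := leftInvField_ofP _ 1

omit [FiniteDimensional ℝ E] in
theorem dOp_one (i : Fin l) : dOp E G ξ i 1 = 0 := partialP_ofG _ 1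

theorem starOp_one_left (hF : ∀ n, (Fs n).1 = fun p => PowerSeries.coeff n (F p))
    (hN : IsNormalized F) (n : ℕ) (f : Fn E P G) :
    starOp b ξ Fs n (1 ⊗ₜ f) = if n = 0 then f else 0 := by
  have h0 : thetaOf (hOp P b) (dOp E G ξ) (1 ⊗ₜ f) = 0 := by
    rw [thetaOf_tmul, Finset.sum_eq_zero, smul_zero]
    intro i _
    rw [hOp_one, dOp_one, TensorProduct.zero_tmul, TensorProduct.zero_tmul, sub_zero]
  rw [starOp_leftSub b ξ hF hN n (tmul_mem_leftSub one_mem_paramFns _),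
    divPow_apply_of_eq_zero h0, apply_ite (LinearMap.mul' ℝ (Fn E P G)), map_zero,
    LinearMap.mul'_apply, one_mul]

theorem starOp_one_right (hF : ∀ n, (Fs n).1 = fun p => PowerSeries.coeff n (F p))
    (hN : IsNormalized F) (n : ℕ) (f : Fn E P G) :
    starOp b ξ Fs n (f ⊗ₜ 1) = if n = 0 then f else 0 := by
  have h0 : thetaOf (hOp P b) (dOp E G ξ) (f ⊗ₜ 1) = 0 := by
    rw [thetaOf_tmul, Finset.sum_eq_zero, smul_zero]
    intro i _
    rw [hOp_one, dOp_one, TensorProduct.tmul_zero, TensorProduct.tmul_zero, sub_zero]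
  rw [starOp_rightSub b ξ hF hN n (tmul_mem_rightSub _ one_mem_paramFns),
    divPow_apply_of_eq_zero h0, apply_ite (LinearMap.mul' ℝ (Fn E P G)), map_zero,
    LinearMap.mul'_apply, mul_one]

theorem starOp_zero (h0 : ∀ p, (Fs 0).1 p = 1) (y : Fn E P G ⊗[ℝ] Fn E P G) :
    starOp b ξ Fs 0 y = LinearMap.mul' ℝ (Fn E P G) y := by
  ext p
  rw [starOp_apply, Finset.Nat.antidiagonal_zero, Finset.sum_singleton, divPow_zero, coeffOp_apply, h0,
    map_one]
  rfl

theorem starOp_one_apply (h0 : ∀ p, (Fs 0).1 p = 1) (y : Fn E P G ⊗[ℝ] Fn E P G) (p : P × G) :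
    starOp b ξ Fs 1 y p
      = LinearMap.mul' ℝ (Fn E P G) (thetaOf (hOp P b) (dOp E G ξ) y) p
        + LinearMap.mul' ℝ (Fn E P G) (leftInvOp₂ E P G ((Fs 1).1 p.1) y) p := by
  have e : starOp b ξ Fs 1 y = coeffOp (Fs 0) (thetaOf (hOp P b) (dOp E G ξ) y)
      + coeffOp (Fs 1) y := by
    rw [starOp_apply, Finset.Nat.antidiagonal_succ, Finset.sum_cons, Finset.Nat.antidiagonal_zero,
      Finset.map_singleton, Finset.sum_singleton]
    change coeffOp (Fs 0) (divPow (thetaOf (hOp P b) (dOp E G ξ)) 1 y)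
      + coeffOp (Fs 1) (divPow (thetaOf (hOp P b) (dOp E G ξ)) 0 y) = _
    rw [divPow_one, divPow_zero, Module.End.one_apply]
  rw [e, ← evalAt_apply, map_add, evalAt_apply, evalAt_apply, coeffOp_apply, coeffOp_apply, h0,
    map_one, Module.End.one_apply]

theorem mul'_leftInvOp₂_swap (v : UEA₂ (GroupLieAlgebra 𝓘(ℝ, E) G)) (f g : Fn E P G) :
    LinearMap.mul' ℝ (Fn E P G) (leftInvOp₂ E P G v (g ⊗ₜ f))
      = LinearMap.mul' ℝ (Fn E P G) (leftInvOp₂ E P G (flip v) (f ⊗ₜ g)) := by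
  induction v using TensorProduct.induction_on with
  | zero => simp only [map_zero, LinearMap.zero_apply]
  | add s t hs ht => simp only [map_add, LinearMap.add_apply, hs, ht]
  | tmul u v =>
    have : flip (u ⊗ₜ[ℝ] v) = v ⊗ₜ u := rfl
    rw [this, leftInvOp₂_tmul, leftInvOp₂_tmul, TensorProduct.map_tmul, TensorProduct.map_tmul,
      LinearMap.mul'_apply, LinearMap.mul'_apply, mul_comm]

theorem mul'_theta (f g : Fn E P G) (p : P × G) :
    LinearMap.mul' ℝ (Fn E P G) (thetaOf (hOp P b) (dOp E G ξ) (f ⊗ₜ g)) p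
      = (1 / 2) * ∑ i, (hOp P b i f p * dOp E G ξ i g p - dOp E G ξ i f p * hOp P b i g p) := by
  rw [thetaOf_tmul, map_smul, map_sum, ← evalAt_apply, map_smul, map_sum, smul_eq_mul]
  refine congrArg _ (Finset.sum_congr rfl fun i _ => ?_)
  rw [map_sub, map_sub, LinearMap.mul'_apply, LinearMap.mul'_apply, map_mul, map_mul]
  rfl

/-- `θ` is skew, so antisymmetrization cancels its factor `½`; the coefficient contributes `F₁ -
F₁²¹`. -/
theorem starOp_one_sub_swap (h0 : ∀ p, (Fs 0).1 p = 1) (f g : Fn E P G) (p : P × G) :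
    starOp b ξ Fs 1 (f ⊗ₜ g) p - starOp b ξ Fs 1 (g ⊗ₜ f) p
      = ∑ i, (hOp P b i f p * dOp E G ξ i g p - dOp E G ξ i f p * hOp P b i g p)
        + LinearMap.mul' ℝ (Fn E P G) (leftInvOp₂ E P G
          ((Fs 1).1 p.1 - flip ((Fs 1).1 p.1)) (f ⊗ₜ g)) p := by
  rw [starOp_one_apply b ξ h0, starOp_one_apply b ξ h0, mul'_theta, mul'_theta,
    mul'_leftInvOp₂_swap _ f g]
  have e : LinearMap.mul' ℝ (Fn E P G) (leftInvOp₂ E P G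
      ((Fs 1).1 p.1 - flip ((Fs 1).1 p.1)) (f ⊗ₜ g)) p
      = LinearMap.mul' ℝ (Fn E P G) (leftInvOp₂ E P G ((Fs 1).1 p.1) (f ⊗ₜ g)) p
      - LinearMap.mul' ℝ (Fn E P G) (leftInvOp₂ E P G (flip ((Fs 1).1 p.1)) (f ⊗ₜ g)) p := by
    rw [map_sub, LinearMap.sub_apply, map_sub]
    rfl
  have e' : ∑ i, (hOp P b i g p * dOp E G ξ i f p - dOp E G ξ i g p * hOp P b i f p)
      = - ∑ i, (hOp P b i f p * dOp E G ξ i g p - dOp E G ξ i f p * hOp P b i g p) := by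
    rw [← Finset.sum_neg_distrib]
    exact Finset.sum_congr rfl fun i _ => by ring
  rw [e, e']
  ring

end ParamFunctions

end DynQuant
end

noncomputable section

namespace DynQuant

/-! ### The order of bidifferential operators -/

section Order

variable {A Q : Type*} [CommRing A] [Algebra ℝ A] {I : Q → Ideal A}

/-- The elements of `Iⁿ`, as a set. -/
def powSet (I : Ideal A) (n : ℕ) : Set A := {f | f ∈ I ^ n}

omit [Algebra ℝ A] in
theorem powSet_anti (I : Ideal A) {m n : ℕ} (h : m ≤ n) : powSet I n ⊆ powSet I m :=
  fun _ hf => Ideal.pow_le_pow_right h hf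

theorem leftSub_mono {R R' : Set A} (h : R ⊆ R') : leftSub R ≤ leftSub R' :=
  Submodule.span_mono fun _ ⟨f, hf, g, e⟩ => ⟨f, h hf, g, e⟩

theorem rightSub_mono {R R' : Set A} (h : R ⊆ R') : rightSub R ≤ rightSub R' :=
  Submodule.span_mono fun _ ⟨f, g, hg, e⟩ => ⟨f, g, h hg, e⟩

/-- Operators that decrease orders of vanishing by a bounded amount. -/
def FiniteOrder (I : Q → Ideal A) (D : Module.End ℝ A) : Prop :=
  ∃ d : ℕ, ∀ (q : Q) (m : ℕ), ∀ f ∈ powSet (I q) (m + d), D f ∈ powSet (I q) m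

/-- Operators on tensors that decrease orders of vanishing in either argument by a bounded
amount. -/
def FiniteOrder₂ (I : Q → Ideal A) (T : Module.End ℝ (A ⊗[ℝ] A)) : Prop :=
  ∃ d : ℕ, ∀ (q : Q) (m : ℕ) (y : A ⊗[ℝ] A),
    (y ∈ leftSub (powSet (I q) (m + d)) → T y ∈ leftSub (powSet (I q) m)) ∧
    (y ∈ rightSub (powSet (I q) (m + d)) → T y ∈ rightSub (powSet (I q) m))

theorem FiniteOrder.smul {D : Module.End ℝ A} (hD : FiniteOrder I D) (c : ℝ) :
    FiniteOrder I (c • D) := by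
  obtain ⟨d, hd⟩ := hD
  refine ⟨d, fun q m f hf => ?_⟩
  rw [LinearMap.smul_apply, Algebra.smul_def]
  exact Ideal.mul_mem_left _ _ (hd q m f hf)

theorem FiniteOrder.one : FiniteOrder I 1 := ⟨0, fun _ _ _ hf => hf⟩

theorem FiniteOrder.add {D D' : Module.End ℝ A} (hD : FiniteOrder I D) (hD' : FiniteOrder I D') :
    FiniteOrder I (D + D') := by
  obtain ⟨d, hd⟩ := hD
  obtain ⟨d', hd'⟩ := hD'
  refine ⟨max d d', fun q m f hf => (I q ^ m).add_mem (hd q m f (powSet_anti _ ?_ hf))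
    (hd' q m f (powSet_anti _ ?_ hf))⟩
  · exact Nat.add_le_add_left (le_max_left _ _) m
  · exact Nat.add_le_add_left (le_max_right _ _) m

theorem FiniteOrder.mul {D D' : Module.End ℝ A} (hD : FiniteOrder I D) (hD' : FiniteOrder I D') :
    FiniteOrder I (D * D') := by
  obtain ⟨d, hd⟩ := hD
  obtain ⟨d', hd'⟩ := hD'
  refine ⟨d + d', fun q m f hf => hd q m _ (hd' q (m + d) f ?_)⟩
  rwa [add_assoc]

theorem FiniteOrder.of_derivation {D : Module.End ℝ A}
    (h : ∀ f g, D (f * g) = f * D g + g * D f) : FiniteOrder I D :=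
  ⟨1, fun q m _ hf => derivation_mem_pow (map_add D) h (I q) m hf⟩

theorem FiniteOrder.map {D D' : Module.End ℝ A} (hD : FiniteOrder I D) (hD' : FiniteOrder I D') :
    FiniteOrder₂ I (TensorProduct.map D D') := by
  obtain ⟨d, hd⟩ := hD
  obtain ⟨d', hd'⟩ := hD'
  refine ⟨max d d', fun q m y => ⟨fun hy => ?_, fun hy => ?_⟩⟩
  · induction hy using Submodule.span_induction with
    | mem y hy =>
      obtain ⟨f, hf, g, rfl⟩ := hy
      exact tmul_mem_leftSub
        (hd q m f (powSet_anti _ (Nat.add_le_add_left (le_max_left _ _) m) hf)) _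
    | zero => rw [map_zero]; exact zero_mem _
    | add y z _ _ hy hz => rw [map_add]; exact add_mem hy hz
    | smul c y _ hy => rw [map_smul]; exact Submodule.smul_mem _ c hy
  · induction hy using Submodule.span_induction with
    | mem y hy =>
      obtain ⟨f, g, hg, rfl⟩ := hy
      exact tmul_mem_rightSub _
        (hd' q m g (powSet_anti _ (Nat.add_le_add_left (le_max_right _ _) m) hg))
    | zero => rw [map_zero]; exact zero_mem _
    | add y z _ _ hy hz => rw [map_add]; exact add_mem hy hz
    | smul c y _ hy => rw [map_smul]; exact Submodule.smul_mem _ c hy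

theorem FiniteOrder₂.smul {T : Module.End ℝ (A ⊗[ℝ] A)} (hT : FiniteOrder₂ I T) (c : ℝ) :
    FiniteOrder₂ I (c • T) := by
  obtain ⟨d, hd⟩ := hT
  refine ⟨d, fun q m y => ⟨fun hy => ?_, fun hy => ?_⟩⟩
  · exact Submodule.smul_mem _ c ((hd q m y).1 hy)
  · exact Submodule.smul_mem _ c ((hd q m y).2 hy)

theorem FiniteOrder₂.zero : FiniteOrder₂ I 0 :=
  ⟨0, fun _ _ _ => ⟨fun _ => zero_mem _, fun _ => zero_mem _⟩⟩

theorem FiniteOrder₂.one : FiniteOrder₂ I 1 := ⟨0, fun _ _ _ => ⟨id, id⟩⟩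

theorem FiniteOrder₂.add {T T' : Module.End ℝ (A ⊗[ℝ] A)} (hT : FiniteOrder₂ I T)
    (hT' : FiniteOrder₂ I T') : FiniteOrder₂ I (T + T') := by
  obtain ⟨d, hd⟩ := hT
  obtain ⟨d', hd'⟩ := hT'
  have h1 := fun m : ℕ => Nat.add_le_add_left (le_max_left d d') m
  have h2 := fun m : ℕ => Nat.add_le_add_left (le_max_right d d') m
  refine ⟨max d d', fun q m y => ⟨fun hy => ?_, fun hy => ?_⟩⟩
  · exact add_mem ((hd q m y).1 (leftSub_mono (powSet_anti _ (h1 m)) hy))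
      ((hd' q m y).1 (leftSub_mono (powSet_anti _ (h2 m)) hy))
  · exact add_mem ((hd q m y).2 (rightSub_mono (powSet_anti _ (h1 m)) hy))
      ((hd' q m y).2 (rightSub_mono (powSet_anti _ (h2 m)) hy))

theorem FiniteOrder₂.mul {T T' : Module.End ℝ (A ⊗[ℝ] A)} (hT : FiniteOrder₂ I T)
    (hT' : FiniteOrder₂ I T') : FiniteOrder₂ I (T * T') := by
  obtain ⟨d, hd⟩ := hT
  obtain ⟨d', hd'⟩ := hT'
  refine ⟨d + d', fun q m y => ⟨fun hy => (hd q m _).1 ((hd' q (m + d) y).1 ?_),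
    fun hy => (hd q m _).2 ((hd' q (m + d) y).2 ?_)⟩⟩
  · rwa [add_assoc]
  · rwa [add_assoc]

theorem FiniteOrder₂.sum {κ : Type*} {s : Finset κ} {T : κ → Module.End ℝ (A ⊗[ℝ] A)}
    (hT : ∀ i, FiniteOrder₂ I (T i)) : FiniteOrder₂ I (∑ i ∈ s, T i) := by
  classical
  induction s using Finset.induction_on with
  | empty => rw [Finset.sum_empty]; exact FiniteOrder₂.zero
  | insert i s his ih => rw [Finset.sum_insert his]; exact (hT i).add ih

theorem FiniteOrder₂.divPow {T : Module.End ℝ (A ⊗[ℝ] A)} (hT : FiniteOrder₂ I T) (k : ℕ) :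
    FiniteOrder₂ I (divPow T k) := by
  have key : FiniteOrder₂ I (T ^ k) := by
    induction k with
    | zero => rw [pow_zero]; exact FiniteOrder₂.one
    | succ k ih => rw [pow_succ]; exact ih.mul hT
  exact key.smul _

theorem FiniteOrder₂.thetaOf {l : ℕ} {h d : Fin l → Module.End ℝ A}
    (hh : ∀ i f g, h i (f * g) = f * h i g + g * h i f)
    (hd : ∀ i f g, d i (f * g) = f * d i g + g * d i f) : FiniteOrder₂ I (thetaOf h d) := by
  refine (FiniteOrder₂.sum fun i => ?_).smul _
  rw [sub_eq_add_neg, ← neg_one_smul ℝ]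
  exact ((FiniteOrder.of_derivation (hh i)).map (FiniteOrder.of_derivation (hd i))).add
    (((FiniteOrder.of_derivation (hd i)).map (FiniteOrder.of_derivation (hh i))).smul (-1))

theorem mul'_mem_of_mem_leftSub {J : Ideal A} {y : A ⊗[ℝ] A} (hy : y ∈ leftSub (powSet J 1)) :
    LinearMap.mul' ℝ A y ∈ J := by
  induction hy using Submodule.span_induction with
  | mem y hy =>
    obtain ⟨f, hf, g, rfl⟩ := hy
    rw [powSet, pow_one] at hf
    exact Ideal.mul_mem_right _ _ hf
  | zero => rw [map_zero]; exact zero_mem _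
  | add y z _ _ hy hz => rw [map_add]; exact add_mem hy hz
  | smul c y _ hy => rw [map_smul, Algebra.smul_def]; exact Ideal.mul_mem_left _ _ hy

theorem mul'_mem_of_mem_rightSub {J : Ideal A} {y : A ⊗[ℝ] A} (hy : y ∈ rightSub (powSet J 1)) :
    LinearMap.mul' ℝ A y ∈ J := by
  induction hy using Submodule.span_induction with
  | mem y hy =>
    obtain ⟨f, g, hg, rfl⟩ := hy
    rw [powSet, pow_one] at hg
    exact Ideal.mul_mem_left _ _ hg
  | zero => rw [map_zero]; exact zero_mem _
  | add y z _ _ hy hz => rw [map_add]; exact add_mem hy hz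
  | smul c y _ hy => rw [map_smul, Algebra.smul_def]; exact Ideal.mul_mem_left _ _ hy

/-- All `m` above the bound are admitted, so that finitely many operators of different orders can
share one `m`. -/
theorem FiniteOrder₂.exists_mul'_mem {T : Module.End ℝ (A ⊗[ℝ] A)} (hT : FiniteOrder₂ I T) :
    ∃ n, ∀ m, n ≤ m → ∀ q f g, (f ∈ I q ^ (m + 1) ∨ g ∈ I q ^ (m + 1)) →
      LinearMap.mul' ℝ A (T (f ⊗ₜ g)) ∈ I q := by
  obtain ⟨d, hd⟩ := hT
  refine ⟨d, fun m hm q f g => ?_⟩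
  have hle : 1 + d ≤ m + 1 := by omega
  rintro (hf | hg)
  · exact mul'_mem_of_mem_leftSub ((hd q 1 _).1
      (tmul_mem_leftSub (R := powSet (I q) (1 + d)) (powSet_anti _ hle hf) _))
  · exact mul'_mem_of_mem_rightSub ((hd q 1 _).2
      (tmul_mem_rightSub (R := powSet (I q) (1 + d)) _ (powSet_anti _ hle hg)))

end Order

/-! ### Bidifferentiality of the product defined by a coefficient function -/

section Bidifferential

variable {E P G : Type*} [NormedAddCommGroup E] [NormedSpace ℝ E]
  [NormedAddCommGroup P] [NormedSpace ℝ P]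
  [TopologicalSpace G] [ChartedSpace E G]

theorem IsBidifferential.add {B B' : Fn E P G →ₗ[ℝ] Fn E P G →ₗ[ℝ] Fn E P G}
    (hB : IsBidifferential B) (hB' : IsBidifferential B') : IsBidifferential (B + B') := by
  intro q₀
  obtain ⟨n, hn⟩ := hB q₀
  obtain ⟨n', hn'⟩ := hB' q₀
  refine ⟨max n n', ?_⟩
  filter_upwards [hn, hn'] with q hq hq' f g h
  have h1 := hq f g (h.imp (fun h => Ideal.pow_le_pow_right
    (Nat.succ_le_succ (le_max_left n n')) h) fun h => Ideal.pow_le_pow_right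
    (Nat.succ_le_succ (le_max_left n n')) h)
  have h2 := hq' f g (h.imp (fun h => Ideal.pow_le_pow_right
    (Nat.succ_le_succ (le_max_right n n')) h) fun h => Ideal.pow_le_pow_right
    (Nat.succ_le_succ (le_max_right n n')) h)
  change B f g q + B' f g q = 0
  rw [h1, h2, add_zero]

theorem IsBidifferential.sub {B B' : Fn E P G →ₗ[ℝ] Fn E P G →ₗ[ℝ] Fn E P G}
    (hB : IsBidifferential B) (hB' : IsBidifferential B') : IsBidifferential (B - B') := by
  intro q₀
  obtain ⟨n, hn⟩ := hB q₀
  obtain ⟨n', hn'⟩ := hB' q₀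
  refine ⟨max n n', ?_⟩
  filter_upwards [hn, hn'] with q hq hq' f g h
  have h1 := hq f g (h.imp (fun h => Ideal.pow_le_pow_right
    (Nat.succ_le_succ (le_max_left n n')) h) fun h => Ideal.pow_le_pow_right
    (Nat.succ_le_succ (le_max_left n n')) h)
  have h2 := hq' f g (h.imp (fun h => Ideal.pow_le_pow_right
    (Nat.succ_le_succ (le_max_right n n')) h) fun h => Ideal.pow_le_pow_right
    (Nat.succ_le_succ (le_max_right n n')) h)
  change B f g q - B' f g q = 0
  rw [h1, h2, sub_zero]

theorem IsBidifferential.zero :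
    IsBidifferential (0 : Fn E P G →ₗ[ℝ] Fn E P G →ₗ[ℝ] Fn E P G) :=
  fun _ => ⟨0, Filter.Eventually.of_forall fun _ _ _ _ => rfl⟩

theorem IsBidifferential.sum {κ : Type*} {s : Finset κ}
    {B : κ → Fn E P G →ₗ[ℝ] Fn E P G →ₗ[ℝ] Fn E P G} (hB : ∀ i, IsBidifferential (B i)) :
    IsBidifferential (∑ i ∈ s, B i) := by
  classical
  induction s using Finset.induction_on with
  | empty => rw [Finset.sum_empty]; exact IsBidifferential.zero
  | insert i s his ih => rw [Finset.sum_insert his]; exact (hB i).add ih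

variable [FiniteDimensional ℝ E] [Group G] [LieGroup 𝓘(ℝ, E) ∞ G]

theorem finiteOrder_leftInvOp (u : UEA (GroupLieAlgebra 𝓘(ℝ, E) G)) :
    FiniteOrder (vanishingIdeal (E := E) (P := P) (G := G)) (leftInvOp E P G u) :=
  leftInvOp_induction (p := fun D => FiniteOrder (vanishingIdeal (E := E) (P := P) (G := G)) D)
    (fun c => FiniteOrder.one.smul c) (fun X => FiniteOrder.of_derivation (leftInvField_mul X))
    (fun _ _ => FiniteOrder.mul) (fun _ _ => FiniteOrder.add) u

theorem finiteOrder₂_leftInvOp₂ (v : UEA₂ (GroupLieAlgebra 𝓘(ℝ, E) G)) :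
    FiniteOrder₂ (vanishingIdeal (E := E) (P := P) (G := G)) (leftInvOp₂ E P G v) := by
  induction v using TensorProduct.induction_on with
  | zero => rw [map_zero]; exact FiniteOrder₂.zero
  | add s t hs ht => rw [map_add]; exact hs.add ht
  | tmul u w => exact (finiteOrder_leftInvOp u).map (finiteOrder_leftInvOp w)

theorem isBidifferential_coeffOp {K : Submodule ℝ (UEA₂ (GroupLieAlgebra 𝓘(ℝ, E) G))}
    (F : smoothMaps P K) {T : Module.End ℝ (Fn E P G ⊗[ℝ] Fn E P G)}
    (hT : FiniteOrder₂ (vanishingIdeal (E := E) (P := P) (G := G)) T) :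
    IsBidifferential (TensorProduct.curry (coeffOp F ∘ₗ T)) := by
  intro q₀
  obtain ⟨m, v, a, h⟩ := F.2.1.exists_eq_sum q₀.1
  have hj : ∀ j, FiniteOrder₂ (vanishingIdeal (E := E) (P := P) (G := G))
      (leftInvOp₂ E P G (v j) * T) := fun j => (finiteOrder₂_leftInvOp₂ (v j)).mul hT
  choose n hn using fun j => (hj j).exists_mul'_mem
  -- The sum bounds each of the orders of the finitely many terms in the local expression of `F`.
  refine ⟨∑ j, n j, ?_⟩
  filter_upwards [(continuous_fst.tendsto q₀).eventually h] with q hq f g hfg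
  refine (exists_coeffApply_eq hq (T (f ⊗ₜ g)) q.2).trans ?_
  have key : (∑ j, ofP (a j) * LinearMap.mul' ℝ (Fn E P G)
      (leftInvOp₂ E P G (v j) (T (f ⊗ₜ g))) : Fn E P G) ∈ vanishingIdeal q :=
    sum_mem fun j _ => Ideal.mul_mem_left _ _
      (hn j _ (Finset.single_le_sum (fun _ _ => Nat.zero_le _) (Finset.mem_univ j)) q f g hfg)
  exact mem_vanishingIdeal.1 key

variable {𝔥 : LieSubalgebra ℝ (GroupLieAlgebra 𝓘(ℝ, E) G)} {l : ℕ} (b : Module.Basis (Fin l) ℝ 𝔥)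
  (ξ : Fin l → P)

theorem finiteOrder₂_theta : FiniteOrder₂ (vanishingIdeal (E := E) (P := P) (G := G))
    (thetaOf (hOp P b) (dOp E G ξ)) :=
  FiniteOrder₂.thetaOf (fun _ => leftInvField_mul _) (fun _ => partialP_mul _)

theorem isBidifferential_starOp (Fs : ℕ → smoothMaps P (zeroWeight 𝔥)) (n : ℕ) :
    IsBidifferential (TensorProduct.curry (starOp b ξ Fs n)) := by
  have : TensorProduct.curry (starOp b ξ Fs n)
      = ∑ ij ∈ Finset.HasAntidiagonal.antidiagonal n, TensorProduct.curry
        (coeffOp (Fs ij.1) ∘ₗ divPow (thetaOf (hOp P b) (dOp E G ξ)) ij.2) := by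
    ext f g p
    rw [TensorProduct.curry_apply, starOp_apply, LinearMap.sum_apply, LinearMap.sum_apply]
    rfl
  rw [this]
  exact IsBidifferential.sum fun ij => isBidifferential_coeffOp _ ((finiteOrder₂_theta b ξ).divPow _)

end Bidifferential

end DynQuant
end

noncomputable section

namespace DynQuant

/-! ### Smooth curves in a Lie group -/

section Curves

variable {E P G : Type*} [NormedAddCommGroup E] [NormedSpace ℝ E]
  [NormedAddCommGroup P] [NormedSpace ℝ P]
  [TopologicalSpace G] [ChartedSpace E G] [Group G] [LieGroup 𝓘(ℝ, E) ∞ G]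

/-- The velocity of a curve. -/
def velocity {N : Type*} [TopologicalSpace N] [ChartedSpace E N] (δ : ℝ → N) (t : ℝ) : E :=
  mfderiv 𝓘(ℝ, ℝ) 𝓘(ℝ, E) δ t (1 : ℝ)

theorem hasDerivAt_comp_curve {N : Type*} [TopologicalSpace N] [ChartedSpace E N]
    {φ : N → ℝ} {δ : ℝ → N} {t : ℝ} {x : N} (hx : δ t = x)
    (hφ : MDifferentiableAt 𝓘(ℝ, E) 𝓘(ℝ, ℝ) φ x)
    (hδ : MDifferentiableAt 𝓘(ℝ, ℝ) 𝓘(ℝ, E) δ t) :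
    HasDerivAt (fun s => φ (δ s)) (tderiv φ x (velocity δ t : E)) t := by
  have h := (MDifferentiableAt.comp_of_eq t hφ hδ hx).differentiableAt.hasDerivAt
  have e := mfderiv_comp_apply_of_eq t hφ hδ hx (1 : ℝ)
  rw [mfderiv_eq_fderiv] at e
  have e' : deriv (φ ∘ δ) t = tderiv φ x (velocity δ t : E) :=
    (fderiv_apply_one_eq_deriv).symm.trans e
  rw [← e']
  exact h

variable (E) in
/-- The velocity of a curve through the unit, in the Lie algebra. -/
def lieVelocity (δ : ℝ → G) (t : ℝ) : GroupLieAlgebra 𝓘(ℝ, E) G := (velocity δ t : E)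

theorem hasDerivAt_diag {φ : ℝ × ℝ → ℝ} {t a c : ℝ} (hφ : DifferentiableAt ℝ φ (t, t))
    (ha : HasDerivAt (fun s => φ (s, t)) a t) (hc : HasDerivAt (fun s => φ (t, s)) c t) :
    HasDerivAt (fun s => φ (s, s)) (a + c) t := by
  have h := hφ.hasFDerivAt
  have h1 : HasDerivAt (fun s => φ (s, t)) (fderiv ℝ φ (t, t) (1, 0)) t :=
    HasFDerivAt.comp_hasDerivAt (f := fun s => (s, t)) t h
      ((hasDerivAt_id t).prodMk (hasDerivAt_const t t))
  have h2 : HasDerivAt (fun s => φ (t, s)) (fderiv ℝ φ (t, t) (0, 1)) t :=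
    HasFDerivAt.comp_hasDerivAt (f := fun s => (t, s)) t h
      ((hasDerivAt_const t t).prodMk (hasDerivAt_id t))
  have h3 : HasDerivAt (fun s => φ (s, s)) (fderiv ℝ φ (t, t) (1, 1)) t :=
    HasFDerivAt.comp_hasDerivAt (f := fun s => (s, s)) t h
      ((hasDerivAt_id t).prodMk (hasDerivAt_id t))
  rw [ha.unique h1, hc.unique h2, ← map_add]
  simpa using h3

theorem hasDerivAt_mul_curve (k : Fn E P G) (p : P) (x : G) {δ : ℝ → G}
    (hδ : ContMDiff 𝓘(ℝ, ℝ) 𝓘(ℝ, E) ∞ δ) {t : ℝ} (ht : δ t = 1) :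
    HasDerivAt (fun s => k (p, x * δ s)) (leftInvField (lieVelocity E δ t) k (p, x)) t := by
  rw [leftInvField_apply]
  refine hasDerivAt_comp_curve (φ := fun y => k (p, x * y)) ht ?_
    (hδ.mdifferentiable (by simp) t)
  exact ((contMDiff_slice k p).comp (contMDiff_mul_left (n := ∞))).mdifferentiable (by simp) 1

theorem hasDerivAt_moving (k : Fn E (P × ℝ) G) (p : P) (x : G) {ε : ℝ → G}
    (hε : ContMDiff 𝓘(ℝ, ℝ) 𝓘(ℝ, E) ∞ ε) {t : ℝ} (ht : ε t = 1) :
    HasDerivAt (fun s => k ((p, s), x * ε s))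
      (partialP (0, 1) k ((p, t), x) + leftInvField (lieVelocity E ε t) k ((p, t), x)) t := by
  refine hasDerivAt_diag (φ := fun z => k ((p, z.1), x * ε z.2)) ?_ ?_ ?_
  · have : ContMDiff 𝓘(ℝ, ℝ × ℝ) 𝓘(ℝ, ℝ) ∞ fun z : ℝ × ℝ => k ((p, z.1), x * ε z.2) :=
      k.contMDiff.comp ((contDiff_const.prodMk contDiff_fst).contMDiff.prodMk
        (contMDiff_const.mul (hε.comp contDiff_snd.contMDiff)))
    exact this.contDiff.differentiable (by simp) _
  · change HasDerivAt (fun s => k ((p, s), x * ε t)) _ t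
    rw [ht, mul_one, partialP_apply]
    have hd : DifferentiableAt ℝ (fun q => k (q, x)) (p, t) :=
      ((contMDiff_slice' k x).contDiff.differentiable (by simp)).differentiableAt
    exact HasFDerivAt.comp_hasDerivAt (f := fun s => (p, s)) t hd.hasFDerivAt
      ((hasDerivAt_const t p).prodMk (hasDerivAt_id t))
  · exact hasDerivAt_mul_curve k (p, t) x hε ht

/-- Obtained by differentiating `δ(s) δ(s)⁻¹ = 1`. -/
theorem leftInvField_velocity_inv (k : Fn E P G) {δ : ℝ → G}
    (hδ : ContMDiff 𝓘(ℝ, ℝ) 𝓘(ℝ, E) ∞ δ) {t : ℝ} (ht : δ t = 1) (q : P × G) :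
    leftInvField (lieVelocity E (fun s => (δ s)⁻¹) t) k q = - leftInvField (lieVelocity E δ t) k q := by
  have hε : ContMDiff 𝓘(ℝ, ℝ) 𝓘(ℝ, E) ∞ fun s => (δ s)⁻¹ := hδ.inv
  have h1 := hasDerivAt_mul_curve k q.1 q.2 hδ ht
  have h2 := hasDerivAt_mul_curve k q.1 q.2 hε (t := t) (by rw [ht, inv_one])
  have h3 := hasDerivAt_diag (φ := fun z => k (q.1, q.2 * (δ z.1 * (δ z.2)⁻¹))) (t := t) ?_
    (by simpa only [ht, inv_one, mul_one] using h1) (by simpa only [ht, one_mul] using h2)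
  · simp only [mul_inv_cancel] at h3
    have := h3.unique (hasDerivAt_const t _)
    linarith
  · have : ContMDiff 𝓘(ℝ, ℝ × ℝ) 𝓘(ℝ, ℝ) ∞
        fun z : ℝ × ℝ => k (q.1, q.2 * (δ z.1 * (δ z.2)⁻¹)) :=
      k.contMDiff.comp (contMDiff_const.prodMk (contMDiff_const.mul
        ((hδ.comp contDiff_fst.contMDiff).mul (hε.comp contDiff_snd.contMDiff))))
    exact this.contDiff.differentiable (by simp) _

/-- The function `((λ, t), x) ↦ f (λ, x δ(t))`. -/
def mulCurve {δ : ℝ → G} (hδ : ContMDiff 𝓘(ℝ, ℝ) 𝓘(ℝ, E) ∞ δ) (f : Fn E P G) :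
    Fn E (P × ℝ) G :=
  ⟨fun p => f (p.1.1, p.2 * δ p.1.2), f.contMDiff.comp
    ((contDiff_fst.contMDiff.comp contMDiff_fst).prodMk
      (contMDiff_snd.mul (hδ.comp (contDiff_snd.contMDiff.comp contMDiff_fst))))⟩

/-- `λ ↦ (λ, t)`. -/
def sliceAt (t : ℝ) : C^∞⟮𝓘(ℝ, P), P; 𝓘(ℝ, P × ℝ), P × ℝ⟯ :=
  ⟨fun p => (p, t), (contDiff_id.prodMk contDiff_const).contMDiff⟩

/-- Time is treated as an additional parameter. Right translation along the curve then becomes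
restriction to a time slice, and the time derivative becomes a parameter derivative, which commutes
with left-invariant operators. -/
theorem pullback_mulCurve {δ : ℝ → G} (hδ : ContMDiff 𝓘(ℝ, ℝ) 𝓘(ℝ, E) ∞ δ) (f : Fn E P G)
    (t : ℝ) : pullback (sliceAt t) (mulCurve hδ f) = translateHom 1 (δ t) f := by
  ext p
  rw [translateHom_apply, one_mul]
  rfl

theorem pullback_partialP_mulCurve {δ : ℝ → G} (hδ : ContMDiff 𝓘(ℝ, ℝ) 𝓘(ℝ, E) ∞ δ)
    (f : Fn E P G) {t : ℝ} (ht : δ t = 1) :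
    pullback (sliceAt t) (partialP (0, 1) (mulCurve hδ f)) = leftInvField (lieVelocity E δ t) f := by
  ext p
  rw [pullback_apply, partialP_apply]
  have hd : DifferentiableAt ℝ (fun q => mulCurve hδ f (q, p.2)) (p.1, t) :=
    ((contMDiff_slice' (mulCurve hδ f) p.2).contDiff.differentiable (by simp)).differentiableAt
  have h1 := HasFDerivAt.comp_hasDerivAt (f := fun s => (p.1, s)) t hd.hasFDerivAt
      ((hasDerivAt_const t p.1).prodMk (hasDerivAt_id t))
  exact h1.unique (hasDerivAt_mul_curve f p.1 p.2 hδ ht)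

end Curves

/-! ### Derivatives of operators along curves of right translations -/

section Transport

variable {E P P' G : Type*} [NormedAddCommGroup E] [NormedSpace ℝ E] [FiniteDimensional ℝ E]
  [NormedAddCommGroup P] [NormedSpace ℝ P] [NormedAddCommGroup P'] [NormedSpace ℝ P']
  [TopologicalSpace G] [ChartedSpace E G] [Group G] [LieGroup 𝓘(ℝ, E) ∞ G]

theorem mul'_leftInvOp₂_pullback (v : UEA₂ (GroupLieAlgebra 𝓘(ℝ, E) G))
    (j : C^∞⟮𝓘(ℝ, P), P; 𝓘(ℝ, P'), P'⟯) (f g : Fn E P' G) :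
    LinearMap.mul' ℝ (Fn E P G) (leftInvOp₂ E P G v (pullback j f ⊗ₜ pullback j g))
      = pullback j (LinearMap.mul' ℝ (Fn E P' G) (leftInvOp₂ E P' G v (f ⊗ₜ g))) := by
  induction v using TensorProduct.induction_on with
  | zero => simp only [map_zero, LinearMap.zero_apply]
  | add s t hs ht => simp only [map_add, LinearMap.add_apply, hs, ht]
  | tmul u w => rw [leftInvOp₂_tmul, leftInvOp₂_tmul, TensorProduct.map_tmul,
      TensorProduct.map_tmul, LinearMap.mul'_apply, LinearMap.mul'_apply, leftInvOp_pullback,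
      leftInvOp_pullback, map_mul]

variable {δ : ℝ → G} (hδ : ContMDiff 𝓘(ℝ, ℝ) 𝓘(ℝ, E) ∞ δ) {t : ℝ} (ht : δ t = 1)
  (v : UEA₂ (GroupLieAlgebra 𝓘(ℝ, E) G)) (f g : Fn E P G)
include hδ ht

theorem partialP_mul'_mulCurve (p : P) (x : G) :
    partialP (0, 1) (LinearMap.mul' ℝ (Fn E (P × ℝ) G)
        (leftInvOp₂ E (P × ℝ) G v (mulCurve hδ f ⊗ₜ mulCurve hδ g))) ((p, t), x)
      = LinearMap.mul' ℝ (Fn E P G) (leftInvOp₂ E P G v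
          (leibniz (leftInvField (lieVelocity E δ t)) (f ⊗ₜ g))) (p, x) := by
  rw [← mul'_leibniz (partialP_mul _), ← Module.End.mul_apply (leibniz _),
    ← (leibniz_commute_leftInvOp₂ (fun u => leftInvOp_commute_partialP u _) v).eq,
    Module.End.mul_apply]
  have h1 : ∀ f : Fn E P G, f = pullback (sliceAt t) (mulCurve hδ f) := by
    intro f
    rw [pullback_mulCurve, ht]
    ext p
    rw [translateHom_apply, one_mul, mul_one]
  have e1 : leibniz (partialP (0, 1)) (mulCurve hδ f ⊗ₜ mulCurve hδ g)
      = partialP (0, 1) (mulCurve hδ f) ⊗ₜ mulCurve hδ g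
        + mulCurve hδ f ⊗ₜ partialP (0, 1) (mulCurve hδ g) := rfl
  have e2 : leibniz (leftInvField (lieVelocity E δ t)) (f ⊗ₜ g)
      = leftInvField (lieVelocity E δ t) f ⊗ₜ g + f ⊗ₜ leftInvField (lieVelocity E δ t) g := rfl
  have e3 : leftInvField (lieVelocity E δ t) f ⊗ₜ[ℝ] g
      = pullback (sliceAt t) (partialP (0, 1) (mulCurve hδ f))
        ⊗ₜ[ℝ] pullback (sliceAt t) (mulCurve hδ g) := by
    rw [pullback_partialP_mulCurve hδ f ht, ← h1]
  have e4 : f ⊗ₜ[ℝ] leftInvField (lieVelocity E δ t) g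
      = pullback (sliceAt t) (mulCurve hδ f)
        ⊗ₜ[ℝ] pullback (sliceAt t) (partialP (0, 1) (mulCurve hδ g)) := by
    rw [pullback_partialP_mulCurve hδ g ht, ← h1]
  rw [e1, e2, e3, e4, map_add, map_add, map_add, map_add, mul'_leftInvOp₂_pullback,
    mul'_leftInvOp₂_pullback]
  rfl

/-- The derivative of a bidifferential operator applied to right translates along a curve. -/
theorem hasDerivAt_translate (p : P) (x : G) :
    HasDerivAt (fun s => LinearMap.mul' ℝ (Fn E P G) (leftInvOp₂ E P G v
        (translateHom 1 (δ s) f ⊗ₜ translateHom 1 (δ s) g)) (p, x))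
      (LinearMap.mul' ℝ (Fn E P G) (leftInvOp₂ E P G v
          (leibniz (leftInvField (lieVelocity E δ t)) (f ⊗ₜ g))) (p, x)) t := by
  have e : ∀ s, LinearMap.mul' ℝ (Fn E P G) (leftInvOp₂ E P G v
      (translateHom 1 (δ s) f ⊗ₜ translateHom 1 (δ s) g)) (p, x)
      = LinearMap.mul' ℝ (Fn E (P × ℝ) G)
        (leftInvOp₂ E (P × ℝ) G v (mulCurve hδ f ⊗ₜ mulCurve hδ g)) ((p, s), x) := by
    intro s
    rw [← pullback_mulCurve hδ, ← pullback_mulCurve hδ, mul'_leftInvOp₂_pullback]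
    rfl
  simp only [e]
  rw [← partialP_mul'_mulCurve hδ ht, partialP_apply]
  set K := LinearMap.mul' ℝ (Fn E (P × ℝ) G)
    (leftInvOp₂ E (P × ℝ) G v (mulCurve hδ f ⊗ₜ mulCurve hδ g))
  have hd : DifferentiableAt ℝ (fun q => K (q, x)) (p, t) :=
    ((contMDiff_slice' K x).contDiff.differentiable (by simp)).differentiableAt
  exact HasFDerivAt.comp_hasDerivAt (f := fun s => (p, s)) t hd.hasFDerivAt
      ((hasDerivAt_const t p).prodMk (hasDerivAt_id t))

/-- Operators of zero weight are infinitesimally invariant under right translations. -/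
theorem hasDerivAt_conj_translate (hv : Commute (comul (incl (lieVelocity E δ t))) v) (p : P) (x : G) :
    HasDerivAt (fun s => LinearMap.mul' ℝ (Fn E P G) (leftInvOp₂ E P G v
        (translateHom 1 (δ s) f ⊗ₜ translateHom 1 (δ s) g)) (p, x * (δ s)⁻¹)) 0 t := by
  set K := LinearMap.mul' ℝ (Fn E (P × ℝ) G)
    (leftInvOp₂ E (P × ℝ) G v (mulCurve hδ f ⊗ₜ mulCurve hδ g)) with hK
  have e : ∀ s y, LinearMap.mul' ℝ (Fn E P G) (leftInvOp₂ E P G v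
      (translateHom 1 (δ s) f ⊗ₜ translateHom 1 (δ s) g)) (p, y) = K ((p, s), y) := by
    intro s y
    rw [← pullback_mulCurve hδ, ← pullback_mulCurve hδ, mul'_leftInvOp₂_pullback]
    rfl
  have hε : ContMDiff 𝓘(ℝ, ℝ) 𝓘(ℝ, E) ∞ fun s => (δ s)⁻¹ := hδ.inv
  have h1 := hasDerivAt_moving K p x hε (t := t) (by rw [ht, inv_one])
  simp only [e]
  convert h1 using 1
  -- With `X` the velocity, the arguments contribute the symbol `v · ΔX` and the base point `x
  -- δ(s)⁻¹` contributes `-ΔX · v`; they cancel because `ΔX` commutes with `v`.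
  rw [leftInvField_velocity_inv K hδ ht, hK, partialP_mul'_mulCurve hδ ht, ← leftInvOp₂_comul_incl,
    ← Module.End.mul_apply, ← map_mul, ← hv.eq, map_mul, Module.End.mul_apply,
    mul'_leftInvOp₂_comul, ← hK, leftInvOp_incl]
  have h2 : leftInvField (lieVelocity E δ t) K ((p, t), x)
      = pullback (sliceAt t) (leftInvOp E (P × ℝ) G (incl (lieVelocity E δ t)) K) (p, x) := by
    rw [leftInvOp_incl]
    rfl
  have h3 : pullback (sliceAt t) K = LinearMap.mul' ℝ (Fn E P G) (leftInvOp₂ E P G v (f ⊗ₜ g)) := by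
    ext q
    rw [pullback_apply]
    have h1 : ∀ f : Fn E P G, translateHom 1 (δ t) f = f := by
      intro f
      ext p
      rw [translateHom_apply, one_mul, ht, mul_one]
    have := mul'_leftInvOp₂_pullback v (sliceAt t) (mulCurve hδ f) (mulCurve hδ g)
    rw [pullback_mulCurve hδ, pullback_mulCurve hδ, h1, h1] at this
    exact (DFunLike.congr_fun this q).symm
  rw [h2, ← leftInvOp_pullback, h3, leftInvOp_incl, add_neg_cancel]

end Transport

end DynQuant
end

noncomputable section

namespace DynQuant

/-! ### Invariance under a connected Lie subgroup -/

/-- The curve is a straight line in a chart at the unit, mapped to the group by the globally defined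
extension `κ` of the inverse chart. -/
theorem eventually_exists_curve {E' H : Type*} [NormedAddCommGroup E'] [NormedSpace ℝ E']
    [TopologicalSpace H] [ChartedSpace E' H] [Group H] [FiniteDimensional ℝ E']
    [LieGroup 𝓘(ℝ, E') ∞ H] : ∀ᶠ c in 𝓝 (1 : H), ∃ γ : ℝ → H,
    ContMDiff 𝓘(ℝ, ℝ) 𝓘(ℝ, E') ∞ γ ∧ γ 0 = 1 ∧ γ 1 = c := by
  obtain ⟨κ, hκ, hκ₀⟩ := exists_contMDiff_eq_extChartAt_symm (E := E') (1 : H)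
  set y₀ := extChartAt 𝓘(ℝ, E') (1 : H) 1 with hy₀
  filter_upwards [(continuousAt_extChartAt (I := 𝓘(ℝ, E')) (1 : H)).eventually hκ₀,
    extChartAt_source_mem_nhds (I := 𝓘(ℝ, E')) (1 : H)] with c hc hc'
  set y₁ := extChartAt 𝓘(ℝ, E') (1 : H) c with hy₁
  have hl : ContDiff ℝ ∞ fun t : ℝ => y₀ + t • (y₁ - y₀) :=
    contDiff_const.add (contDiff_id.smul contDiff_const)
  refine ⟨fun t => κ (y₀ + t • (y₁ - y₀)), hκ.comp hl.contMDiff, ?_, ?_⟩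
  · simp only [zero_smul, add_zero]
    rw [hκ₀.eq_of_nhds]
    exact extChartAt_to_inv 1
  · simp only [one_smul, add_sub_cancel]
    rw [hc]
    exact (extChartAt 𝓘(ℝ, E') (1 : H)).left_inv hc'

theorem translateHom_one_mul {E P G : Type*} [NormedAddCommGroup E] [NormedSpace ℝ E]
    [NormedAddCommGroup P] [NormedSpace ℝ P] [TopologicalSpace G] [ChartedSpace E G] [Group G]
    [LieGroup 𝓘(ℝ, E) ∞ G] (c d : G) (f : Fn E P G) :
    translateHom 1 (c * d) f = translateHom 1 c (translateHom 1 d f) := by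
  ext p
  simp only [translateHom_apply, one_mul, mul_assoc]

section Subgroup

variable {E P G : Type*} [NormedAddCommGroup E] [NormedSpace ℝ E] [FiniteDimensional ℝ E]
  [NormedAddCommGroup P] [NormedSpace ℝ P]
  [TopologicalSpace G] [ChartedSpace E G] [Group G] [LieGroup 𝓘(ℝ, E) ∞ G]
  {𝔥 : LieSubalgebra ℝ (GroupLieAlgebra 𝓘(ℝ, E) G)}
  {E' H : Type*} [NormedAddCommGroup E'] [NormedSpace ℝ E']
  [TopologicalSpace H] [ChartedSpace E' H] [Group H] {ι : H →* G}
  (hι : IsConnectedLieSubgroup (E' := E') ι 𝔥)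
include hι

namespace IsConnectedLieSubgroup

theorem contMDiff_comp {γ : ℝ → H} (hγ : ContMDiff 𝓘(ℝ, ℝ) 𝓘(ℝ, E') ∞ γ) :
    ContMDiff 𝓘(ℝ, ℝ) 𝓘(ℝ, E) ∞ fun s => ι (γ s) := hι.smooth.comp hγ

theorem velocity_comp {γ : ℝ → H} (hγ : ContMDiff 𝓘(ℝ, ℝ) 𝓘(ℝ, E') ∞ γ) {t : ℝ}
    (ht : γ t = 1) : lieVelocity E (fun s => ι (γ s)) t
      = (mfderiv 𝓘(ℝ, E') 𝓘(ℝ, E) ι 1 (velocity γ t : E') : E) :=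
  mfderiv_comp_apply_of_eq t (hι.smooth.mdifferentiable (by simp) 1)
    (hγ.mdifferentiable (by simp) t) ht (1 : ℝ)

theorem lieVelocity_mem {γ : ℝ → H} (hγ : ContMDiff 𝓘(ℝ, ℝ) 𝓘(ℝ, E') ∞ γ) {t : ℝ}
    (ht : γ t = 1) : lieVelocity E (fun s => ι (γ s)) t ∈ 𝔥 :=
  (hι.lieAlgebra _).2 ⟨(velocity γ t : E'), (hι.velocity_comp hγ ht).symm⟩

variable [FiniteDimensional ℝ E'] [LieGroup 𝓘(ℝ, E') ∞ H]

/-- The straight line through the unit in a chart of `H`, in the direction of a preimage of `X`; the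
chart has identity differential at the unit, so the velocity is this preimage. -/
theorem exists_curve {X : GroupLieAlgebra 𝓘(ℝ, E) G} (hX : X ∈ 𝔥) :
    ∃ γ : ℝ → H, ContMDiff 𝓘(ℝ, ℝ) 𝓘(ℝ, E') ∞ γ ∧ γ 0 = 1 ∧
      lieVelocity E (fun s => ι (γ s)) 0 = X := by
  obtain ⟨Y, hY⟩ := (hι.lieAlgebra X).1 hX
  let Y' : E' := Y
  obtain ⟨κ, hκ, hκ₀⟩ := exists_contMDiff_eq_extChartAt_symm (E := E') (1 : H)
  set y₀ := extChartAt 𝓘(ℝ, E') (1 : H) 1 with hy₀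
  have hl : ContDiff ℝ ∞ fun t : ℝ => y₀ + t • Y' :=
    contDiff_const.add (contDiff_id.smul contDiff_const)
  have hγ : ContMDiff 𝓘(ℝ, ℝ) 𝓘(ℝ, E') ∞ fun t : ℝ => κ (y₀ + t • Y') :=
    hκ.comp hl.contMDiff
  have h1 : κ (y₀ + (0 : ℝ) • Y') = 1 := by
    rw [zero_smul, add_zero, hκ₀.eq_of_nhds]
    exact extChartAt_to_inv 1
  refine ⟨fun t => κ (y₀ + t • Y'), hγ, h1, ?_⟩
  rw [hι.velocity_comp hγ h1, ← hY]
  congr 1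
  have hl' : HasFDerivAt (fun t : ℝ => y₀ + t • Y') (ContinuousLinearMap.toSpanSingleton ℝ Y') 0 :=
    ((ContinuousLinearMap.toSpanSingleton ℝ Y').hasFDerivAt.const_add y₀)
  have e : extChartAt 𝓘(ℝ, E') (1 : H) ∘ (fun t : ℝ => κ (y₀ + t • Y'))
      =ᶠ[𝓝 0] fun t : ℝ => y₀ + t • Y' := by
    have hc : Filter.Tendsto (fun t : ℝ => y₀ + t • Y') (𝓝 0) (𝓝 y₀) := by
      have := hl.continuous.tendsto 0
      simpa using this
    filter_upwards [hc.eventually hκ₀, hc.eventually (extChartAt_target_mem_nhds (1 : H))]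
      with t ht ht'
    rw [Function.comp_apply, ht]
    exact (extChartAt 𝓘(ℝ, E') (1 : H)).right_inv ht'
  have hφ : MDifferentiableAt 𝓘(ℝ, E') 𝓘(ℝ, E') (extChartAt 𝓘(ℝ, E') (1 : H)) 1 :=
    (contMDiffAt_extChartAt (n := ∞)).mdifferentiableAt (by simp)
  have h2 := mfderiv_comp_apply_of_eq (0 : ℝ) hφ (hγ.mdifferentiable (by simp) 0) h1 (1 : ℝ)
  rw [mfderiv_extChartAt_self, Filter.EventuallyEq.mfderiv_eq e, mfderiv_eq_fderiv,
    hl'.fderiv] at h2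
  refine h2.symm.trans ?_
  exact one_smul ℝ Y'

/-- Points near the unit are endpoints of curves, so `S` is an open subgroup; open subgroups are
closed, and `H` is connected. -/
theorem forall_of_curves {S : Subgroup H}
    (h : ∀ γ : ℝ → H, ContMDiff 𝓘(ℝ, ℝ) 𝓘(ℝ, E') ∞ γ → γ 0 = 1 → γ 1 ∈ S) (c : H) : c ∈ S := by
  have := hι.connected
  have : IsTopologicalGroup H := topologicalGroup_of_lieGroup 𝓘(ℝ, E') ∞
  have hS : IsOpen (S : Set H) := S.isOpen_of_mem_nhds (g := 1) (by
    filter_upwards [eventually_exists_curve (E' := E') (H := H)] with c hc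
    obtain ⟨γ, h1, h2, rfl⟩ := hc
    exact h γ h1 h2)
  have hS' : IsClopen (S : Set H) := ⟨S.isClosed_of_isOpen hS, hS⟩
  have := hS'.eq_univ ⟨1, S.one_mem⟩
  exact (Set.ext_iff.1 this c).2 trivial

/-- The elements of `H` under which an operator is invariant. -/
def stabilizer (P : Type*) [NormedAddCommGroup P] [NormedSpace ℝ P] (ι : H →* G)
    (v : UEA₂ (GroupLieAlgebra 𝓘(ℝ, E) G)) : Subgroup H where
  carrier := {c | ∀ (f g : Fn E P G) (p : P) (x : G),
    LinearMap.mul' ℝ (Fn E P G) (leftInvOp₂ E P G v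
      (translateHom 1 (ι c) f ⊗ₜ translateHom 1 (ι c) g)) (p, x * (ι c)⁻¹)
    = LinearMap.mul' ℝ (Fn E P G) (leftInvOp₂ E P G v (f ⊗ₜ g)) (p, x)}
  one_mem' := by
    intro f g p x
    have h1 : ∀ f : Fn E P G, translateHom 1 1 f = f := by
      intro f
      ext p
      rw [translateHom_apply, one_mul, mul_one]
    rw [map_one, h1, h1, inv_one, mul_one]
  mul_mem' {c d} hc hd := by
    intro f g p x
    rw [map_mul, translateHom_one_mul, translateHom_one_mul, mul_inv_rev, ← mul_assoc, hc, hd]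
  inv_mem' {c} hc := by
    intro f g p x
    have := hc (translateHom 1 (ι c⁻¹) f) (translateHom 1 (ι c⁻¹) g) p (x * ι c)
    rw [← translateHom_one_mul, ← translateHom_one_mul, ← map_mul, mul_inv_cancel, map_one,
      mul_inv_cancel_right] at this
    have h1 : ∀ f : Fn E P G, translateHom 1 1 f = f := by
      intro f
      ext p
      rw [translateHom_apply, one_mul, mul_one]
    rw [h1, h1] at this
    rw [map_inv, inv_inv, ← map_inv, this]

/-- Operators of zero weight are invariant under right translations by the subgroup. -/
theorem translateHom_invariant {v : UEA₂ (GroupLieAlgebra 𝓘(ℝ, E) G)} (hv : v ∈ zeroWeight 𝔥)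
    (c : H) (f g : Fn E P G) :
    LinearMap.mul' ℝ (Fn E P G) (leftInvOp₂ E P G v
      (translateHom 1 (ι c) f ⊗ₜ translateHom 1 (ι c) g))
    = translateHom 1 (ι c) (LinearMap.mul' ℝ (Fn E P G) (leftInvOp₂ E P G v (f ⊗ₜ g))) := by
  have key : c ∈ stabilizer P ι v := by
    refine hι.forall_of_curves (S := stabilizer P ι v) (fun γ hγ h0 => ?_) c
    intro f g p x
    set ψ : ℝ → ℝ := fun s => LinearMap.mul' ℝ (Fn E P G) (leftInvOp₂ E P G v
      (translateHom 1 (ι (γ s)) f ⊗ₜ translateHom 1 (ι (γ s)) g)) (p, x * (ι (γ s))⁻¹) with hψ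
    have hd : ∀ t, HasDerivAt ψ 0 t := by
      intro t
      -- The infinitesimal statement concerns curves at the unit, so the curve is recentred at time
      -- `t`, and the translation by `γ t` is moved to the functions and to the base point.
      have hγ' : ContMDiff 𝓘(ℝ, ℝ) 𝓘(ℝ, E') ∞ fun s => γ s * (γ t)⁻¹ := hγ.mul contMDiff_const
      have ht : γ t * (γ t)⁻¹ = 1 := mul_inv_cancel _
      have h1 := hasDerivAt_conj_translate (hι.contMDiff_comp hγ') (t := t)
        (by rw [ht, map_one]) v (translateHom 1 (ι (γ t)) f) (translateHom 1 (ι (γ t)) g)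
        (hv _ (hι.lieVelocity_mem hγ' ht)) p (x * (ι (γ t))⁻¹)
      convert h1 using 2 with s
      have e : ι (γ s) = ι (γ s * (γ t)⁻¹) * ι (γ t) := by
        rw [← map_mul, inv_mul_cancel_right]
      have e' : x * (ι (γ s))⁻¹ = x * (ι (γ t))⁻¹ * (ι (γ s * (γ t)⁻¹))⁻¹ := by
        rw [mul_assoc, ← mul_inv_rev, ← e]
      rw [hψ]
      simp only []
      rw [e', ← translateHom_one_mul, ← translateHom_one_mul, ← e]
    have hc : ψ 1 = ψ 0 := is_const_of_deriv_eq_zero (fun t => (hd t).differentiableAt)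
      (fun t => (hd t).deriv) 1 0
    refine hc.trans ?_
    rw [hψ]
    simp only [h0]
    exact (stabilizer P ι v).one_mem f g p x
  ext q
  have := key f g q.1 (q.2 * ι c)
  rw [mul_inv_cancel_right] at this
  rw [translateHom_apply, one_mul]
  exact this

/-- Operators that are invariant under right translations by the subgroup have zero weight. -/
theorem mem_zeroWeight [T2Space G] {v : UEA₂ (GroupLieAlgebra 𝓘(ℝ, E) G)} (p : P)
    (hv : ∀ (c : H) (f g : C^∞⟮𝓘(ℝ, E), G; 𝓘(ℝ, ℝ), ℝ⟯),
      LinearMap.mul' ℝ (Fn E P G) (leftInvOp₂ E P G v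
        (translateHom 1 (ι c) (ofG f) ⊗ₜ translateHom 1 (ι c) (ofG g))) (p, 1)
      = LinearMap.mul' ℝ (Fn E P G) (leftInvOp₂ E P G v (ofG f ⊗ₜ ofG g)) (p, ι c)) :
    v ∈ zeroWeight 𝔥 := by
  intro X hX
  obtain ⟨γ, hγ, h0, rfl⟩ := hι.exists_curve hX
  rw [commute_iff_eq, ← sub_eq_zero]
  refine leftInvOp₂_separating p _ fun f g => ?_
  have hδ := hι.contMDiff_comp hγ
  -- By invariance, translating the arguments and translating the value give the same function of
  -- time. Its derivative at `0` is given by the symbol `v · ΔX` in the first description and by `ΔX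
  -- · v` in the second.
  have h1 := hasDerivAt_translate hδ (t := 0) (by rw [h0, map_one]) v (ofG f : Fn E P G) (ofG g) p 1
  have h2 := hasDerivAt_mul_curve
    (LinearMap.mul' ℝ (Fn E P G) (leftInvOp₂ E P G v (ofG f ⊗ₜ ofG g))) p 1 hδ (t := 0)
    (by rw [h0, map_one])
  simp only [one_mul] at h2
  simp only [hv] at h1
  have h3 := h1.unique h2
  rw [← leftInvOp₂_comul_incl, ← leftInvOp_incl, ← mul'_leftInvOp₂_comul,
    ← Module.End.mul_apply, ← Module.End.mul_apply, ← map_mul, ← map_mul] at h3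
  rw [map_sub, LinearMap.sub_apply, map_sub, ← evalAt_apply, map_sub, evalAt_apply, evalAt_apply,
    h3, sub_self]

end IsConnectedLieSubgroup

end Subgroup

end DynQuant
end

noncomputable section

namespace DynQuant

/-! ### Invariance of the product under left translations and the subgroup -/

section Invariance

variable {E P G : Type*} [NormedAddCommGroup E] [NormedSpace ℝ E] [FiniteDimensional ℝ E]
  [NormedAddCommGroup P] [NormedSpace ℝ P]
  [TopologicalSpace G] [ChartedSpace E G] [Group G] [LieGroup 𝓘(ℝ, E) ∞ G]

theorem mul'_leftInvOp₂_translate (v : UEA₂ (GroupLieAlgebra 𝓘(ℝ, E) G)) (a : G)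
    (f g : Fn E P G) :
    LinearMap.mul' ℝ (Fn E P G) (leftInvOp₂ E P G v (translateHom a 1 f ⊗ₜ translateHom a 1 g))
      = translateHom a 1 (LinearMap.mul' ℝ (Fn E P G) (leftInvOp₂ E P G v (f ⊗ₜ g))) := by
  induction v using TensorProduct.induction_on with
  | zero => simp only [map_zero, LinearMap.zero_apply]
  | add s t hs ht => simp only [map_add, LinearMap.add_apply, hs, ht]
  | tmul u w => rw [leftInvOp₂_tmul, TensorProduct.map_tmul,
      TensorProduct.map_tmul, LinearMap.mul'_apply, LinearMap.mul'_apply, leftInvOp_translate,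
      leftInvOp_translate, map_mul]

omit [FiniteDimensional ℝ E] in
theorem translateHom_eq (a c : G) (f : Fn E P G) :
    translateHom a c f = translateHom a 1 (translateHom 1 c f) := by
  ext p
  simp only [translateHom_apply, one_mul, mul_one]

variable {𝔥 : LieSubalgebra ℝ (GroupLieAlgebra 𝓘(ℝ, E) G)}
  {E' H : Type*} [NormedAddCommGroup E'] [NormedSpace ℝ E'] [FiniteDimensional ℝ E']
  [TopologicalSpace H] [ChartedSpace E' H] [Group H] [LieGroup 𝓘(ℝ, E') ∞ H] {ι : H →* G}
  (hι : IsConnectedLieSubgroup (E' := E') ι 𝔥) {l : ℕ} (b : Module.Basis (Fin l) ℝ 𝔥)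
  (ξ : Fin l → P)
include hι

namespace IsConnectedLieSubgroup

theorem mul'_translateHom {v : UEA₂ (GroupLieAlgebra 𝓘(ℝ, E) G)} (hv : v ∈ zeroWeight 𝔥)
    (a : G) (c : H) (f g : Fn E P G) :
    LinearMap.mul' ℝ (Fn E P G) (leftInvOp₂ E P G v
      (translateHom a (ι c) f ⊗ₜ translateHom a (ι c) g))
    = translateHom a (ι c) (LinearMap.mul' ℝ (Fn E P G) (leftInvOp₂ E P G v (f ⊗ₜ g))) := by
  rw [translateHom_eq a (ι c) f, translateHom_eq a (ι c) g, mul'_leftInvOp₂_translate, hι.translateHom_invariant hv,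
    ← translateHom_eq]

omit [FiniteDimensional ℝ E'] [LieGroup 𝓘(ℝ, E') ∞ H] hι [TopologicalSpace H]
  [NormedAddCommGroup E'] [NormedSpace ℝ E'] [ChartedSpace E' H] [Group H] in
-- With the second function equal to `1`, the invariance theorem for `U𝔤 ⊗ U𝔤` applied to `X ⊗ 1`
-- yields that the vector fields from `𝔥` commute with right translations by the subgroup.
theorem incl_tmul_one_mem_zeroWeight [IsLieAbelian 𝔥] (X : 𝔥) :
    (incl (X : GroupLieAlgebra 𝓘(ℝ, E) G) ⊗ₜ[ℝ] (1 : UEA (GroupLieAlgebra 𝓘(ℝ, E) G)))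
      ∈ zeroWeight 𝔥 := by
  intro Y hY
  have h0 : ⁅Y, (X : GroupLieAlgebra 𝓘(ℝ, E) G)⁆ = 0 := by
    have : ⁅(⟨Y, hY⟩ : 𝔥), X⁆ = 0 := trivial_lie_zero _ _ _ _
    exact congrArg Subtype.val this
  have h1 : incl Y * incl (X : GroupLieAlgebra 𝓘(ℝ, E) G)
      = incl (X : GroupLieAlgebra 𝓘(ℝ, E) G) * incl Y := by
    have := incl_lie Y (X : GroupLieAlgebra 𝓘(ℝ, E) G)
    rw [h0, map_zero] at this
    exact (sub_eq_zero.1 this.symm)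
  rw [commute_iff_eq, comul_incl, add_mul, mul_add]
  simp only [Algebra.TensorProduct.tmul_mul_tmul, one_mul, mul_one, h1]

variable [IsLieAbelian 𝔥]

theorem leftInvField_translateHom (X : 𝔥) (a : G) (c : H) (f : Fn E P G) :
    leftInvField (X : GroupLieAlgebra 𝓘(ℝ, E) G) (translateHom a (ι c) f)
      = translateHom a (ι c) (leftInvField (X : GroupLieAlgebra 𝓘(ℝ, E) G) f) := by
  have := hι.mul'_translateHom (incl_tmul_one_mem_zeroWeight X) a c f 1
  rw [map_one, leftInvOp₂_tmul, TensorProduct.map_tmul, TensorProduct.map_tmul,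
    LinearMap.mul'_apply, LinearMap.mul'_apply, map_one (leftInvOp E P G), Module.End.one_apply,
    mul_one, mul_one, leftInvOp_incl] at this
  exact this

theorem theta_translateHom (a : G) (c : H) (y : Fn E P G ⊗[ℝ] Fn E P G) :
    TensorProduct.map (translateHom a (ι c)).toLinearMap (translateHom a (ι c)).toLinearMap
        (thetaOf (hOp P b) (dOp E G ξ) y)
      = thetaOf (hOp P b) (dOp E G ξ) (TensorProduct.map (translateHom a (ι c)).toLinearMap
        (translateHom a (ι c)).toLinearMap y) := by
  induction y using TensorProduct.induction_on with
  | zero => simp only [map_zero]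
  | add y z hy hz => simp only [map_add, hy, hz]
  | tmul f g =>
    have eh : ∀ (i : Fin l) (f : Fn E P G), hOp P b i (translateHom a (ι c) f)
      = translateHom a (ι c) (hOp P b i f) := fun i f => hι.leftInvField_translateHom (b i) a c f
    have ed : ∀ (i : Fin l) (f : Fn E P G), dOp E G ξ i (translateHom a (ι c) f)
      = translateHom a (ι c) (dOp E G ξ i f) := fun i f => rfl
    rw [thetaOf_tmul, TensorProduct.map_tmul, thetaOf_tmul, map_smul, map_sum]
    refine congrArg _ (Finset.sum_congr rfl fun i _ => ?_)
    rw [map_sub, TensorProduct.map_tmul, TensorProduct.map_tmul, AlgHom.toLinearMap_apply,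
      AlgHom.toLinearMap_apply, AlgHom.toLinearMap_apply, AlgHom.toLinearMap_apply,
      AlgHom.toLinearMap_apply, AlgHom.toLinearMap_apply, eh, ed, eh, ed]

omit [IsLieAbelian 𝔥] in
theorem coeffOp_translateHom (F : smoothMaps P (zeroWeight 𝔥)) (a : G) (c : H)
    (y : Fn E P G ⊗[ℝ] Fn E P G) :
    coeffOp F (TensorProduct.map (translateHom a (ι c)).toLinearMap
        (translateHom a (ι c)).toLinearMap y) = translateHom a (ι c) (coeffOp F y) := by
  induction y using TensorProduct.induction_on with
  | zero => simp only [map_zero]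
  | add y z hy hz => simp only [map_add, hy, hz]
  | tmul f g =>
    ext p
    rw [TensorProduct.map_tmul, AlgHom.toLinearMap_apply, AlgHom.toLinearMap_apply, coeffOp_apply,
      hι.mul'_translateHom (F.2.2 p.1), translateHom_apply, translateHom_apply, coeffOp_apply]

theorem starOp_translateHom (Fs : ℕ → smoothMaps P (zeroWeight 𝔥)) (n : ℕ) (a : G) (c : H)
    (f g : Fn E P G) :
    starOp b ξ Fs n (translateHom a (ι c) f ⊗ₜ translateHom a (ι c) g)
      = translateHom a (ι c) (starOp b ξ Fs n (f ⊗ₜ g)) := by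
  rw [starOp_apply, starOp_apply, map_sum]
  refine Finset.sum_congr rfl fun ij _ => ?_
  rw [← hι.coeffOp_translateHom, divPow_intertwine (hι.theta_translateHom b ξ a c)]
  rfl

end IsConnectedLieSubgroup

end Invariance

end DynQuant
end

noncomputable section

namespace DynQuant

/-! ### Products determined by their restrictions to two subalgebras -/

section Rigidity

open Finset HasAntidiagonal

variable {A : Type*} [CommRing A] [Algebra ℝ A]

/-- Only the two end terms involve the order `n`; they are distinct because `n ≠ 0`. This isolates
the top order in the difference of two associativity equations. -/
theorem sum_antidiagonal_sub {M : Type*} [AddCommGroup M] {n : ℕ} (hn : n ≠ 0) (S T : ℕ × ℕ → M)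
    (h : ∀ i j, i < n → j < n → S (i, j) = T (i, j)) :
    ∑ ij ∈ antidiagonal n, S ij - ∑ ij ∈ antidiagonal n, T ij
      = (S (n, 0) - T (n, 0)) + (S (0, n) - T (0, n)) := by
  have hne : ((n, 0) : ℕ × ℕ) ≠ (0, n) := fun h => hn (Prod.mk.inj h).1
  rw [← Finset.sum_sub_distrib, ← Finset.sum_pair (f := fun ij => S ij - T ij) hne]
  refine (Finset.sum_subset ?_ fun ij hij hij' => ?_).symm
  · intro ij hij
    rw [Finset.mem_insert, Finset.mem_singleton] at hij
    rw [HasAntidiagonal.mem_antidiagonal]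
    rcases hij with rfl | rfl <;> simp
  · obtain ⟨i, j⟩ := ij
    rw [HasAntidiagonal.mem_antidiagonal] at hij
    rw [Finset.mem_insert, Finset.mem_singleton, Prod.mk.injEq, Prod.mk.injEq] at hij'
    exact sub_eq_zero.2 (h i j (by simp only at hij; omega) (by simp only at hij; omega))

/-- Two formal deformations of the multiplication of a commutative algebra agree if they agree on
two subsets `U` and `V` whose products suffice to recognize the coefficients, provided that one
is associative and the other is associative as soon as one argument lies in `U`. -/
theorem eq_of_eq_on_generators {B C : ℕ → A →ₗ[ℝ] A →ₗ[ℝ] A} {U V : Set A}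
    (hU : ∀ a ∈ U, ∀ b ∈ U, a * b ∈ U) (hV : ∀ a ∈ V, ∀ b ∈ V, a * b ∈ V)
    (hB0 : ∀ f g, B 0 f g = f * g) (hC0 : ∀ f g, C 0 f g = f * g)
    (hB : ∀ n f g h, ∑ ij ∈ antidiagonal n, B ij.1 (B ij.2 f g) h
      = ∑ ij ∈ antidiagonal n, B ij.1 f (B ij.2 g h))
    (hC : ∀ n f g h, (f ∈ U ∨ g ∈ U ∨ h ∈ U) → ∑ ij ∈ antidiagonal n, C ij.1 (C ij.2 f g) h
      = ∑ ij ∈ antidiagonal n, C ij.1 f (C ij.2 g h))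
    (hUV : ∀ n, ∀ f ∈ U ∪ V, ∀ g ∈ U ∪ V, B n f g = C n f g)
    (hdense : ∀ n, (∀ a ∈ U, ∀ u ∈ V, ∀ b ∈ U, ∀ v ∈ V,
      B n (a * u) (b * v) = C n (a * u) (b * v)) → B n = C n) (n : ℕ) : B n = C n := by
  induction n using Nat.strong_induction_on with
  | _ n ih =>
    rcases Nat.eq_zero_or_pos n with rfl | hn
    · ext f g
      rw [hB0, hC0]
    have hn0 : n ≠ 0 := hn.ne'
    set D : A → A → A := fun f g => B n f g - C n f g with hD
    -- The lower orders agree by induction and cancel, so the associativity equations at order `n`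
    -- make `D` satisfy the Hochschild cocycle identity, on the triples on which both products are
    -- associative.
    have coc : ∀ f g h, (f ∈ U ∨ g ∈ U ∨ h ∈ U) →
        D (f * g) h + D f g * h = D f (g * h) + f * D g h := by
      intro f g h hfgh
      have e1 := sum_antidiagonal_sub hn0 (fun ij => B ij.1 (B ij.2 f g) h)
        (fun ij => C ij.1 (C ij.2 f g) h)
        (fun i j hi hj => by simp only [ih i hi, ih j hj])
      have e2 := sum_antidiagonal_sub hn0 (fun ij => B ij.1 f (B ij.2 g h))
        (fun ij => C ij.1 f (C ij.2 g h))
        (fun i j hi hj => by simp only [ih i hi, ih j hj])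
      rw [hB, hC n f g h hfgh, e2] at e1
      simp only [hB0, hC0] at e1
      simp only [hD]
      linear_combination -e1
    have hUV0 : ∀ f ∈ U ∪ V, ∀ g ∈ U ∪ V, D f g = 0 := fun f hf g hg =>
      sub_eq_zero.2 (hUV n f hf g hg)
    -- In the cocycle identity for `(a, b, u)` every other term pairs generators, and so vanishes.
    have h1 : ∀ a ∈ U, ∀ b ∈ U, ∀ u ∈ V, D a (b * u) = 0 := by
      intro a ha b hb u hu
      have := coc a b u (Or.inl ha)
      rw [hUV0 _ (Or.inl (hU a ha b hb)) u (Or.inr hu), hUV0 a (Or.inl ha) b (Or.inl hb),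
        hUV0 b (Or.inl hb) u (Or.inr hu)] at this
      linear_combination -this
    have h2 : ∀ u ∈ V, ∀ v ∈ V, ∀ b ∈ U, D u (v * b) = 0 := by
      intro u hu v hv b hb
      have := coc u v b (Or.inr (Or.inr hb))
      rw [hUV0 _ (Or.inr (hV u hu v hv)) b (Or.inl hb), hUV0 u (Or.inr hu) v (Or.inr hv),
        hUV0 v (Or.inr hv) b (Or.inl hb)] at this
      linear_combination -this
    refine hdense n fun a ha u hu b hb v hv => sub_eq_zero.1 ?_
    -- As multiplication is commutative, `u (b v) = b (u v)`; so `h1` and `h2` dispose of the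
    -- right-hand side, and only `D (a u) (b v)` is left.
    have h3 := coc a u (b * v) (Or.inl ha)
    have h4 : u * (b * v) = b * (u * v) := by ring
    rw [hUV0 a (Or.inl ha) u (Or.inr hu), h4, h1 a ha b hb (u * v) (hV u hu v hv),
      mul_comm b v, h2 u hu v hv b hb] at h3
    rw [mul_comm b v]
    have h5 : D (a * u) (v * b) = 0 := by linear_combination h3
    exact h5

end Rigidity

/-! ### Star products and quantizations, with parameters in a normed space -/

section Star

variable {E P G : Type*} [NormedAddCommGroup E] [NormedSpace ℝ E] [FiniteDimensional ℝ E]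
  [NormedAddCommGroup P] [NormedSpace ℝ P]
  [TopologicalSpace G] [ChartedSpace E G] [Group G] [LieGroup 𝓘(ℝ, E) ∞ G]
  {𝔥 : LieSubalgebra ℝ (GroupLieAlgebra 𝓘(ℝ, E) G)}

/-- Star products with coefficient `F`, for a parameter space `P` with vectors `ξᵢ`. -/
structure IsParamStar {H : Type*} [Group H] (ι : H →* G) {l : ℕ} (b : Module.Basis (Fin l) ℝ 𝔥)
    (ξ : Fin l → P)
    (r : P → GroupLieAlgebra 𝓘(ℝ, E) G ⊗[ℝ] GroupLieAlgebra 𝓘(ℝ, E) G)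
    (B : ℕ → Fn E P G →ₗ[ℝ] Fn E P G →ₗ[ℝ] Fn E P G)
    (F : P → PowerSeries (UEA₂ (GroupLieAlgebra 𝓘(ℝ, E) G))) : Prop where
  bidifferential : ∀ n, IsBidifferential (B n)
  coeff_zero : ∀ f g, B 0 f g = f * g
  assoc : ∀ n f g h,
    ∑ ij ∈ Finset.HasAntidiagonal.antidiagonal n, B ij.1 (B ij.2 f g) h
      = ∑ ij ∈ Finset.HasAntidiagonal.antidiagonal n, B ij.1 f (B ij.2 g h)
  one_left : ∀ n f, B n 1 f = if n = 0 then f else 0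
  one_right : ∀ n f, B n f 1 = if n = 0 then f else 0
  poisson : ∀ f g p, B 1 f g p - B 1 g f p
    = ∑ i, (hOp P b i f p * dOp E G ξ i g p - dOp E G ξ i f p * hOp P b i g p)
      + LinearMap.mul' ℝ (Fn E P G) (leftInvOp₂ E P G (incl₂ (r p.1)) (f ⊗ₜ g)) p
  invariant : ∀ n (a : G) (c : H) f g,
    B n (translateHom a (ι c) f) (translateHom a (ι c) g) = translateHom a (ι c) (B n f g)
  pointwise : ∀ n f g, B n (ofP f) (ofP g) = if n = 0 then ofP f * ofP g else 0
  theta_left : ∀ n f g p, B n (ofP f) (ofG g) p = LinearMap.mul' ℝ (Fn E P G)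
    (divPow (thetaOf (hOp P b) (dOp E G ξ)) n (ofP f ⊗ₜ ofG g)) p
  theta_right : ∀ n f g p, B n (ofG g) (ofP f) p = LinearMap.mul' ℝ (Fn E P G)
    (divPow (thetaOf (hOp P b) (dOp E G ξ)) n (ofG g ⊗ₜ ofP f)) p
  smooth : ∀ n, IsSmooth fun p => PowerSeries.coeff n (F p)
  coefficient : ∀ n f g p, B n (ofG f) (ofG g) p = LinearMap.mul' ℝ (Fn E P G)
    (leftInvOp₂ E P G (PowerSeries.coeff n (F p.1)) (ofG f ⊗ₜ ofG g)) p

/-- Quantizations of `r`, for a parameter space `P` with vectors `ξᵢ`. -/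
structure IsParamQuantization {l : ℕ} (b : Module.Basis (Fin l) ℝ 𝔥) (ξ : Fin l → P)
    (r : P → GroupLieAlgebra 𝓘(ℝ, E) G ⊗[ℝ] GroupLieAlgebra 𝓘(ℝ, E) G)
    (F : P → PowerSeries (UEA₂ (GroupLieAlgebra 𝓘(ℝ, E) G))) : Prop where
  normalized : IsNormalized F
  coeff_zero : ∀ p, PowerSeries.coeff 0 (F p) = 1
  zero_weight : ∀ n p, PowerSeries.coeff n (F p) ∈ zeroWeight 𝔥
  shifted_cocycle : ∀ p,
    PowerSeries.map (comulLeft (𝔤 := GroupLieAlgebra 𝓘(ℝ, E) G)).toRingHom (F p)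
        * taylor12 b ξ F p
      = PowerSeries.map (comulRight (𝔤 := GroupLieAlgebra 𝓘(ℝ, E) G)).toRingHom (F p)
        * taylor23 b ξ F p
  quantization : ∀ p,
    PowerSeries.coeff 1 (F p) - flip (PowerSeries.coeff 1 (F p)) = incl₂ (r p)

/-- The coefficients of a series, as smooth maps of zero weight. -/
def coeffMaps {F : P → PowerSeries (UEA₂ (GroupLieAlgebra 𝓘(ℝ, E) G))}
    (hs : ∀ n, IsSmooth fun p => PowerSeries.coeff n (F p))
    (hz : ∀ n p, PowerSeries.coeff n (F p) ∈ zeroWeight 𝔥) (n : ℕ) :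
    smoothMaps P (zeroWeight 𝔥) := ⟨fun p => PowerSeries.coeff n (F p), hs n, hz n⟩

variable {E' H : Type*} [NormedAddCommGroup E'] [NormedSpace ℝ E'] [FiniteDimensional ℝ E']
  [TopologicalSpace H] [ChartedSpace E' H] [Group H] [LieGroup 𝓘(ℝ, E') ∞ H] {ι : H →* G}
  {l : ℕ} {b : Module.Basis (Fin l) ℝ 𝔥}
  {ξ : Fin l → P} {r : P → GroupLieAlgebra 𝓘(ℝ, E) G ⊗[ℝ] GroupLieAlgebra 𝓘(ℝ, E) G}
  {B : ℕ → Fn E P G →ₗ[ℝ] Fn E P G →ₗ[ℝ] Fn E P G}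
  {F : P → PowerSeries (UEA₂ (GroupLieAlgebra 𝓘(ℝ, E) G))}

namespace IsParamStar

variable [T2Space G] (hB : IsParamStar ι b ξ r B F)
include hB

omit [FiniteDimensional ℝ E'] [TopologicalSpace H] [ChartedSpace E' H] [LieGroup 𝓘(ℝ, E') ∞ H]
  [NormedAddCommGroup E'] [NormedSpace ℝ E']

theorem coeff_zero_eq (p : P) : PowerSeries.coeff 0 (F p) = 1 := by
  rw [← sub_eq_zero]
  refine leftInvOp₂_separating p _ fun f g => ?_
  have h := hB.coefficient 0 f g (p, 1)
  rw [hB.coeff_zero] at h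
  rw [map_sub, LinearMap.sub_apply, map_sub, map_one, Module.End.one_apply, LinearMap.mul'_apply,
    ← evalAt_apply, map_sub, evalAt_apply, evalAt_apply, ← h, sub_self]

/-- The constant function `1` is both a function of `x` and the unit of the product; on it `F⃗(λ)`
acts through the counit, and separation gives the normalization. -/
theorem isNormalized : IsNormalized F where
  smooth := hB.smooth
  left n p := by
    rw [← sub_eq_zero]
    refine leftInvOp_separating p _ fun f => ?_
    have h := hB.coefficient n 1 f (p, 1)
    have h1 : (ofG 1 : Fn E P G) = 1 := rfl
    rw [h1, hB.one_left, mul'_leftInvOp₂_leftSub (tmul_mem_leftSub one_mem_paramFns _),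
      leftInvOp₂_tmul, TensorProduct.map_tmul, map_one (leftInvOp E P G), Module.End.one_apply,
      LinearMap.mul'_apply, one_mul] at h
    rw [map_sub, LinearMap.sub_apply, ← evalAt_apply, map_sub, evalAt_apply, evalAt_apply, ← h]
    split_ifs
    · rw [map_one, Module.End.one_apply, sub_self]
    · rw [map_zero, LinearMap.zero_apply, sub_self]
  right n p := by
    rw [← sub_eq_zero]
    refine leftInvOp_separating p _ fun f => ?_
    have h := hB.coefficient n f 1 (p, 1)
    have h1 : (ofG 1 : Fn E P G) = 1 := rfl
    rw [h1, hB.one_right, mul'_leftInvOp₂_rightSub (tmul_mem_rightSub _ one_mem_paramFns),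
      leftInvOp₂_tmul, TensorProduct.map_tmul, map_one (leftInvOp E P G), Module.End.one_apply,
      LinearMap.mul'_apply, mul_one] at h
    rw [map_sub, LinearMap.sub_apply, ← evalAt_apply, map_sub, evalAt_apply, evalAt_apply, ← h]
    split_ifs
    · rw [map_one, Module.End.one_apply, sub_self]
    · rw [map_zero, LinearMap.zero_apply, sub_self]

/-- On functions of `x` the terms of the Poisson bracket with `∂/∂λⁱ` vanish, and only `r⃗(λ)`
remains. -/
theorem coeff_one_sub_flip (p : P) :
    PowerSeries.coeff 1 (F p) - flip (PowerSeries.coeff 1 (F p)) = incl₂ (r p) := by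
  rw [← sub_eq_zero]
  refine leftInvOp₂_separating p _ fun f g => ?_
  have h := hB.poisson (ofG f) (ofG g) (p, 1)
  have e : ∀ (i : Fin l) (f : C^∞⟮𝓘(ℝ, E), G; 𝓘(ℝ, ℝ), ℝ⟯),
    dOp E G ξ i (ofG f) (p, 1) = 0 := fun i f =>
      DFunLike.congr_fun (partialP_ofG (ξ i) f) ((p, 1) : P × G)
  rw [hB.coefficient, hB.coefficient, mul'_leftInvOp₂_swap _ (ofG f) (ofG g),
    Finset.sum_eq_zero (fun i _ => by rw [e, e, mul_zero, zero_mul, sub_zero]), zero_add] at h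
  rw [map_sub, map_sub, LinearMap.sub_apply, LinearMap.sub_apply, map_sub, map_sub,
    ← evalAt_apply, map_sub, map_sub, evalAt_apply, evalAt_apply, evalAt_apply, h, sub_self]

theorem coefficient_unique {F' : P → PowerSeries (UEA₂ (GroupLieAlgebra 𝓘(ℝ, E) G))}
    (hB' : IsParamStar ι b ξ r B F') : F = F' := by
  funext p
  refine PowerSeries.ext fun n => ?_
  rw [← sub_eq_zero]
  refine leftInvOp₂_separating p _ fun f g => ?_
  have h := hB.coefficient n f g (p, 1)
  rw [hB'.coefficient] at h
  rw [map_sub, LinearMap.sub_apply, map_sub, ← evalAt_apply, map_sub, evalAt_apply, evalAt_apply,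
    h, sub_self]

end IsParamStar

/-- Right translates of functions of `x` are functions of `x`, so invariance of the star product
becomes invariance of the coefficients `Fₙ(λ)` themselves. -/
theorem IsParamStar.zero_weight [T2Space G] (hB : IsParamStar ι b ξ r B F)
    (hι : IsConnectedLieSubgroup (E' := E') ι 𝔥) (n : ℕ) (p : P) :
    PowerSeries.coeff n (F p) ∈ zeroWeight 𝔥 := by
  refine hι.mem_zeroWeight p fun c f g => ?_
  have h := DFunLike.congr_fun (hB.invariant n 1 c (ofG f) (ofG g)) (p, 1)
  let tr : C^∞⟮𝓘(ℝ, E), G; 𝓘(ℝ, ℝ), ℝ⟯ → C^∞⟮𝓘(ℝ, E), G; 𝓘(ℝ, ℝ), ℝ⟯ := fun f =>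
    ⟨fun x => f (1 * x * ι c),
      f.contMDiff.comp ((contMDiff_const.mul contMDiff_id).mul contMDiff_const)⟩
  have e : ∀ f : C^∞⟮𝓘(ℝ, E), G; 𝓘(ℝ, ℝ), ℝ⟯,
    (translateHom 1 (ι c) (ofG f) : Fn E P G) = ofG (tr f) := fun f => rfl
  rw [e, e, translateHom_apply, one_mul, one_mul] at h
  rw [e, e]
  exact (hB.coefficient n (tr f) (tr g) (p, 1)).symm.trans
    (h.trans (hB.coefficient n f g (p, ι c)))

end Star

end DynQuant
end

noncomputable section

namespace DynQuant

/-! ### Star products and shifted cocycles -/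

section Correspondence

variable {E P G : Type*} [NormedAddCommGroup E] [NormedSpace ℝ E] [FiniteDimensional ℝ E]
  [NormedAddCommGroup P] [NormedSpace ℝ P]
  [TopologicalSpace G] [ChartedSpace E G] [Group G] [LieGroup 𝓘(ℝ, E) ∞ G]
  {𝔥 : LieSubalgebra ℝ (GroupLieAlgebra 𝓘(ℝ, E) G)}
  {l : ℕ} (b : Module.Basis (Fin l) ℝ 𝔥) (ξ : Fin l → P)

/-- The bilinear operators of the product defined by a coefficient function. -/
def starBilin (Fs : ℕ → smoothMaps P (zeroWeight 𝔥)) (n : ℕ) :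
    Fn E P G →ₗ[ℝ] Fn E P G →ₗ[ℝ] Fn E P G := TensorProduct.curry (starOp b ξ Fs n)

variable {Fs : ℕ → smoothMaps P (zeroWeight 𝔥)}

theorem starBilin_apply (n : ℕ) (f g : Fn E P G) :
    starBilin b ξ Fs n f g = starOp b ξ Fs n (f ⊗ₜ g) := rfl

omit [FiniteDimensional ℝ E] [Group G] [LieGroup 𝓘(ℝ, E) ∞ G] in
theorem IsBidifferential.ext [FiniteDimensional ℝ E] [FiniteDimensional ℝ P] [T2Space G]
    [IsManifold 𝓘(ℝ, E) ∞ G] {B C : Fn E P G →ₗ[ℝ] Fn E P G →ₗ[ℝ] Fn E P G}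
    (hB : IsBidifferential B) (hC : IsBidifferential C)
    (h : ∀ (a c : C^∞⟮𝓘(ℝ, P), P; 𝓘(ℝ, ℝ), ℝ⟯) (u v : C^∞⟮𝓘(ℝ, E), G; 𝓘(ℝ, ℝ), ℝ⟯),
      B (ofP a * ofG u) (ofP c * ofG v) = C (ofP a * ofG u) (ofP c * ofG v)) : B = C := by
  refine sub_eq_zero.1 ((hB.sub hC).eq_zero (Or.inr le_rfl) (Or.inr le_rfl) fun f hf g hg => ?_)
  rw [LinearMap.sub_apply, LinearMap.sub_apply, sub_eq_zero]
  unfold prodSpan at hf hg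
  induction hf, hg using Submodule.span_induction₂ with
  | mem_mem f g hf hg =>
    obtain ⟨a, u, rfl⟩ := hf
    obtain ⟨c, v, rfl⟩ := hg
    exact h a c u v
  | zero_left g _ => rw [map_zero, map_zero, LinearMap.zero_apply]
  | zero_right f _ => rw [map_zero, map_zero]
  | add_left f f' g _ _ _ h h' =>
    rw [map_add, map_add, LinearMap.add_apply, LinearMap.add_apply, h, h']
  | add_right f g g' _ _ _ h h' => rw [map_add, map_add, h, h']
  | smul_left c f g _ _ h =>
    rw [map_smul, map_smul, LinearMap.smul_apply, LinearMap.smul_apply, h]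
  | smul_right c f g _ _ h => rw [map_smul, map_smul, h]

omit [FiniteDimensional ℝ E] [Group G] [LieGroup 𝓘(ℝ, E) ∞ G] in
theorem mul_mem_paramFns : ∀ f ∈ paramFns E P G, ∀ g ∈ paramFns E P G, f * g ∈ paramFns E P G := by
  rintro _ ⟨a, rfl⟩ _ ⟨c, rfl⟩
  exact ⟨a * c, rfl⟩

omit [FiniteDimensional ℝ E] [Group G] [LieGroup 𝓘(ℝ, E) ∞ G] in
theorem mul_mem_range_ofG : ∀ f ∈ Set.range (ofG : _ → Fn E P G),
    ∀ g ∈ Set.range (ofG : _ → Fn E P G), f * g ∈ Set.range (ofG : _ → Fn E P G) := by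
  rintro _ ⟨a, rfl⟩ _ ⟨c, rfl⟩
  exact ⟨a * c, rfl⟩

theorem theta₃_ofG (f g k : C^∞⟮𝓘(ℝ, E), G; 𝓘(ℝ, ℝ), ℝ⟯) :
    theta₃ b ξ (ofG f ⊗ₜ (ofG g ⊗ₜ ofG k)) = 0 := by
  have e : ∀ (i : Fin l) (f : C^∞⟮𝓘(ℝ, E), G; 𝓘(ℝ, ℝ), ℝ⟯),
    dOp E G ξ i (ofG f) = 0 := fun i f => partialP_ofG _ f
  simp only [theta₃, thetaLeg, LinearMap.add_apply, LinearMap.smul_apply, LinearMap.sum_apply,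
    LinearMap.sub_apply, Module.End.mul_apply, leg_zero_tmul, leg_one_tmul, leg_two_tmul, e,
    TensorProduct.zero_tmul, TensorProduct.tmul_zero, sub_zero, Finset.sum_const_zero, smul_zero,
    add_zero, map_zero]

/-- Only the last summand contributes if `X` vanishes at `v`. -/
theorem sum_eval₃_divPow {X : Module.End ℝ (Fn E P G ⊗[ℝ] (Fn E P G ⊗[ℝ] Fn E P G))}
    {y : Fn E P G ⊗[ℝ] (Fn E P G ⊗[ℝ] Fn E P G)} (hy : X y = 0) (p : P × G) (n : ℕ)
    (u : ℕ → UEA₃ (GroupLieAlgebra 𝓘(ℝ, E) G)) :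
    ∑ qt ∈ Finset.HasAntidiagonal.antidiagonal n, eval₃ (divPow X qt.2 y) p (u qt.1)
      = eval₃ y p (u n) := by
  rw [Finset.sum_eq_single (n, 0)]
  · rw [divPow_zero, Module.End.one_apply]
  · rintro ⟨k, m⟩ hkm hne
    rw [Finset.HasAntidiagonal.mem_antidiagonal] at hkm
    rw [divPow_apply_of_eq_zero hy, if_neg, eval₃_apply, map_zero, map_zero]
    · rfl
    · rintro rfl
      simp_all
  · intro hn
    exact absurd (Finset.HasAntidiagonal.mem_antidiagonal.2 (add_zero n)) hn

variable {E' H : Type*} [NormedAddCommGroup E'] [NormedSpace ℝ E'] [FiniteDimensional ℝ E']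
  [TopologicalSpace H] [ChartedSpace E' H] [Group H] [LieGroup 𝓘(ℝ, E') ∞ H] {ι : H →* G}
  {r : P → GroupLieAlgebra 𝓘(ℝ, E) G ⊗[ℝ] GroupLieAlgebra 𝓘(ℝ, E) G}
  {B : ℕ → Fn E P G →ₗ[ℝ] Fn E P G →ₗ[ℝ] Fn E P G}
  {F : P → PowerSeries (UEA₂ (GroupLieAlgebra 𝓘(ℝ, E) G))}
  [T2Space G] [IsLieAbelian 𝔥]
variable {b ξ}

omit [TopologicalSpace H] in
/-- A star product is determined by its coefficient function. -/
theorem IsParamStar.eq_starBilin [FiniteDimensional ℝ P] (hB : IsParamStar ι b ξ r B F)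
    (hF : ∀ n, (Fs n).1 = fun p => PowerSeries.coeff n (F p)) (n : ℕ) :
    B n = starBilin b ξ Fs n := by
  have hN := hB.isNormalized
  have h0 : ∀ p, (Fs 0).1 p = 1 := fun p =>
    (congrFun (hF 0) p).trans (hB.coeff_zero_eq p)
  -- The generators are the functions of `λ` and the functions of `x`. Associativity of the product
  -- defined by `F` is available at this stage only when an argument is a function of `λ`, as the
  -- cocycle equation is not assumed.
  refine eq_of_eq_on_generators (A := Fn E P G) (B := B) (C := starBilin b ξ Fs)
    (U := paramFns E P G) (V := Set.range ofG) mul_mem_paramFns mul_mem_range_ofG hB.coeff_zero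
    (fun f g => (starOp_zero b ξ h0 _).trans (LinearMap.mul'_apply (R := ℝ))) hB.assoc ?_ ?_ ?_ n
  · intro n f g k h
    have key : ∃ j, f ⊗ₜ (g ⊗ₜ k) ∈ legSub (paramFns E P G) j := by
      rcases h with h | h | h
      · exact ⟨0, tmul_mem_legSub h⟩
      · exact ⟨1, tmul_mem_legSub h⟩
      · exact ⟨2, tmul_mem_legSub h⟩
    obtain ⟨j, hj⟩ := key
    exact starOp_assoc_of_mem_legSub b ξ hF hN n hj
  · rintro n _ (⟨a, rfl⟩ | ⟨u, rfl⟩) _ (⟨c, rfl⟩ | ⟨v, rfl⟩)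
    · rw [hB.pointwise, starBilin_apply, starOp_ofP_ofP b ξ hF hN]
    · ext p
      rw [hB.theta_left, starBilin_apply,
        starOp_leftSub b ξ hF hN n (tmul_mem_leftSub (ofP_mem_paramFns a) _)]
    · ext p
      rw [hB.theta_right, starBilin_apply,
        starOp_rightSub b ξ hF hN n (tmul_mem_rightSub _ (ofP_mem_paramFns c))]
    · ext p
      rw [hB.coefficient, starBilin_apply, starOp_ofG_ofG, coeffOp_apply, hF]
  · intro n h
    refine (hB.bidifferential n).ext (isBidifferential_starOp b ξ Fs n) fun a c u v => ?_
    exact h _ ⟨a, rfl⟩ _ ⟨u, rfl⟩ _ ⟨c, rfl⟩ _ ⟨v, rfl⟩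

/-- Associativity on functions on the group implies the shifted cocycle equation. -/
theorem shifted_cocycle_of_starOp_assoc
    (hF : ∀ n, (Fs n).1 = fun p => PowerSeries.coeff n (F p))
    (hA : ∀ n f g k, ∑ ij ∈ Finset.HasAntidiagonal.antidiagonal n,
        starBilin (E := E) (G := G) b ξ Fs ij.1 (starBilin b ξ Fs ij.2 f g) k
      = ∑ ij ∈ Finset.HasAntidiagonal.antidiagonal n,
        starBilin b ξ Fs ij.1 f (starBilin b ξ Fs ij.2 g k)) (p : P) :
    PowerSeries.map (comulLeft (𝔤 := GroupLieAlgebra 𝓘(ℝ, E) G)).toRingHom (F p)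
        * taylor12 b ξ F p
      = PowerSeries.map (comulRight (𝔤 := GroupLieAlgebra 𝓘(ℝ, E) G)).toRingHom (F p)
        * taylor23 b ξ F p := by
  refine PowerSeries.ext fun n => ?_
  rw [← sub_eq_zero]
  refine leftInvOp₃_separating p _ fun f g k => ?_
  have h := DFunLike.congr_fun (hA n (ofG f) (ofG g) (ofG k)) (p, 1)
  have h' := ((starOp_rTensor b ξ hF n (ofG f ⊗ₜ (ofG g ⊗ₜ ofG k)) (p, 1)).symm.trans h).trans
    (starOp_lTensor b ξ hF n (ofG f ⊗ₜ (ofG g ⊗ₜ ofG k)) (p, 1))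
  -- `θ₁₂ + θ₁₃ + θ₂₃` kills functions of `x`, so the exponential drops out and the bare symbols are
  -- compared.
  rw [sum_eval₃_divPow (theta₃_ofG b ξ f g k) (p, 1) n fun q => PowerSeries.coeff q
      (PowerSeries.map (comulLeft (𝔤 := GroupLieAlgebra 𝓘(ℝ, E) G)).toRingHom (F p)
        * taylor12 b ξ F p),
    sum_eval₃_divPow (theta₃_ofG b ξ f g k) (p, 1) n fun q => PowerSeries.coeff q
      (PowerSeries.map (comulRight (𝔤 := GroupLieAlgebra 𝓘(ℝ, E) G)).toRingHom (F p)
        * taylor23 b ξ F p)] at h'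
  rw [← eval₃_apply, map_sub, h', sub_self]

/-- Rigidity first identifies the star product with the one defined by `F`; its full associativity
then yields the cocycle equation. -/
theorem IsParamStar.isParamQuantization [FiniteDimensional ℝ P] (hB : IsParamStar ι b ξ r B F)
    (hι : IsConnectedLieSubgroup (E' := E') ι 𝔥) : IsParamQuantization b ξ r F where
  normalized := hB.isNormalized
  coeff_zero := hB.coeff_zero_eq
  zero_weight := hB.zero_weight hι
  quantization := hB.coeff_one_sub_flip
  shifted_cocycle := shifted_cocycle_of_starOp_assoc
    (Fs := coeffMaps hB.smooth (hB.zero_weight hι)) (fun _ => rfl) fun n f g k => by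
      simp only [← hB.eq_starBilin (Fs := coeffMaps hB.smooth (hB.zero_weight hι)) fun _ => rfl]
      exact hB.assoc n f g k

omit [T2Space G] in
/-- Every quantization is the coefficient function of a star product. -/
theorem IsParamQuantization.isParamStar (hQ : IsParamQuantization b ξ r F)
    (hι : IsConnectedLieSubgroup (E' := E') ι 𝔥) :
    IsParamStar ι b ξ r (starBilin b ξ (coeffMaps hQ.normalized.smooth hQ.zero_weight)) F where
  bidifferential := isBidifferential_starOp b ξ _
  coeff_zero f g := (starOp_zero b ξ hQ.coeff_zero _).trans (LinearMap.mul'_apply (R := ℝ))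
  assoc n f g k := starOp_assoc b ξ (fun _ => rfl) hQ.shifted_cocycle n (f ⊗ₜ (g ⊗ₜ k))
  one_left := starOp_one_left b ξ (fun _ => rfl) hQ.normalized
  one_right := starOp_one_right b ξ (fun _ => rfl) hQ.normalized
  poisson f g p := by
    rw [← hQ.quantization]
    exact starOp_one_sub_swap b ξ hQ.coeff_zero f g p
  invariant n a c f g := hι.starOp_translateHom b ξ _ n a c f g
  pointwise := starOp_ofP_ofP b ξ (fun _ => rfl) hQ.normalized
  theta_left n f g p := DFunLike.congr_fun (starOp_leftSub b ξ (fun _ => rfl) hQ.normalized n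
    (tmul_mem_leftSub (ofP_mem_paramFns f) _)) p
  theta_right n f g p := DFunLike.congr_fun (starOp_rightSub b ξ (fun _ => rfl) hQ.normalized n
    (tmul_mem_rightSub _ (ofP_mem_paramFns f))) p
  smooth := hQ.normalized.smooth
  coefficient n f g p := DFunLike.congr_fun (starOp_ofG_ofG b ξ n f g) p

theorem IsParamQuantization.existsUnique [FiniteDimensional ℝ P]
    (hQ : IsParamQuantization b ξ r F) (hι : IsConnectedLieSubgroup (E' := E') ι 𝔥) :
    ∃! B, IsParamStar ι b ξ r B F :=
  ⟨_, hQ.isParamStar hι, fun _ hB => funext fun n => hB.eq_starBilin (fun _ => rfl) n⟩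

theorem IsParamStar.apply_eq [FiniteDimensional ℝ P] (hB : IsParamStar ι b ξ r B F)
    (hι : IsConnectedLieSubgroup (E' := E') ι 𝔥) (n : ℕ) (f g : Fn E P G) (p : P × G) :
    B n f g p = LinearMap.mul' ℝ (Fn E P G) ((∑ ij ∈ Finset.HasAntidiagonal.antidiagonal n,
      leftInvOp₂ E P G (PowerSeries.coeff ij.1 (F p.1))
        * divPow (thetaOf (hOp P b) (dOp E G ξ)) ij.2) (f ⊗ₜ g)) p := by
  rw [hB.eq_starBilin (Fs := coeffMaps hB.smooth (hB.zero_weight hι)) (fun _ => rfl),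
    starBilin_apply, starOp_apply, LinearMap.sum_apply, map_sum, ← evalAt_apply, ← evalAt_apply,
    map_sum, map_sum]
  rfl

end Correspondence

end DynQuant
end

noncomputable section

namespace DynQuant

/-! ### The parameter space `𝔥*` -/

instance {V : Type*} [AddCommGroup V] [Module ℝ V] [Module.Finite ℝ V] :
    FiniteDimensional ℝ (DualSpace V) := inferInstanceAs (Module.Finite ℝ (Module.Dual ℝ V))

/-! ### Identities of formal series read coefficientwise -/

section Coefficients

variable {E P G : Type*} [NormedAddCommGroup E] [NormedSpace ℝ E] [FiniteDimensional ℝ E]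
  [NormedAddCommGroup P] [NormedSpace ℝ P]
  [TopologicalSpace G] [ChartedSpace E G] [Group G] [LieGroup 𝓘(ℝ, E) ∞ G]

omit [FiniteDimensional ℝ E] [Group G] [LieGroup 𝓘(ℝ, E) ∞ G] in
theorem biop_coeff_mk (X : ℕ → Module.End ℝ (Fn E P G ⊗[ℝ] Fn E P G)) (n : ℕ) (f g : Fn E P G)
    (p : P × G) : biop (PowerSeries.coeff n (PowerSeries.mk X)) f g p
      = LinearMap.mul' ℝ (Fn E P G) (X n (f ⊗ₜ g)) p := by
  rw [PowerSeries.coeff_mk, biop]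

theorem biop_coeff_map (F : PowerSeries (UEA₂ (GroupLieAlgebra 𝓘(ℝ, E) G))) (n : ℕ)
    (f g : Fn E P G) (p : P × G) :
    biop (PowerSeries.coeff n (PowerSeries.map (leftInvOp₂ E P G).toRingHom F)) f g p
      = LinearMap.mul' ℝ (Fn E P G) (leftInvOp₂ E P G (PowerSeries.coeff n F) (f ⊗ₜ g)) p := by
  rw [PowerSeries.coeff_map, biop]
  rfl

theorem biop_coeff_map_mul_mk (F : PowerSeries (UEA₂ (GroupLieAlgebra 𝓘(ℝ, E) G)))
    (X : ℕ → Module.End ℝ (Fn E P G ⊗[ℝ] Fn E P G)) (n : ℕ) (f g : Fn E P G) (p : P × G) :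
    biop (PowerSeries.coeff n
        (PowerSeries.map (leftInvOp₂ E P G).toRingHom F * PowerSeries.mk X)) f g p
      = LinearMap.mul' ℝ (Fn E P G) ((∑ ij ∈ Finset.HasAntidiagonal.antidiagonal n,
        leftInvOp₂ E P G (PowerSeries.coeff ij.1 F) * X ij.2) (f ⊗ₜ g)) p := by
  simp only [PowerSeries.coeff_mul, PowerSeries.coeff_mk, PowerSeries.coeff_map, biop]
  rfl

theorem map_eq_one_iff {R S : Type*} [Semiring R] [Semiring S] (φ : R →+* S) (F : PowerSeries R) :
    PowerSeries.map φ F = 1 ↔ ∀ n, φ (PowerSeries.coeff n F) = if n = 0 then 1 else 0 := by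
  simp only [PowerSeries.ext_iff, PowerSeries.coeff_map, PowerSeries.coeff_one]

theorem commute_C_iff {R : Type*} [Semiring R] (a : R) (F : PowerSeries R) :
    Commute (PowerSeries.C a) F ↔ ∀ n, Commute a (PowerSeries.coeff n F) := by
  simp only [commute_iff_eq, PowerSeries.ext_iff, PowerSeries.coeff_C_mul,
    PowerSeries.coeff_mul_C]

theorem mem_zeroWeight_iff {𝔥 : LieSubalgebra ℝ (GroupLieAlgebra 𝓘(ℝ, E) G)}
    (v : UEA₂ (GroupLieAlgebra 𝓘(ℝ, E) G)) :
    v ∈ zeroWeight 𝔥 ↔ ∀ h : 𝔥, Commute ((1 : UEA (GroupLieAlgebra 𝓘(ℝ, E) G)) ⊗ₜ[ℝ]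
      incl (h : GroupLieAlgebra 𝓘(ℝ, E) G) + incl (h : GroupLieAlgebra 𝓘(ℝ, E) G) ⊗ₜ[ℝ] 1) v := by
  have e : ∀ X : GroupLieAlgebra 𝓘(ℝ, E) G, (1 : UEA (GroupLieAlgebra 𝓘(ℝ, E) G)) ⊗ₜ[ℝ] incl X
      + incl X ⊗ₜ[ℝ] 1 = comul (incl X) := fun X => by rw [comul_incl, add_comm]
  simp only [e]
  exact ⟨fun hv h => hv h h.2, fun hv h hh => hv ⟨h, hh⟩⟩

end Coefficients

section Dual

variable {E G : Type*} [NormedAddCommGroup E] [NormedSpace ℝ E] [FiniteDimensional ℝ E]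
  [TopologicalSpace G] [ChartedSpace E G] [Group G] [LieGroup 𝓘(ℝ, E) ∞ G]
  {𝔥 : LieSubalgebra ℝ (GroupLieAlgebra 𝓘(ℝ, E) G)} {l : ℕ} {b : Module.Basis (Fin l) ℝ 𝔥}
  {H : Type*} [Group H] {ι : H →* G}
  {r : DualSpace 𝔥 → GroupLieAlgebra 𝓘(ℝ, E) G ⊗[ℝ] GroupLieAlgebra 𝓘(ℝ, E) G}
  {B : ℕ → Fn E (DualSpace 𝔥) G →ₗ[ℝ] Fn E (DualSpace 𝔥) G →ₗ[ℝ] Fn E (DualSpace 𝔥) G}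
  {F : DualSpace 𝔥 → PowerSeries (UEA₂ (GroupLieAlgebra 𝓘(ℝ, E) G))}

/-- For `P = 𝔥*` and `ξᵢ` the dual basis the two notions coincide once the coefficients of `Theta`
and `arrow` are written out; `divPow (thetaOf …) n` is by definition the `n`-th coefficient of
`Theta`. -/
theorem IsCompatible.isParamStar (hB : IsCompatible ι b r B F) :
    IsParamStar ι b (dualVec b) r B F where
  bidifferential := hB.isStarProduct.bidifferential
  coeff_zero := hB.isStarProduct.coeff_zero
  assoc := hB.isStarProduct.assoc
  one_left := hB.isStarProduct.one_left
  one_right := hB.isStarProduct.one_right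
  poisson := hB.isStarProduct.poisson
  invariant := hB.invariant
  pointwise := hB.pointwise
  theta_left n f g p := (hB.theta_left n f g p).trans (biop_coeff_mk _ n _ _ p)
  theta_right n f g p := (hB.theta_right n f g p).trans (biop_coeff_mk _ n _ _ p)
  smooth := hB.smooth
  coefficient n f g p := (hB.coefficient n f g p).trans (biop_coeff_map _ n _ _ p)

theorem IsParamStar.isCompatible (hB : IsParamStar ι b (dualVec b) r B F) :
    IsCompatible ι b r B F where
  isStarProduct :=
    { bidifferential := hB.bidifferential
      coeff_zero := hB.coeff_zero
      assoc := hB.assoc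
      one_left := hB.one_left
      one_right := hB.one_right
      poisson := hB.poisson }
  invariant := hB.invariant
  pointwise := hB.pointwise
  theta_left n f g p := (hB.theta_left n f g p).trans (biop_coeff_mk _ n _ _ p).symm
  theta_right n f g p := (hB.theta_right n f g p).trans (biop_coeff_mk _ n _ _ p).symm
  smooth := hB.smooth
  coefficient n f g p := (hB.coefficient n f g p).trans (biop_coeff_map _ n _ _ p).symm

theorem IsQuantization.isParamQuantization (hF : IsQuantization b r F) :
    IsParamQuantization b (dualVec b) r F where
  normalized :=
    { smooth := hF.smooth
      left := fun n p => (map_eq_one_iff _ _).1 (hF.normal_left p) n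
      right := fun n p => (map_eq_one_iff _ _).1 (hF.normal_right p) n }
  coeff_zero := hF.coeff_zero
  zero_weight n p := (mem_zeroWeight_iff _).2 fun h => (commute_C_iff _ _).1 (hF.zero_weight h p) n
  shifted_cocycle := hF.shifted_cocycle
  quantization := hF.quantization

theorem IsParamQuantization.isQuantization (hF : IsParamQuantization b (dualVec b) r F) :
    IsQuantization b r F where
  smooth := hF.normalized.smooth
  coeff_zero := hF.coeff_zero
  zero_weight h p := (commute_C_iff _ _).2 fun n => (mem_zeroWeight_iff _).1 (hF.zero_weight n p) h
  shifted_cocycle := hF.shifted_cocycle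
  normal_left p := (map_eq_one_iff _ _).2 fun n => hF.normalized.left n p
  normal_right p := (map_eq_one_iff _ _).2 fun n => hF.normalized.right n p
  quantization := hF.quantization

end Dual

end DynQuant
end

theorem mainTheorem4
    {E : Type*} [NormedAddCommGroup E] [NormedSpace ℝ E] [FiniteDimensional ℝ E]
    {G : Type*} [TopologicalSpace G] [T2Space G] [ChartedSpace E G] [Group G]
    [LieGroup 𝓘(ℝ, E) ∞ G]
    {E' : Type*} [NormedAddCommGroup E'] [NormedSpace ℝ E'] [FiniteDimensional ℝ E']
    {H : Type*} [TopologicalSpace H] [ChartedSpace E' H] [CommGroup H] [LieGroup 𝓘(ℝ, E') ∞ H]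
    (𝔥 : LieSubalgebra ℝ (GroupLieAlgebra 𝓘(ℝ, E) G)) [IsLieAbelian 𝔥]
    (ι : H →* G) (hι : DynQuant.IsConnectedLieSubgroup (E' := E') ι 𝔥)
    {l : ℕ} (b : Module.Basis (Fin l) ℝ 𝔥)
    (r : DynQuant.DualSpace 𝔥 → GroupLieAlgebra 𝓘(ℝ, E) G ⊗[ℝ] GroupLieAlgebra 𝓘(ℝ, E) G)
    (hr : DynQuant.IsTriangularRMatrix b r) :
    (∀ B F, DynQuant.IsCompatible ι b r B F →
      DynQuant.IsQuantization b r F ∧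
      ∀ n f g p, B n f g p =
        DynQuant.biop
          (PowerSeries.coeff n (DynQuant.arrow (F p.1) * DynQuant.Theta b)) f g p) ∧
    (∀ F, DynQuant.IsQuantization b r F → ∃! B, DynQuant.IsCompatible ι b r B F) ∧
    (∀ B F F', DynQuant.IsCompatible ι b r B F → DynQuant.IsCompatible ι b r B F' → F = F') := by
  have key : ∀ F, DynQuant.IsQuantization b r F → ∃! B, DynQuant.IsCompatible ι b r B F := by
    intro F hF
    obtain ⟨B, hB, hu⟩ := hF.isParamQuantization.existsUnique hι
    exact ⟨B, hB.isCompatible, fun B' hB' => hu B' hB'.isParamStar⟩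
  refine ⟨fun B F hB => ⟨(hB.isParamStar.isParamQuantization hι).isQuantization, ?_⟩, key,
    fun B F F' hB hB' => hB.isParamStar.coefficient_unique hB'.isParamStar⟩
  exact fun n f g p => (hB.isParamStar.apply_eq hι n f g p).trans
    (DynQuant.biop_coeff_map_mul_mk _ _ n f g p).symm
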